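/- Let $h:[0,+\infty)\to\mathbb R$ be a non-decreasing convex function and $f(x)=e^{h(|x|)}$ for $x\in\mathbb R^2$. For $\tau>0$ let $\varrho_+(\tau)$ and $\varrho_-(\tau)$ be the right and left derivatives of $h$ at $\tau$ and $\varrho=\tfrac12(\varrho_++\varrho_-)$. For a Lebesgue measurable set $F\subset\mathbb R^2$ of locally finite perimeter (i.e. $\chi_F\in BV_{loc}(\mathbb R^2)$) put $V_f(F)=\int_F f\,dx$ and $P_f(F)=\int_{\mathbb R^2}f\,d|D\chi_F|$. Given $v>0$, let $E$ be a minimiser of $P_f$ among all such sets $F$ with $V_f(F)=v$. Assume that $E$ is a bounded open set with $C^{1,1}$ boundary $M=\partial E$ (locally $E$ is one side of the graph of a $C^{1,1}$ function in suitable orthonormal coordinates). Let $n$ be the inner unit normal on $M$ and $t$ the unit tangent such that $(t,n)$ is positively oriented; for $x\in M\setminus\{0\}$ let $\sigma(x)$ be the angle measured anti-clockwise from $x$ to $t(x)$. The curvature $k$ of $M$ is defined by $\ddot\gamma=k\,n$ for local arc-length parametrisations $\gamma$ of $M$ with $\dot\gamma=t$, at the points where $\ddot\gamma$ exists. Assume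 that $E$ is spherical cap symmetric in the sense that $E\setminus\{0\}=E^{sc}$. Here, with $L(\tau)=\mathcal H^1(\{x\in E:|x|=\tau\})$, the set $E^{sc}$ is the union, over all $\tau>0$ with $L(\tau)>0$, of the caps $\{|x|=\tau,\ \langle x,e_1\rangle>\tau\cos\alpha\}$ with $\alpha=L(\tau)/(2\tau)$ if $L(\tau)<2\pi\tau$, and of the whole circles $\{|x|=\tau\}$ if $L(\tau)=2\pi\tau$. Let $\Lambda=\{x\in M\setminus\{0\}:\cos\sigma(x)=0\}$, $$\Lambda_1=\{x\in M:\ \mathcal H^1(\Lambda\cap B(x,\rho))=\mathcal H^1(M\cap B(x,\rho))\text{ for some }\rho>0\},\qquad \Lambda_1^\pm=\{x\in\Lambda_1:\pm\langle x,n(x)\rangle>0\},$$ and suppose that $M\setminus\overline{\Lambda_1}\neq\emptyset$. Then there exists $\lambda\in\mathbb R$ such that (i) $k$ exists and $k+\varrho(|x|)\sin\sigma+\lambda=0$ at $\mathcal H^1$-a.e. $x\in M\setminus\overline{\Lambda_1}$; (ii) $k$ exists and $\varrho_-(|x|)-\lambda\le k\le\varrho_+(|x|)-\lambda$ at every $x\in\Lambda_1^+$;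 (iii) $k$ exists and $-\varrho_+(|x|)-\lambda\le k\le-\varrho_-(|x|)-\lambda$ at every $x\in\Lambda_1^-$. -/

import Mathlib

open Set Filter Topology MeasureTheory

noncomputable section

namespace LogConvexIso

/-- The Euclidean plane. -/
abbrev Plane : Type := EuclideanSpace ℝ (Fin 2)

/-- The first standard basis vector of the plane. -/
def e₁ : Plane := !₂[1, 0]

/-- Anti-clockwise rotation through a right angle. -/
def J (x : Plane) : Plane := !₂[-x 1, x 0]

/-- The identification of the plane with `ℂ`, used only to speak of oriented angles. -/
def toC (x : Plane) : ℂ := ⟨x 0, x 1⟩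

/-! ### Weighted volume, perimeter, and the isoperimetric problem -/

/-- The radial density `f x = exp (h |x|)`. -/
def density (h : ℝ → ℝ) (x : Plane) : ℝ := Real.exp (h ‖x‖)

/-- Divergence of a vector field on the plane. -/
def div (X : Plane → Plane) (x : Plane) : ℝ :=
  ∑ i : Fin 2, (fderiv ℝ X x (EuclideanSpace.single i 1)) i

/-- The distributional derivative of the indicator function of `E` is the vector-valued Radon
measure with polar decomposition `ν μ`; thus `μ` is its total variation measure `|Dχ_E|`. -/
def IsVariationMeasure (E : Set Plane) (μ : Measure Plane) : Prop :=
  IsLocallyFiniteMeasure μ ∧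
    ∃ ν : Plane → Plane, Measurable ν ∧ (∀ᵐ x ∂μ, ‖ν x‖ = 1) ∧
      ∀ X : Plane → Plane, ContDiff ℝ 1 X → HasCompactSupport X →
        ∫ x in E, div X x = -∫ x, inner ℝ (X x) (ν x) ∂μ

/-- `E` is a Lebesgue measurable set of (locally) finite perimeter: its indicator function lies in
`BV_loc`. -/
def FinitePerimeter (E : Set Plane) : Prop :=
  NullMeasurableSet E volume ∧ ∃ μ : Measure Plane, IsVariationMeasure E μ

open Classical in
/-- The total variation measure `|Dχ_E|` (it is unique when it exists). -/
def variationMeasure (E : Set Plane) : Measure Plane :=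
  if hE : ∃ μ : Measure Plane, IsVariationMeasure E μ then hE.choose else 0

/-- The weighted perimeter `P_f(E) = ∫ f d|Dχ_E|`. -/
def perimeter (f : Plane → ℝ) (E : Set Plane) : ENNReal :=
  ∫⁻ x, ENNReal.ofReal (f x) ∂(variationMeasure E)

/-- The weighted volume `V_f(E) = ∫_E f dx`. -/
def weightedVolume (f : Plane → ℝ) (E : Set Plane) : ENNReal :=
  ∫⁻ x in E, ENNReal.ofReal (f x)

/-- The sets admitted in the isoperimetric problem with volume `v`. -/
def Admissible (f : Plane → ℝ) (v : ℝ) (E : Set Plane) : Prop :=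
  FinitePerimeter E ∧ weightedVolume f E = ENNReal.ofReal v

/-- The isoperimetric profile `I_f(v)`. -/
def isoProfile (f : Plane → ℝ) (v : ℝ) : ENNReal :=
  ⨅ (F : Set Plane) (_ : Admissible f v F), perimeter f F

/-- `E` is a minimiser for the weighted isoperimetric problem with volume `v`. -/
def IsMinimiser (f : Plane → ℝ) (v : ℝ) (E : Set Plane) : Prop :=
  Admissible f v E ∧ perimeter f E = isoProfile f v

/-! ### One-sided derivatives of `h` -/

/-- The directional derivative `h'_+(x, v) = lim_{t ↓ 0} (h (x + t v) - h x) / t`. -/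
def dirDeriv (h : ℝ → ℝ) (x v : ℝ) : ℝ :=
  limUnder (𝓝[>] (0 : ℝ)) fun t => (h (x + t * v) - h x) / t

/-- The right derivative of `h`. -/
def rhoPlus (h : ℝ → ℝ) (τ : ℝ) : ℝ := dirDeriv h τ 1

/-- The left derivative of `h`. -/
def rhoMinus (h : ℝ → ℝ) (τ : ℝ) : ℝ := -dirDeriv h τ (-1)

/-- The mean of the one-sided derivatives of `h`. -/
def rho (h : ℝ → ℝ) (τ : ℝ) : ℝ := (1 / 2) * (rhoPlus h τ + rhoMinus h τ)

/-! ### Spherical cap symmetrisation -/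

/-- The length `L(τ)` of the section of `E` by the centred circle of radius `τ`. -/
def sectionLength (E : Set Plane) (τ : ℝ) : ℝ :=
  (Measure.hausdorffMeasure 1 (E ∩ Metric.sphere (0 : Plane) τ)).toReal

open Classical in
/-- The spherical cap of radius `τ` and half-angle `α ∈ (0, π]` about the positive first axis: an
open arc if `α < π` and the whole circle if `α = π`. -/
def sphericalCap (τ α : ℝ) : Set Plane :=
  if α < Real.pi then
    {x | x ∈ Metric.sphere (0 : Plane) τ ∧ ‖x‖ * Real.cos α < inner ℝ x e₁}
  else Metric.sphere (0 : Plane) τ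

/-- The spherical cap symmetral `E^sc`: the union over all `τ > 0` with `L(τ) > 0` of the caps of
radius `τ` with length `2 α τ = L(τ)`. -/
def capSymmetral (E : Set Plane) : Set Plane :=
  ⋃ τ ∈ {τ : ℝ | 0 < τ ∧ 0 < sectionLength E τ}, sphericalCap τ (sectionLength E τ / (2 * τ))

/-! ### Boundary, normal, tangent, angle, curvature -/

/-- `E` has `C^{1,1}` boundary: near each boundary point, in a rotated orthonormal frame
`(e, J e)`, the set is the epigraph of a `C^1` function with Lipschitz derivative. -/
def HasC11Boundary (E : Set Plane) : Prop :=
  ∀ p ∈ frontier E, ∃ (e : Plane) (r : ℝ) (g : ℝ → ℝ) (K : NNReal),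
    ‖e‖ = 1 ∧ 0 < r ∧ ContDiff ℝ 1 g ∧ LipschitzWith K (deriv g) ∧
      E ∩ Metric.ball p r = {x | g (inner ℝ x e) < inner ℝ x (J e)} ∩ Metric.ball p r

/-- `n` is an inner unit normal of `E` at the boundary point `p`: a unit vector that is orthogonal
to the boundary at `p` and points into `E`. -/
def IsInnerNormal (E : Set Plane) (p n : Plane) : Prop :=
  ‖n‖ = 1 ∧
    (fun x : Plane => (inner ℝ (x - p) n : ℝ)) =o[𝓝[frontier E] p] (fun x : Plane => x - p) ∧
    ∀ᶠ s : ℝ in 𝓝[>] 0, p + s • n ∈ E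

open Classical in
/-- The inner unit normal `n(p)`. -/
def innerNormal (E : Set Plane) (p : Plane) : Plane :=
  if hp : ∃ n, IsInnerNormal E p n then hp.choose else 0

/-- The unit tangent `t(p)`, for which `(t(p), n(p))` is positively oriented, that is
`J t(p) = n(p)`. -/
def tangent (E : Set Plane) (p : Plane) : Plane := -J (innerNormal E p)

/-- The angle `σ(p)`, measured anti-clockwise from the position vector `p ≠ 0` to `t(p)`
(a representative modulo `2π`). -/
def sigma (E : Set Plane) (p : Plane) : ℝ := Complex.arg (toC (tangent E p) / toC p)

/-- `γ`, restricted to `(-δ, δ)`, is a `C^1` arc-length parametrisation of a relatively open piece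
of `M`. -/
def IsLocalParam (M : Set Plane) (γ : ℝ → Plane) (δ : ℝ) : Prop :=
  0 < δ ∧ ContDiffOn ℝ 1 γ (Ioo (-δ) δ) ∧ (∀ s ∈ Ioo (-δ) δ, ‖deriv γ s‖ = 1) ∧
    InjOn γ (Ioo (-δ) δ) ∧ ∃ U : Set Plane, IsOpen U ∧ γ '' Ioo (-δ) δ = M ∩ U

/-- The curvature of the boundary of `E` exists at `x` and equals `k`: there is a local arc-length
parametrisation through `x`, with velocity `t(x)` at `x`, that is twice differentiable there with
second derivative `k n(x)`. -/
def HasCurvatureAt (E : Set Plane) (x : Plane) (k : ℝ) : Prop :=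
  ∃ (γ : ℝ → Plane) (δ : ℝ), IsLocalParam (frontier E) γ δ ∧ γ 0 = x ∧
    deriv γ 0 = tangent E x ∧ HasDerivAt (deriv γ) (k • innerNormal E x) 0

/-- The boundary points other than `0` at which `cos σ = 0`. -/
def Lam (E : Set Plane) : Set Plane :=
  {x | x ∈ frontier E ∧ x ≠ 0 ∧ Real.cos (sigma E x) = 0}

/-- The boundary points near which `cos σ = 0` holds `ℋ¹`-almost everywhere. -/
def Lam₁ (E : Set Plane) : Set Plane :=
  {x | x ∈ frontier E ∧ ∃ ρ : ℝ, 0 < ρ ∧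
    Measure.hausdorffMeasure 1 (Lam E ∩ Metric.ball x ρ) =
      Measure.hausdorffMeasure 1 (frontier E ∩ Metric.ball x ρ)}

/-- The part of `Λ₁` on which `⟨x, n⟩ > 0`. -/
def Lam₁Plus (E : Set Plane) : Set Plane := {x | x ∈ Lam₁ E ∧ 0 < inner ℝ x (innerNormal E x)}

/-- The part of `Λ₁` on which `⟨x, n⟩ < 0`. -/
def Lam₁Minus (E : Set Plane) : Set Plane := {x | x ∈ Lam₁ E ∧ inner ℝ x (innerNormal E x) < 0}

end LogConvexIso

end

/-! The proof is a first variation argument in graph charts, made one-sided because `h` may have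
kinks, together with a geometric argument showing that kinks are harmless away from `Λ₁`.

Localisation. The distributional derivative of an indicator is unique and local, and the Gauss–Green
formula on an epigraph identifies it as the length measure of the graph. So replacing the graph
function in a box changes weighted perimeter and volume by explicit one-dimensional integrals
(`Chart.Represents.perimeter_modify`, `Chart.Represents.weightedVolume_modify`), and minimality
becomes an inequality between such integrals for two disjoint boxes (`IsMinimiser.len_add_len_le`).

Multiplier. Under `g + s φ` the area is differentiable, but the length only from the right, since
the density has only one-sided directional derivatives. If a second, disjoint chart restores the
volume and its own length is differentiable from both sides, the inequality `lam * mass φ ≤ lenDeriv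
φ` follows (`mul_div_le_of_constrained_min`, `IsMinimiser.first_variation`). Two-sided
differentiability holds in a chart almost none of whose points lie on circles with a kink of `h` as
radius. Cap symmetry provides such charts: if three boundary points of one circle have distinct
first coordinates, the boundary contains the arc around the middle one, which then belongs to `Λ₁`.
Hence off `Λ₁` a circle meets a chart in finitely many points, and convexity leaves only countably
many kinks. Since `M` is not covered by the closure of `Λ₁`, there are two regular charts with
disjoint boxes. Testing one against the other shows that they give the same multiplier, and every
boundary point lies away from one of them, so the multiplier is global.

Conclusions. In a regular chart the inequality for `φ` and `-φ` is an equality. Integration by parts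
against a Lipschitz coefficient and the fundamental lemma of the calculus of variations give the
equation for `k` almost everywhere, as `sin σ = -⟨x, n⟩ / |x|`. Near a point of `Λ₁` other than the
origin, the boundary is orthogonal to the position vector, hence an arc of a centred circle of some
radius `τ`, with `k = -ε / τ` and `ε` the sign of `⟨x, n⟩`. Pushing the arc outwards and inwards
yields `ϱ₋ + 1/τ ≤ ε λ ≤ ϱ₊ + 1/τ`, which rearranges to (ii) and (iii). -/

namespace LogConvexIso

/-! ### The plane in rotated coordinates -/

@[simp] lemma J_zero (x : Plane) : J x 0 = -x 1 := rfl
@[simp] lemma J_one (x : Plane) : J x 1 = x 0 := rfl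

lemma plane_ext {x y : Plane} (h0 : x 0 = y 0) (h1 : x 1 = y 1) : x = y := by
  ext i; fin_cases i <;> assumption

lemma inner_plane (x y : Plane) : inner ℝ x y = x 0 * y 0 + x 1 * y 1 := by
  simp [PiLp.inner_apply, Fin.sum_univ_two, mul_comm]

lemma norm_sq_plane (x : Plane) : ‖x‖ ^ 2 = x 0 ^ 2 + x 1 ^ 2 := by
  rw [← real_inner_self_eq_norm_sq, inner_plane]; ring

lemma J_J (x : Plane) : J (J x) = -x := plane_ext (by simp) (by simp)

lemma J_neg (x : Plane) : J (-x) = -J x := plane_ext (by simp) (by simp)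

lemma J_add (x y : Plane) : J (x + y) = J x + J y :=
  plane_ext (by simp; ring) (by simp)

lemma J_smul (c : ℝ) (x : Plane) : J (c • x) = c • J x := plane_ext (by simp) (by simp)

lemma norm_J (x : Plane) : ‖J x‖ = ‖x‖ := by
  have : ‖J x‖ ^ 2 = ‖x‖ ^ 2 := by rw [norm_sq_plane, norm_sq_plane]; simp; ring
  exact (pow_left_inj₀ (norm_nonneg _) (norm_nonneg _) two_ne_zero).1 this

@[simp] lemma inner_J_J (x y : Plane) : inner ℝ (J x) (J y) = (inner ℝ x y : ℝ) := by
  simp [inner_plane]; ring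

@[simp] lemma inner_self_J (x : Plane) : inner ℝ x (J x) = (0 : ℝ) := by
  simp [inner_plane]; ring

@[simp] lemma inner_J_self (x : Plane) : inner ℝ (J x) x = (0 : ℝ) := by
  simp [inner_plane]; ring

lemma sq_add_sq_of_norm_one {e : Plane} (he : ‖e‖ = 1) : e 0 ^ 2 + e 1 ^ 2 = 1 := by
  rw [← norm_sq_plane, he]; norm_num

lemma inner_self_one {e : Plane} (he : ‖e‖ = 1) : inner ℝ e e = (1 : ℝ) := by
  rw [real_inner_self_eq_norm_sq, he]; norm_num

/-- The point with coordinates `(u, y)` in the frame `(e, J e)`. -/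
noncomputable def framePoint (e : Plane) (q : ℝ × ℝ) : Plane := q.1 • e + q.2 • J e

lemma inner_framePoint {e : Plane} (he : ‖e‖ = 1) (q : ℝ × ℝ) :
    inner ℝ (framePoint e q) e = q.1 := by
  simp [framePoint, inner_add_left, inner_smul_left, he]

lemma inner_framePoint_J {e : Plane} (he : ‖e‖ = 1) (q : ℝ × ℝ) :
    inner ℝ (framePoint e q) (J e) = q.2 := by
  simp [framePoint, inner_add_left, inner_smul_left, norm_J, he]

lemma framePoint_inner {e : Plane} (he : ‖e‖ = 1) (x : Plane) :
    framePoint e (inner ℝ x e, inner ℝ x (J e)) = x := by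
  have h := sq_add_sq_of_norm_one he
  apply plane_ext
  · simp [framePoint, inner_plane]; linear_combination (x 0) * h
  · simp [framePoint, inner_plane]; linear_combination (x 1) * h

lemma continuous_framePoint (e : Plane) : Continuous (framePoint e) := by
  unfold framePoint; fun_prop

lemma inner_eq_frame {e : Plane} (he : ‖e‖ = 1) (x y : Plane) :
    inner ℝ x y = inner ℝ x e * inner ℝ y e + inner ℝ x (J e) * (inner ℝ y (J e) : ℝ) := by
  have h := sq_add_sq_of_norm_one he
  simp only [inner_plane, J_zero, J_one]
  linear_combination -(x 0 * y 0 + x 1 * y 1) * h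

lemma norm_framePoint_sq {e : Plane} (he : ‖e‖ = 1) (q : ℝ × ℝ) :
    ‖framePoint e q‖ ^ 2 = q.1 ^ 2 + q.2 ^ 2 := by
  rw [← real_inner_self_eq_norm_sq, inner_eq_frame he, inner_framePoint he,
    inner_framePoint_J he]; ring

/-- The frame coordinates as a homeomorphism. -/
noncomputable def frameHomeo (e : Plane) (he : ‖e‖ = 1) : ℝ × ℝ ≃ₜ Plane where
  toFun := framePoint e
  invFun x := (inner ℝ x e, inner ℝ x (J e))
  left_inv q := Prod.ext (inner_framePoint he q) (inner_framePoint_J he q)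
  right_inv x := framePoint_inner he x
  continuous_toFun := continuous_framePoint e
  continuous_invFun := by fun_prop

/-- The frame map is a linear isometry of the plane preceded by the volume-preserving identification
of `ℝ × ℝ` with the plane. -/
lemma measurePreserving_framePoint {e : Plane} (he : ‖e‖ = 1) :
    MeasurePreserving (framePoint e) volume volume := by
  let L : Plane →ₗ[ℝ] Plane :=
    { toFun := fun x => x 0 • e + x 1 • J e
      map_add' := fun x y => by simp only [PiLp.add_apply, add_smul]; abel
      map_smul' := fun c x => by simp [smul_smul, smul_add] }
  have hL : ∀ x, ‖L x‖ = ‖x‖ := fun x => by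
    have : ‖L x‖ ^ 2 = ‖x‖ ^ 2 := by
      rw [norm_sq_plane x]; exact norm_framePoint_sq he (x 0, x 1)
    exact (pow_left_inj₀ (norm_nonneg _) (norm_nonneg _) two_ne_zero).1 this
  let R : Plane →ₗᵢ[ℝ] Plane := ⟨L, hL⟩
  let R' : Plane ≃ₗᵢ[ℝ] Plane := R.toLinearIsometryEquiv rfl
  have h1 := R'.measurePreserving
  have h2 := PiLp.volume_preserving_toLp (Fin 2)
  have h3 := (volume_preserving_finTwoArrow ℝ).symm
  have := h1.comp (h2.comp h3)
  exact this

/-- The divergence is a trace, hence independent of the orthonormal frame. -/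
lemma div_eq_frame {e : Plane} (he : ‖e‖ = 1) (X : Plane → Plane) (x : Plane) :
    div X x = inner ℝ (fderiv ℝ X x e) e + inner ℝ (fderiv ℝ X x (J e)) (J e) := by
  have h := sq_add_sq_of_norm_one he
  set A := fderiv ℝ X x
  set a : Plane := EuclideanSpace.single 0 1
  set b : Plane := EuclideanSpace.single 1 1
  have e1 : e = e 0 • a + e 1 • b := plane_ext (by simp [a, b]) (by simp [a, b])
  have e2 : J e = (-e 1) • a + e 0 • b := plane_ext (by simp [a, b]) (by simp [a, b])
  have hA1 : A e = e 0 • A a + e 1 • A b := by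
    conv_lhs => rw [e1]
    simp
  have hA2 : A (J e) = (-e 1) • A a + e 0 • A b := by
    rw [e2]; simp
  simp only [div, Fin.sum_univ_two, hA1, hA2, inner_plane]
  change A a 0 + A b 1 = _
  simp
  linear_combination -(A a 0 + A b 1) * h

end LogConvexIso

namespace LogConvexIso

/-! ### Uniqueness and locality of the variation measure -/

/-- `ν μ` is the polar decomposition of the distributional derivative of the indicator of `E`. -/
def IsPolar (E : Set Plane) (μ : Measure Plane) (ν : Plane → Plane) : Prop :=
  IsLocallyFiniteMeasure μ ∧ Measurable ν ∧ (∀ᵐ x ∂μ, ‖ν x‖ = 1) ∧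
    ∀ X : Plane → Plane, ContDiff ℝ 1 X → HasCompactSupport X →
      ∫ x in E, div X x = -∫ x, inner ℝ (X x) (ν x) ∂μ

lemma isVariationMeasure_iff {E : Set Plane} {μ : Measure Plane} :
    IsVariationMeasure E μ ↔ ∃ ν, IsPolar E μ ν := by
  constructor
  · rintro ⟨h, ν, h1, h2, h3⟩; exact ⟨ν, h, h1, h2, h3⟩
  · rintro ⟨ν, h, h1, h2, h3⟩; exact ⟨h, ν, h1, h2, h3⟩

lemma div_eq_zero_of_notMem_tsupport {X : Plane → Plane} {x : Plane} (hx : x ∉ tsupport X) :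
    div X x = 0 := by
  have : fderiv ℝ X x = 0 := by
    by_contra h
    exact hx (support_fderiv_subset ℝ h)
  simp [div, this]

lemma div_add {X Y : Plane → Plane} {x : Plane} (hX : DifferentiableAt ℝ X x)
    (hY : DifferentiableAt ℝ Y x) : div (fun z => X z + Y z) x = div X x + div Y x := by
  simp [div, fderiv_fun_add hX hY]; ring

lemma continuous_div {X : Plane → Plane} (hX : ContDiff ℝ 1 X) : Continuous (div X) := by
  have := hX.continuous_fderiv one_ne_zero
  unfold div
  fun_prop

lemma hasCompactSupport_div {X : Plane → Plane} (hX : HasCompactSupport X) :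
    HasCompactSupport (div X) :=
  HasCompactSupport.intro hX fun _ hx => div_eq_zero_of_notMem_tsupport hx

lemma integrable_div {X : Plane → Plane} (hX : ContDiff ℝ 1 X) (hc : HasCompactSupport X) :
    Integrable (div X) :=
  (continuous_div hX).integrable_of_hasCompactSupport (hasCompactSupport_div hc)

lemma setIntegral_div_inter {E U : Set Plane} (hE : NullMeasurableSet E) {X : Plane → Plane}
    (hX : tsupport X ⊆ U) : ∫ x in E, div X x = ∫ x in E ∩ U, div X x := by
  refine setIntegral_eq_of_subset_of_ae_sdiff_eq_zero hE inter_subset_left ?_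
  refine Eventually.of_forall fun x hx => div_eq_zero_of_notMem_tsupport fun h => ?_
  exact hx.2 ⟨hx.1, hX h⟩

lemma setIntegral_div_congr {E F U : Set Plane} (hE : NullMeasurableSet E)
    (hF : NullMeasurableSet F) (h : E ∩ U = F ∩ U) {X : Plane → Plane} (hX : tsupport X ⊆ U) :
    ∫ x in E, div X x = ∫ x in F, div X x := by
  rw [setIntegral_div_inter hE hX, setIntegral_div_inter hF hX, h]

lemma integrable_inner_unit {μ : Measure Plane} [IsLocallyFiniteMeasure μ] {ν X : Plane → Plane}
    (hν : Measurable ν) (h1 : ∀ᵐ x ∂μ, ‖ν x‖ = 1) (hX : Continuous X)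
    (hc : HasCompactSupport X) : Integrable (fun x => (inner ℝ (X x) (ν x) : ℝ)) μ := by
  refine (hX.integrable_of_hasCompactSupport (μ := μ) hc).mono
    (by fun_prop) ?_
  filter_upwards [h1] with x hx
  calc ‖(inner ℝ (X x) (ν x) : ℝ)‖ ≤ ‖X x‖ * ‖ν x‖ := norm_inner_le_norm _ _
    _ = ‖X x‖ := by rw [hx, mul_one]

/-- The field is the density of the vector measure `ν μ` with respect to `m`. Its norm is `a` almost
everywhere, and the integral of `a` over a set is the `μ`-measure of that set. -/
lemma locallyIntegrable_density_smul {m μ : Measure Plane} [IsLocallyFiniteMeasure μ]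
    {a : Plane → ENNReal} (ha : Measurable a) (hafin : ∀ᵐ x ∂m, a x < ⊤) {ν : Plane → Plane}
    (hν : Measurable ν) (hν1 : ∀ᵐ x ∂m, a x ≠ 0 → ‖ν x‖ = 1) (hμd : m.withDensity a = μ) :
    LocallyIntegrable (fun x => (a x).toReal • ν x) m := by
  intro x
  obtain ⟨s, hs, hsf⟩ := μ.finiteAt_nhds x
  refine ⟨toMeasurable μ s, mem_of_superset hs (subset_toMeasurable _ _), ?_, ?_⟩
  · have := ha.ennreal_toReal
    exact (by fun_prop : Measurable fun x => (a x).toReal • ν x).aestronglyMeasurable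
  · rw [HasFiniteIntegral]
    calc ∫⁻ x in toMeasurable μ s, ‖(a x).toReal • ν x‖ₑ ∂m
        ≤ ∫⁻ x in toMeasurable μ s, a x ∂m := by
          refine lintegral_mono_ae (ae_restrict_of_ae ?_)
          filter_upwards [hafin, hν1] with x h1 h2
          rw [enorm_smul]
          by_cases h0 : a x = 0
          · simp [h0]
          · rw [← ofReal_norm (ν x), h2 h0, Real.enorm_eq_ofReal ENNReal.toReal_nonneg,
              ENNReal.ofReal_toReal h1.ne]; simp
      _ = μ (toMeasurable μ s) := by
          rw [← withDensity_apply _ (measurableSet_toMeasurable _ _), hμd]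
      _ < ⊤ := by rw [measure_toMeasurable]; exact hsf

lemma isLocallyFiniteMeasure_add {μ κ : Measure Plane} [IsLocallyFiniteMeasure μ]
    [IsLocallyFiniteMeasure κ] : IsLocallyFiniteMeasure (μ + κ) := by
  refine ⟨fun x => ?_⟩
  obtain ⟨s, hs, hsf⟩ := μ.finiteAt_nhds x
  obtain ⟨t, ht, htf⟩ := κ.finiteAt_nhds x
  refine ⟨s ∩ t, inter_mem hs ht, ?_⟩
  rw [Measure.add_apply]
  exact ENNReal.add_lt_top.2 ⟨(measure_mono inter_subset_left).trans_lt hsf,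
    (measure_mono inter_subset_right).trans_lt htf⟩

/-- The distributional derivative of an indicator is determined on an open set by the trace of the
set there. -/
theorem IsPolar.congr_on {E F U : Set Plane} (hE : NullMeasurableSet E)
    (hF : NullMeasurableSet F) (hU : IsOpen U) (hEF : E ∩ U = F ∩ U) {μ κ : Measure Plane}
    {ν ξ : Plane → Plane} (hμ : IsPolar E μ ν) (hκ : IsPolar F κ ξ) :
    μ.restrict U = κ.restrict U ∧ ∀ᵐ x ∂μ.restrict U, ν x = ξ x := by
  obtain ⟨hμf, hνm, hν1, hμX⟩ := hμ
  obtain ⟨hκf, hξm, hξ1, hκX⟩ := hκ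
  -- Both vector measures have densities with respect to the sum `m`, so they can be compared
  -- pointwise.
  set m : Measure Plane := μ + κ with hm
  have hmf : IsLocallyFiniteMeasure m := isLocallyFiniteMeasure_add
  have hμm : μ ≪ m := Measure.le_add_right le_rfl |>.absolutelyContinuous
  have hκm : κ ≪ m := Measure.le_add_left le_rfl |>.absolutelyContinuous
  set a := μ.rnDeriv m
  set b := κ.rnDeriv m
  have hμd : m.withDensity a = μ := Measure.withDensity_rnDeriv_eq _ _ hμm
  have hκd : m.withDensity b = κ := Measure.withDensity_rnDeriv_eq _ _ hκm
  have ha : Measurable a := Measure.measurable_rnDeriv _ _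
  have hb : Measurable b := Measure.measurable_rnDeriv _ _
  have hafin : ∀ᵐ x ∂m, a x < ⊤ := Measure.rnDeriv_lt_top _ _
  have hbfin : ∀ᵐ x ∂m, b x < ⊤ := Measure.rnDeriv_lt_top _ _
  -- unit vectors almost everywhere for the common measure
  have hν1' : ∀ᵐ x ∂m, a x ≠ 0 → ‖ν x‖ = 1 := by
    rw [← hμd] at hν1
    exact (ae_withDensity_iff ha).1 hν1
  have hξ1' : ∀ᵐ x ∂m, b x ≠ 0 → ‖ξ x‖ = 1 := by
    rw [← hκd] at hξ1
    exact (ae_withDensity_iff hb).1 hξ1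
  set w : Plane → Plane := fun x => (a x).toReal • ν x - (b x).toReal • ξ x with hw
  have hwm : Measurable w := by
    have := ha.ennreal_toReal; have := hb.ennreal_toReal; fun_prop
  have hla := locallyIntegrable_density_smul ha hafin hνm hν1' hμd
  have hlb := locallyIntegrable_density_smul hb hbfin hξm hξ1' hκd
  -- A field `g • v` with `g` supported in `U` sees only the common trace of `E` and `F`, so the
  -- difference of the densities integrates to zero against every such `g`.
  have hw0 : ∀ᵐ x ∂m, x ∈ U → w x = 0 := by
    refine hU.ae_eq_zero_of_integral_contDiff_smul_eq_zero
      ((hla.sub hlb).locallyIntegrableOn U) fun g hg hgc hgU => ?_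
    have hia : Integrable (fun x => g x • ((a x).toReal • ν x)) m :=
      hla.integrable_smul_left_of_hasCompactSupport hg.continuous hgc
    have hib : Integrable (fun x => g x • ((b x).toReal • ξ x)) m :=
      hlb.integrable_smul_left_of_hasCompactSupport hg.continuous hgc
    have key : ∫ x, g x • ((a x).toReal • ν x) ∂m = ∫ x, g x • ((b x).toReal • ξ x) ∂m := by
      refine ext_inner_left ℝ fun v => ?_
      have hXs : ContDiff ℝ 1 (fun x => g x • v) := by
        have : ContDiff ℝ 1 g := hg.of_le (by exact_mod_cast le_top)
        fun_prop
      have hXc : HasCompactSupport (fun x => g x • v) := hgc.smul_right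
      have hXU : tsupport (fun x => g x • v) ⊆ U :=
        (closure_mono (Function.support_smul_subset_left g (fun _ => v))).trans hgU
      have h1 := hμX _ hXs hXc
      have h2 := hκX _ hXs hXc
      rw [setIntegral_div_congr hE hF hEF hXU, h2, neg_inj] at h1
      rw [← integral_inner hia, ← integral_inner hib]
      have e1 : ∫ x, inner ℝ v (g x • ((a x).toReal • ν x)) ∂m
          = ∫ x, inner ℝ (g x • v) (ν x) ∂μ := by
        rw [← hμd, integral_withDensity_eq_integral_toReal_smul ha hafin]
        refine integral_congr_ae (Eventually.of_forall fun x => ?_)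
        simp [inner_smul_left, inner_smul_right]; ring
      have e2 : ∫ x, inner ℝ v (g x • ((b x).toReal • ξ x)) ∂m
          = ∫ x, inner ℝ (g x • v) (ξ x) ∂κ := by
        rw [← hκd, integral_withDensity_eq_integral_toReal_smul hb hbfin]
        refine integral_congr_ae (Eventually.of_forall fun x => ?_)
        simp [inner_smul_left, inner_smul_right]; ring
      rw [e1, e2, h1]
    simp only [smul_sub, hw]
    rw [integral_sub hia hib, key, sub_self]
  -- Taking norms separates the scalar densities from the directions, because the directions are
  -- unit vectors wherever the densities do not vanish.
  have hab : ∀ᵐ x ∂m, x ∈ U → a x = b x ∧ (a x ≠ 0 → ν x = ξ x) := by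
    filter_upwards [hw0, hν1', hξ1', hafin, hbfin] with x h0 h1 h2 h3 h4 hx
    have h5 : (a x).toReal • ν x = (b x).toReal • ξ x := sub_eq_zero.1 (h0 hx)
    have h6 : ∀ (c : ENNReal) (n : Plane), c < ⊤ → (c ≠ 0 → ‖n‖ = 1) →
        ‖c.toReal • n‖ = c.toReal := by
      intro c n hc hn
      rw [norm_smul, Real.norm_of_nonneg ENNReal.toReal_nonneg]
      by_cases hc0 : c = 0
      · simp [hc0]
      · rw [hn hc0, mul_one]
    have h7 : (a x).toReal = (b x).toReal := by
      rw [← h6 _ _ h3 h1, h5, h6 _ _ h4 h2]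
    refine ⟨(ENNReal.toReal_eq_toReal_iff' h3.ne h4.ne).1 h7, fun ha0 => ?_⟩
    rw [← h7] at h5
    exact smul_right_injective _ (ENNReal.toReal_ne_zero.2 ⟨ha0, h3.ne⟩) h5
  have hab' : ∀ᵐ x ∂m.restrict U, a x = b x ∧ (a x ≠ 0 → ν x = ξ x) :=
    (ae_restrict_iff' hU.measurableSet).2 hab
  constructor
  · rw [← hμd, ← hκd, restrict_withDensity hU.measurableSet, restrict_withDensity hU.measurableSet]
    exact withDensity_congr_ae (hab'.mono fun x hx => hx.1)
  · rw [← hμd, restrict_withDensity hU.measurableSet, ae_withDensity_iff ha]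
    exact hab'.mono fun x hx => hx.2

theorem IsVariationMeasure.restrict_congr {E F U : Set Plane} (hE : NullMeasurableSet E)
    (hF : NullMeasurableSet F) (hU : IsOpen U) (hEF : E ∩ U = F ∩ U) {μ κ : Measure Plane}
    (hμ : IsVariationMeasure E μ) (hκ : IsVariationMeasure F κ) :
    μ.restrict U = κ.restrict U := by
  obtain ⟨ν, hν⟩ := isVariationMeasure_iff.1 hμ
  obtain ⟨ξ, hξ⟩ := isVariationMeasure_iff.1 hκ
  exact (hν.congr_on hE hF hU hEF hξ).1

/-- Locality with `U` the whole plane is uniqueness. The arbitrary choice in the definition of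
`variationMeasure` can thus be computed from any polar decomposition. -/
theorem IsVariationMeasure.eq_variationMeasure {E : Set Plane} (hE : NullMeasurableSet E)
    {μ : Measure Plane} (hμ : IsVariationMeasure E μ) : variationMeasure E = μ := by
  have h : ∃ μ, IsVariationMeasure E μ := ⟨μ, hμ⟩
  have h1 : IsVariationMeasure E (variationMeasure E) := by
    rw [variationMeasure, dif_pos h]; exact h.choose_spec
  simpa using h1.restrict_congr hE hE isOpen_univ rfl hμ

lemma FinitePerimeter.isVariationMeasure {E : Set Plane} (hE : FinitePerimeter E) :
    IsVariationMeasure E (variationMeasure E) := by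
  rw [variationMeasure, dif_pos hE.2]; exact hE.2.choose_spec

lemma isVariationMeasure_empty : IsVariationMeasure (∅ : Set Plane) 0 :=
  ⟨inferInstance, fun _ => 0, measurable_const, by simp, by simp⟩

lemma variationMeasure_compl_closure {E : Set Plane} (hE : FinitePerimeter E) :
    variationMeasure E (closure E)ᶜ = 0 := by
  have h := hE.isVariationMeasure.restrict_congr hE.1 MeasurableSet.empty.nullMeasurableSet
    isClosed_closure.isOpen_compl (U := (closure E)ᶜ)
    (by rw [empty_inter]; exact disjoint_iff_inter_eq_empty.1
          (disjoint_compl_right.mono_left subset_closure)) isVariationMeasure_empty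
  rw [Measure.restrict_zero] at h
  exact Measure.restrict_eq_zero.1 h

/-- Finiteness is needed later to cancel the perimeter of the minimiser in `ENNReal`. The variation
measure is carried by the compact closure, on which the weight is bounded. -/
lemma perimeter_lt_top {E : Set Plane} (hE : FinitePerimeter E) (hb : Bornology.IsBounded E)
    {f : Plane → ℝ} (hf : Continuous f) : perimeter f E < ⊤ := by
  have : IsLocallyFiniteMeasure (variationMeasure E) := hE.isVariationMeasure.1
  have hK : IsCompact (closure E) := hb.isCompact_closure
  have h1 : (variationMeasure E).restrict (closure E) = variationMeasure E :=
    Measure.restrict_eq_self_of_ae_mem (by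
      rw [ae_iff]; exact variationMeasure_compl_closure hE)
  obtain ⟨C, hC⟩ := hK.exists_bound_of_continuousOn hf.continuousOn
  rw [perimeter, ← h1]
  refine (setLIntegral_mono' hK.measurableSet (g := fun _ => ENNReal.ofReal C)
    fun x hx => ENNReal.ofReal_le_ofReal ((le_abs_self _).trans (hC x hx))).trans_lt ?_
  rw [setLIntegral_const]
  exact ENNReal.mul_lt_top ENNReal.ofReal_lt_top hK.measure_lt_top

end LogConvexIso

namespace LogConvexIso

/-! ### Gluing sets of finite perimeter -/

lemma exists_cutoff {K U : Set Plane} (hK : IsCompact K) (hU : IsOpen U) (hKU : K ⊆ U) :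
    ∃ η : Plane → ℝ, ContDiff ℝ 1 η ∧ tsupport η ⊆ U ∧ tsupport (fun x => 1 - η x) ⊆ Kᶜ := by
  obtain ⟨L, hL, hKL, hLU⟩ := exists_compact_between hK hU hKU
  obtain ⟨f, h1, h0, -⟩ := exists_contMDiffMap_one_nhds_of_subset_interior
    (n := 1) (modelWithCornersSelf ℝ Plane) hK.isClosed hKL
  refine ⟨f, f.contMDiff.contDiff, ?_, ?_⟩
  · refine (closure_minimal (fun x hx => ?_) hL.isClosed).trans hLU
    by_contra h
    exact hx (h0 x h)
  · intro x hx hxK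
    have h2 : ∀ᶠ y in 𝓝 x, f y = 1 := h1.filter_mono (nhds_le_nhdsSet hxK)
    refine (notMem_tsupport_iff_eventuallyEq.2 ?_) hx
    filter_upwards [h2] with y hy
    simp [hy]

/-- A vector field splits into one supported in an open set `U` and one supported off a given
compact subset of `U`. -/
lemma exists_splitting {K U : Set Plane} (hK : IsCompact K) (hU : IsOpen U) (hKU : K ⊆ U)
    {X : Plane → Plane} (hX : ContDiff ℝ 1 X) (hc : HasCompactSupport X) :
    ∃ Y Z : Plane → Plane, ContDiff ℝ 1 Y ∧ ContDiff ℝ 1 Z ∧ HasCompactSupport Y ∧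
      HasCompactSupport Z ∧ tsupport Y ⊆ U ∧ tsupport Z ⊆ Kᶜ ∧ (∀ x, X x = Y x + Z x) := by
  obtain ⟨η, hη, hηU, hηK⟩ := exists_cutoff hK hU hKU
  have hη' : ContDiff ℝ 1 (fun x => 1 - η x) := by fun_prop
  refine ⟨fun x => η x • X x, fun x => (1 - η x) • X x, hη.smul hX, hη'.smul hX,
    hc.mono (Function.support_smul_subset_right η X),
    hc.mono (Function.support_smul_subset_right (fun x => 1 - η x) X),
    (closure_mono (Function.support_smul_subset_left η X)).trans hηU,
    (closure_mono (Function.support_smul_subset_left (fun x => 1 - η x) X)).trans hηK, fun x => ?_⟩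
  rw [← add_smul]; simp

lemma div_eq_add {X Y Z : Plane → Plane} (hY : ContDiff ℝ 1 Y) (hZ : ContDiff ℝ 1 Z)
    (h : ∀ x, X x = Y x + Z x) : div X = fun x => div Y x + div Z x := by
  ext x
  rw [← div_add (hY.differentiable one_ne_zero x) (hZ.differentiable one_ne_zero x)]
  exact congrArg (fun W => div W x) (funext h)

open Classical in
/-- A set that coincides with `G` on `U` and with `F` off a compact subset of `U` has as variation
measure the concatenation of those of `F` and `G`. -/
theorem IsVariationMeasure.glue {F G U K : Set Plane} (hF : NullMeasurableSet F)
    (hG : NullMeasurableSet G) (hU : IsOpen U) (hK : IsCompact K) (hKU : K ⊆ U)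
    (hFG : F ∩ (U \ K) = G ∩ (U \ K)) {μ m : Measure Plane} (hμ : IsVariationMeasure F μ)
    (hm : IsVariationMeasure G m) :
    IsVariationMeasure (F \ U ∪ G ∩ U) (μ.restrict Uᶜ + m.restrict U) := by
  obtain ⟨ν, hν⟩ := isVariationMeasure_iff.1 hμ
  obtain ⟨ξ, hξ⟩ := isVariationMeasure_iff.1 hm
  have hVo : IsOpen (U \ K) := hU.sdiff hK.isClosed
  obtain ⟨hμm, hνξ⟩ := hν.congr_on hF hG hVo hFG hξ
  obtain ⟨hμf, hνm, hν1, hνX⟩ := hν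
  obtain ⟨hmf, hξm, hξ1, hξX⟩ := hξ
  have hUm := hU.measurableSet
  have hF' : NullMeasurableSet (F \ U ∪ G ∩ U) :=
    (hF.diff hUm.nullMeasurableSet).union (hG.inter hUm.nullMeasurableSet)
  refine isVariationMeasure_iff.2 ⟨U.piecewise ξ ν, isLocallyFiniteMeasure_add,
    hξm.piecewise hUm hνm, ?_, ?_⟩
  · rw [ae_add_measure_iff, ae_restrict_iff' hUm.compl, ae_restrict_iff' hUm]
    constructor
    · filter_upwards [hν1] with x hx h
      rwa [piecewise_eq_of_notMem _ _ _ h]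
    · filter_upwards [hξ1] with x hx h
      rwa [piecewise_eq_of_mem _ _ _ h]
  have hint : ∀ X : Plane → Plane, ContDiff ℝ 1 X → HasCompactSupport X →
      ∫ x, inner ℝ (X x) (U.piecewise ξ ν x) ∂(μ.restrict Uᶜ + m.restrict U) =
        (∫ x in Uᶜ, inner ℝ (X x) (ν x) ∂μ) + ∫ x in U, inner ℝ (X x) (ξ x) ∂m := by
    intro X hX hc
    have e1 : (fun x => (inner ℝ (X x) (U.piecewise ξ ν x) : ℝ)) =ᵐ[μ.restrict Uᶜ]
        fun x => inner ℝ (X x) (ν x) := by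
      filter_upwards [ae_restrict_mem hUm.compl] with x hx
      rw [piecewise_eq_of_notMem _ _ _ hx]
    have e2 : (fun x => (inner ℝ (X x) (U.piecewise ξ ν x) : ℝ)) =ᵐ[m.restrict U]
        fun x => inner ℝ (X x) (ξ x) := by
      filter_upwards [ae_restrict_mem hUm] with x hx
      rw [piecewise_eq_of_mem _ _ _ hx]
    rw [integral_add_measure, integral_congr_ae e1, integral_congr_ae e2]
    · exact (integrable_inner_unit hνm hν1 hX.continuous hc).restrict.congr e1.symm
    · exact (integrable_inner_unit hξm hξ1 hX.continuous hc).restrict.congr e2.symm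
  intro X hX hc
  rw [hint X hX hc]
  -- The field `Y` lives in `U` and sees only `G`. The field `Z` lives off `K`, where the glued set
  -- is `F`, so it sees only `F`; its integral over `U` may be taken with either measure because the
  -- polar decompositions agree on `U \ K`.
  obtain ⟨Y, Z, hYs, hZs, hYc, hZc, hYU, hZK, hXYZ⟩ := exists_splitting hK hU hKU hX hc
  have hsplit : ∀ (κ : Measure Plane) (n : Plane → Plane) (A : Set Plane),
      IsLocallyFiniteMeasure κ → Measurable n → (∀ᵐ x ∂κ, ‖n x‖ = 1) →
      ∫ x in A, inner ℝ (X x) (n x) ∂κ =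
        (∫ x in A, inner ℝ (Y x) (n x) ∂κ) + ∫ x in A, inner ℝ (Z x) (n x) ∂κ := by
    intro κ n A _ hn hn1
    rw [← integral_add (integrable_inner_unit hn hn1 hYs.continuous hYc).restrict
      (integrable_inner_unit hn hn1 hZs.continuous hZc).restrict]
    exact integral_congr_ae (Eventually.of_forall fun x => by
      simp only; rw [← inner_add_left, ← hXYZ])
  rw [hsplit μ ν _ hμf hνm hν1, hsplit m ξ _ hmf hξm hξ1, div_eq_add hYs hZs hXYZ,
    integral_add (integrable_div hYs hYc).restrict (integrable_div hZs hZc).restrict]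
  -- the part supported in `U`
  have hY1 : ∫ x in F \ U ∪ G ∩ U, div Y x = -∫ x in U, inner ℝ (Y x) (ξ x) ∂m := by
    rw [setIntegral_div_congr hF' hG (U := U) _ hYU, hξX Y hYs hYc,
      setIntegral_eq_integral_of_forall_compl_eq_zero]
    · intro x hx
      rw [image_eq_zero_of_notMem_tsupport fun h => hx (hYU h), inner_zero_left]
    · ext x; simp only [mem_inter_iff, mem_union, Set.mem_sdiff]; tauto
  have hY2 : ∫ x in Uᶜ, inner ℝ (Y x) (ν x) ∂μ = 0 := by
    refine setIntegral_eq_zero_of_forall_eq_zero fun x hx => ?_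
    rw [image_eq_zero_of_notMem_tsupport fun h => hx (hYU h), inner_zero_left]
  -- the part supported off `K`
  have hZ1 : ∫ x in F \ U ∪ G ∩ U, div Z x = -∫ x, inner ℝ (Z x) (ν x) ∂μ := by
    rw [setIntegral_div_congr hF' hF (U := Kᶜ) _ hZK, hνX Z hZs hZc]
    ext x
    have := Set.ext_iff.1 hFG x
    simp only [mem_inter_iff, mem_union, Set.mem_sdiff, mem_compl_iff] at this ⊢
    tauto
  have hZ0 : ∀ (κ : Measure Plane) (n : Plane → Plane),
      ∫ x in U, inner ℝ (Z x) (n x) ∂κ = ∫ x in U \ K, inner ℝ (Z x) (n x) ∂κ := by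
    intro κ n
    refine setIntegral_eq_of_subset_of_forall_sdiff_eq_zero hUm sdiff_subset fun x hx => ?_
    have : x ∈ K := by by_contra h; exact hx.2 ⟨hx.1, h⟩
    rw [image_eq_zero_of_notMem_tsupport fun h => hZK h this, inner_zero_left]
  have hZ2 : ∫ x in U, inner ℝ (Z x) (ξ x) ∂m = ∫ x in U, inner ℝ (Z x) (ν x) ∂μ := by
    rw [hZ0, hZ0, ← hμm]
    refine integral_congr_ae ?_
    filter_upwards [hνξ] with x hx
    rw [hx]
  have hZ3 : (∫ x in Uᶜ, inner ℝ (Z x) (ν x) ∂μ) + ∫ x in U, inner ℝ (Z x) (ν x) ∂μ =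
      ∫ x, inner ℝ (Z x) (ν x) ∂μ := by
    rw [add_comm]
    exact integral_add_compl hUm (integrable_inner_unit hνm hν1 hZs.continuous hZc)
  rw [hY1, hY2, hZ1, hZ2]
  linarith

end LogConvexIso

namespace LogConvexIso

/-! ### Epigraphs -/

/-- The epigraph of `g` in the frame `(e, J e)`. -/
def epigraph (e : Plane) (g : ℝ → ℝ) : Set Plane :=
  {x | g (inner ℝ x e) < (inner ℝ x (J e) : ℝ)}

/-- The parametrisation of the graph of `g` in the frame `(e, J e)`. -/
noncomputable def graphPoint (e : Plane) (g : ℝ → ℝ) (u : ℝ) : Plane := framePoint e (u, g u)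

/-- The speed of the graph parametrisation. -/
noncomputable def graphSpeed (g : ℝ → ℝ) (u : ℝ) : ℝ := √(1 + deriv g u ^ 2)

/-- The unit normal of the graph, pointing into the epigraph. -/
noncomputable def graphNormal (e : Plane) (g : ℝ → ℝ) (u : ℝ) : Plane :=
  framePoint e (-(deriv g u / graphSpeed g u), 1 / graphSpeed g u)

/-- The length measure of the graph of `g`. -/
noncomputable def graphMeasure (e : Plane) (g : ℝ → ℝ) : Measure Plane :=
  (volume.withDensity fun u => ENNReal.ofReal (graphSpeed g u)).map (graphPoint e g)

lemma graphSpeed_pos (g : ℝ → ℝ) (u : ℝ) : 0 < graphSpeed g u :=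
  Real.sqrt_pos.2 (by positivity)

lemma graphSpeed_sq (g : ℝ → ℝ) (u : ℝ) : graphSpeed g u ^ 2 = 1 + deriv g u ^ 2 :=
  Real.sq_sqrt (by positivity)

lemma continuous_graphSpeed {g : ℝ → ℝ} (hg : ContDiff ℝ 1 g) : Continuous (graphSpeed g) := by
  have := hg.continuous_deriv_one
  unfold graphSpeed; fun_prop

lemma continuous_graphPoint {e : Plane} {g : ℝ → ℝ} (hg : Continuous g) :
    Continuous (graphPoint e g) :=
  (continuous_framePoint e).comp (by fun_prop)

lemma continuous_graphNormal {e : Plane} {g : ℝ → ℝ} (hg : ContDiff ℝ 1 g) :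
    Continuous (graphNormal e g) := by
  have h1 := hg.continuous_deriv_one
  have h2 := continuous_graphSpeed hg
  have h3 : ∀ u, graphSpeed g u ≠ 0 := fun u => (graphSpeed_pos g u).ne'
  exact (continuous_framePoint e).comp (by fun_prop (disch := exact h3 _))

lemma inner_graphPoint {e : Plane} (he : ‖e‖ = 1) (g : ℝ → ℝ) (u : ℝ) :
    inner ℝ (graphPoint e g u) e = u := inner_framePoint he _

lemma inner_graphPoint_J {e : Plane} (he : ‖e‖ = 1) (g : ℝ → ℝ) (u : ℝ) :
    inner ℝ (graphPoint e g u) (J e) = g u := inner_framePoint_J he _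

lemma norm_graphNormal {e : Plane} (he : ‖e‖ = 1) (g : ℝ → ℝ) (u : ℝ) :
    ‖graphNormal e g u‖ = 1 := by
  have h1 := graphSpeed_pos g u
  have h2 := graphSpeed_sq g u
  have : ‖graphNormal e g u‖ ^ 2 = 1 ^ 2 := by
    rw [graphNormal, norm_framePoint_sq he]
    field_simp
    linarith
  exact (pow_left_inj₀ (norm_nonneg _) zero_le_one two_ne_zero).1 this

lemma measurable_epigraph {e : Plane} {g : ℝ → ℝ} (hg : Continuous g) :
    MeasurableSet (epigraph e g) :=
  (isOpen_lt (by fun_prop) (by fun_prop)).measurableSet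

/-- Shear coordinates adapted to the graph of `g`. -/
noncomputable def shearHomeo (g : ℝ → ℝ) (hg : Continuous g) : ℝ × ℝ ≃ₜ ℝ × ℝ where
  toFun q := (q.1, q.2 + g q.1)
  invFun q := (q.1, q.2 - g q.1)
  left_inv q := by simp
  right_inv q := by simp
  continuous_toFun := by fun_prop
  continuous_invFun := by fun_prop

/-- On each vertical line the shear is a translation. -/
lemma measurePreserving_shear {g : ℝ → ℝ} (hg : Continuous g) :
    MeasurePreserving (shearHomeo g hg) volume volume := by
  refine (MeasurePreserving.id volume).skew_product (μc := volume)
    (g := fun u z => z + g u) (by fun_prop) ?_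
  exact Eventually.of_forall fun u => (measurePreserving_add_right volume (g u)).map_eq

lemma lintegral_graphMeasure {e : Plane} {g : ℝ → ℝ} (hg : ContDiff ℝ 1 g) {F : Plane → ENNReal}
    (hF : Measurable F) : ∫⁻ x, F x ∂graphMeasure e g =
      ∫⁻ u, ENNReal.ofReal (graphSpeed g u) * F (graphPoint e g u) := by
  have h1 := (continuous_graphPoint (e := e) hg.continuous).measurable
  have h2 := (continuous_graphSpeed hg).measurable
  rw [graphMeasure, lintegral_map hF h1]
  exact lintegral_withDensity_eq_lintegral_mul _ h2.ennreal_ofReal (hF.comp h1)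

lemma integral_graphMeasure {e : Plane} {g : ℝ → ℝ} (hg : ContDiff ℝ 1 g) {F : Plane → ℝ}
    (hF : Measurable F) : ∫ x, F x ∂graphMeasure e g =
      ∫ u, graphSpeed g u * F (graphPoint e g u) := by
  have h1 := (continuous_graphPoint (e := e) hg.continuous).measurable
  have h2 := (continuous_graphSpeed hg).measurable
  rw [graphMeasure, integral_map h1.aemeasurable hF.aestronglyMeasurable,
    integral_withDensity_eq_integral_toReal_smul h2.ennreal_ofReal
      (Eventually.of_forall fun _ => ENNReal.ofReal_lt_top)]
  refine integral_congr_ae (Eventually.of_forall fun u => ?_)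
  simp [ENNReal.toReal_ofReal (graphSpeed_pos g u).le]

lemma isLocallyFiniteMeasure_graphMeasure {e : Plane} (he : ‖e‖ = 1) {g : ℝ → ℝ}
    (hg : ContDiff ℝ 1 g) : IsLocallyFiniteMeasure (graphMeasure e g) := by
  refine ⟨fun x => ⟨{y | (inner ℝ y e : ℝ) ∈ Ioo (inner ℝ x e - 1) (inner ℝ x e + 1)}, ?_, ?_⟩⟩
  · exact (isOpen_Ioo.preimage (by fun_prop : Continuous fun y : Plane => (inner ℝ y e : ℝ))).mem_nhds
      ⟨by simp, by simp⟩
  · have hm : MeasurableSet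
        {y : Plane | (inner ℝ y e : ℝ) ∈ Ioo (inner ℝ x e - 1) (inner ℝ x e + 1 : ℝ)} :=
      (isOpen_Ioo.preimage (by fun_prop : Continuous fun y : Plane => (inner ℝ y e : ℝ))).measurableSet
    rw [graphMeasure, Measure.map_apply (continuous_graphPoint hg.continuous).measurable hm]
    have : graphPoint e g ⁻¹' {y : Plane | (inner ℝ y e : ℝ) ∈
        Ioo (inner ℝ x e - 1) (inner ℝ x e + 1 : ℝ)} = Ioo (inner ℝ x e - 1) (inner ℝ x e + 1 : ℝ) := by
      ext u; simp [inner_graphPoint he]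
    rw [this, withDensity_apply _ measurableSet_Ioo]
    refine (lintegral_mono_set Ioo_subset_Icc_self).trans_lt ?_
    exact ((continuous_graphSpeed hg).continuousOn.integrableOn_compact isCompact_Icc).lintegral_lt_top

/-- The Gauss–Green formula on an epigraph. -/
theorem isPolar_epigraph {e : Plane} (he : ‖e‖ = 1) {g : ℝ → ℝ} (hg : ContDiff ℝ 1 g) :
    IsPolar (epigraph e g) (graphMeasure e g) (fun x => graphNormal e g (inner ℝ x e)) := by
  have hN : Continuous fun x : Plane => graphNormal e g (inner ℝ x e) :=
    (continuous_graphNormal hg).comp (by fun_prop)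
  refine ⟨isLocallyFiniteMeasure_graphMeasure he hg, hN.measurable,
    Eventually.of_forall fun x => norm_graphNormal he g _, fun X hX hc => ?_⟩
  rw [integral_graphMeasure hg (by have := hX.continuous; fun_prop)]
  -- With `z` the height above the graph, the epigraph becomes the half-plane `z > 0`.
  set Ψ : ℝ × ℝ ≃ₜ Plane := (shearHomeo g hg.continuous).trans (frameHomeo e he) with hΨ
  have hΨmp : MeasurePreserving Ψ volume volume :=
    (measurePreserving_framePoint he).comp (measurePreserving_shear hg.continuous)
  have hΨapp : ∀ u z, Ψ (u, z) = framePoint e (u, z + g u) := fun _ _ => rfl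
  have hΨu : ∀ u z, HasDerivAt (fun u => Ψ (u, z)) (e + deriv g u • J e) u := by
    intro u z
    simp only [hΨapp, framePoint]
    have h1 : HasDerivAt (fun u => u • e) ((1 : ℝ) • e) u := (hasDerivAt_id u).smul_const e
    have h2 : HasDerivAt (fun u => (z + g u) • J e) (deriv g u • J e) u :=
      ((((hg.differentiable one_ne_zero) u).hasDerivAt).const_add z).smul_const (J e)
    simpa using! h1.add h2
  have hΨz : ∀ u z, HasDerivAt (fun z => Ψ (u, z)) (J e) z := by
    intro u z
    simp only [hΨapp, framePoint]
    have h2 : HasDerivAt (fun z => (z + g u) • J e) ((1 : ℝ) • J e) z :=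
      ((hasDerivAt_id z).add_const (g u)).smul_const (J e)
    simpa using! h2.const_add (u • e)
  have hXd : ∀ x, HasFDerivAt X (fderiv ℝ X x) x := fun x =>
    ((hX.differentiable one_ne_zero) x).hasFDerivAt
  have hDX := hX.continuous_fderiv one_ne_zero
  have hg' := hg.continuous_deriv_one
  have hΨc := Ψ.continuous
  set D : ℝ × ℝ → Plane →L[ℝ] Plane := fun q => fderiv ℝ X (Ψ q) with hD
  have hDc : Continuous D := hDX.comp hΨc
  have hDs : HasCompactSupport D := (hc.fderiv ℝ).comp_homeomorph Ψ
  have hXs : HasCompactSupport (fun q => X (Ψ q)) := hc.comp_homeomorph Ψ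
  have hint : ∀ F : ℝ × ℝ → ℝ, Continuous F → (∀ q, D q = 0 → F q = 0) → Integrable F := by
    intro F hF h0
    refine hF.integrable_of_hasCompactSupport (hDs.mono fun q hq => ?_)
    exact fun h => hq (h0 q h)
  -- The divergence is `P1 - P2 + P3`. Here `P1` is a derivative in `u` and integrates to zero along
  -- horizontal lines, while `P2` and `P3` are derivatives in `z`, up to the factor `deriv g`, and
  -- leave boundary terms at `z = 0`. Only the continuity of `deriv g` is used.
  set P1 : ℝ × ℝ → ℝ := fun q => inner ℝ (D q (e + deriv g q.1 • J e)) e with hP1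
  set P2 : ℝ × ℝ → ℝ := fun q => deriv g q.1 * inner ℝ (D q (J e)) e with hP2
  set P3 : ℝ × ℝ → ℝ := fun q => inner ℝ (D q (J e)) (J e) with hP3
  have i1 : Integrable P1 := hint _ (by rw [hP1]; fun_prop) (by intro q h; simp [hP1, h])
  have i2 : Integrable P2 := hint _ (by rw [hP2]; fun_prop) (by intro q h; simp [hP2, h])
  have i3 : Integrable P3 := hint _ (by rw [hP3]; fun_prop) (by intro q h; simp [hP3, h])
  have hdiv : ∀ q, div X (Ψ q) = P1 q - P2 q + P3 q := by
    intro q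
    rw [div_eq_frame he]
    simp only [hP1, hP2, hP3, hD, map_add, map_smul, inner_add_left, inner_smul_left]
    simp
  have hpre : Ψ ⁻¹' epigraph e g = univ ×ˢ Ioi 0 := by
    ext ⟨u, z⟩
    simp [epigraph, hΨapp, inner_framePoint he, inner_framePoint_J he]
  rw [← hΨmp.setIntegral_preimage_emb Ψ.measurableEmbedding, hpre]
  simp only [hdiv]
  have hr : (volume : Measure (ℝ × ℝ)) = (volume : Measure ℝ).prod volume := rfl
  have hr2 : (volume : Measure (ℝ × ℝ)).restrict (univ ×ˢ Ioi 0)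
      = (volume : Measure ℝ).prod (volume.restrict (Ioi 0)) := by
    rw [hr, ← Measure.prod_restrict, Measure.restrict_univ]
  have j1 := i1.restrict (s := univ ×ˢ Ioi 0)
  have j2 := i2.restrict (s := univ ×ˢ Ioi 0)
  have j3 := i3.restrict (s := univ ×ˢ Ioi 0)
  have hadd : ∫ q in univ ×ˢ Ioi (0 : ℝ), (P1 q - P2 q + P3 q) =
      (∫ q in univ ×ˢ Ioi (0 : ℝ), P1 q) - (∫ q in univ ×ˢ Ioi (0 : ℝ), P2 q) +
        ∫ q in univ ×ˢ Ioi (0 : ℝ), P3 q := by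
    rw [← integral_sub j1 j2]
    exact integral_add (j1.sub j2) j3
  rw [hadd]
  rw [hr2] at j1 j2 j3 ⊢
  -- the three iterated integrals
  have hz : ∀ (v : Plane) (u z : ℝ), HasDerivAt (fun z => (inner ℝ (X (Ψ (u, z))) v : ℝ))
      (inner ℝ (D (u, z) (J e)) v) z := by
    intro v u z
    have h1 := (hXd (Ψ (u, z))).comp_hasDerivAt z (hΨz u z)
    simpa using! h1.inner ℝ (hasDerivAt_const z v)
  have huu : ∀ (v : Plane) (u z : ℝ), HasDerivAt (fun u => (inner ℝ (X (Ψ (u, z))) v : ℝ))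
      (inner ℝ (D (u, z) (e + deriv g u • J e)) v) u := by
    intro v u z
    have h1 := (hXd (Ψ (u, z))).comp_hasDerivAt u (hΨu u z)
    simpa using! h1.inner ℝ (hasDerivAt_const u v)
  have hemb1 : ∀ u : ℝ, Topology.IsClosedEmbedding (fun z : ℝ => (u, z)) := fun u =>
    Topology.IsClosedEmbedding.of_continuous_injective_isClosedMap (by fun_prop)
      (fun a b h => by simpa using h) (isClosedMap_prodMk_left u)
  have hemb2 : ∀ z : ℝ, Topology.IsClosedEmbedding (fun u : ℝ => (u, z)) := fun z =>
    Topology.IsClosedEmbedding.of_continuous_injective_isClosedMap (by fun_prop)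
      (fun a b h => by simpa using h) (isClosedMap_prodMk_right z)
  have hzint : ∀ (v : Plane) (u : ℝ),
      ∫ z in Ioi (0 : ℝ), inner ℝ (D (u, z) (J e)) v = -(inner ℝ (X (Ψ (u, 0))) v : ℝ) := by
    intro v u
    have hcs : HasCompactSupport (fun z => (inner ℝ (X (Ψ (u, z))) v : ℝ)) :=
      (hXs.comp_isClosedEmbedding (hemb1 u)).mono fun z hz' h => hz' (by
        have : X (Ψ (u, z)) = 0 := h
        simp [this])
    have hcd : ContDiff ℝ 1 (fun z => (inner ℝ (X (Ψ (u, z))) v : ℝ)) := by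
      refine contDiff_one_iff_deriv.2 ⟨fun z => (hz v u z).differentiableAt, ?_⟩
      rw [show deriv (fun z => (inner ℝ (X (Ψ (u, z))) v : ℝ)) = _ from
        funext fun z => (hz v u z).deriv]
      fun_prop
    have := hcs.integral_Ioi_deriv_eq hcd 0
    rw [← this]
    exact integral_congr_ae (Eventually.of_forall fun z => (hz v u z).deriv.symm)
  have k1 : ∫ q, P1 q ∂((volume : Measure ℝ).prod (volume.restrict (Ioi 0))) = 0 := by
    rw [integral_prod_symm _ j1]
    refine integral_eq_zero_of_ae (Eventually.of_forall fun z => ?_)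
    have hcs : HasCompactSupport (fun u => (inner ℝ (X (Ψ (u, z))) e : ℝ)) :=
      (hXs.comp_isClosedEmbedding (hemb2 z)).mono fun u hu' h => hu' (by
        have : X (Ψ (u, z)) = 0 := h
        simp [this])
    have hcs' : HasCompactSupport (fun u => P1 (u, z)) :=
      (hDs.comp_isClosedEmbedding (hemb2 z)).mono fun u hu' h => hu' (by
        have : D (u, z) = 0 := h
        simp [hP1, this])
    refine integral_eq_zero_of_hasDerivAt_of_integrable (fun u => huu e u z) ?_ ?_
    · exact Continuous.integrable_of_hasCompactSupport (by rw [hP1]; fun_prop) hcs'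
    · have hXc := hX.continuous
      exact Continuous.integrable_of_hasCompactSupport (by fun_prop) hcs
  have k2 : ∫ q, P2 q ∂((volume : Measure ℝ).prod (volume.restrict (Ioi 0))) =
      ∫ u, -(deriv g u * inner ℝ (X (graphPoint e g u)) e) := by
    rw [integral_prod _ j2]
    refine integral_congr_ae (Eventually.of_forall fun u => ?_)
    simp only [hP2]
    rw [integral_const_mul, hzint e u, hΨapp]
    simp [graphPoint]
  have k3 : ∫ q, P3 q ∂((volume : Measure ℝ).prod (volume.restrict (Ioi 0))) =
      ∫ u, -(inner ℝ (X (graphPoint e g u)) (J e) : ℝ) := by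
    rw [integral_prod _ j3]
    refine integral_congr_ae (Eventually.of_forall fun u => ?_)
    simp only [hP3]
    rw [hzint (J e) u, hΨapp]
    simp [graphPoint]
  have hgs : HasCompactSupport (fun u => X (graphPoint e g u)) := by
    have h0 : (fun u => X (graphPoint e g u)) = (fun q => X (Ψ q)) ∘ (fun u => (u, (0 : ℝ))) := by
      ext1 u; simp [hΨapp, graphPoint]
    rw [h0]; exact hXs.comp_isClosedEmbedding (hemb2 0)
  have hgc : Continuous (fun u => X (graphPoint e g u)) :=
    hX.continuous.comp (continuous_graphPoint hg.continuous)
  have l2 : Integrable fun u => -(deriv g u * (inner ℝ (X (graphPoint e g u)) e : ℝ)) := by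
    refine Continuous.integrable_of_hasCompactSupport (hg'.mul (hgc.inner continuous_const)).neg
      (hgs.mono fun u hu h => hu ?_)
    have : X (graphPoint e g u) = 0 := h
    simp [this]
  have l3 : Integrable fun u => -(inner ℝ (X (graphPoint e g u)) (J e) : ℝ) := by
    refine Continuous.integrable_of_hasCompactSupport (hgc.inner continuous_const).neg (hgs.mono fun u hu h => hu ?_)
    have : X (graphPoint e g u) = 0 := h
    simp [this]
  rw [k1, k2, k3, zero_sub, neg_add_eq_sub, ← integral_sub l3 l2, ← integral_neg]
  refine integral_congr_ae (Eventually.of_forall fun u => ?_)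
  have hs := (graphSpeed_pos g u).ne'
  simp only [inner_graphPoint he, graphNormal, framePoint, inner_add_right, inner_smul_right]
  field_simp
  ring

end LogConvexIso

namespace LogConvexIso

/-! ### Charts and local modifications -/

/-- A box in rotated coordinates together with a `C^{1,1}` graph crossing it. -/
structure Chart where
  e : Plane
  g : ℝ → ℝ
  K : NNReal
  (a b c d : ℝ)
  norm_e : ‖e‖ = 1
  contDiff : ContDiff ℝ 1 g
  lip : LipschitzWith K (deriv g)
  a_lt_b : a < b
  mapsTo : ∀ u ∈ Icc a b, g u ∈ Ioo c d

/-- The open box of a chart. -/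
def Chart.box (C : Chart) : Set Plane :=
  {x | (inner ℝ x C.e : ℝ) ∈ Ioo C.a C.b ∧ (inner ℝ x (J C.e) : ℝ) ∈ Ioo C.c C.d}

/-- Inside the box of the chart, the set `E` is the epigraph. -/
def Chart.Represents (C : Chart) (E : Set Plane) : Prop :=
  E ∩ C.box = epigraph C.e C.g ∩ C.box

/-- A `C^1` function that differs from the graph function only on a compact part of the base, with
graph crossing the box. -/
def Chart.IsVariant (C : Chart) (k : ℝ → ℝ) : Prop :=
  ContDiff ℝ 1 k ∧ (∀ u ∈ Icc C.a C.b, k u ∈ Ioo C.c C.d) ∧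
    ∃ T, IsCompact T ∧ T ⊆ Ioo C.a C.b ∧ ∀ u, u ∉ T → k u = C.g u

/-- The set obtained from `E` by replacing the epigraph in the box by that of `k`. -/
def Chart.modify (C : Chart) (E : Set Plane) (k : ℝ → ℝ) : Set Plane :=
  E \ C.box ∪ epigraph C.e k ∩ C.box

/-- The weighted length of the graph of `k` in the box. -/
noncomputable def Chart.len (C : Chart) (f : Plane → ℝ) (k : ℝ → ℝ) : ℝ :=
  ∫ u in C.a..C.b, f (graphPoint C.e k u) * graphSpeed k u

/-- The weighted area of the epigraph of `k` in the box. -/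
noncomputable def Chart.area (C : Chart) (f : Plane → ℝ) (k : ℝ → ℝ) : ℝ :=
  ∫ u in C.a..C.b, ∫ y in (k u)..C.d, f (framePoint C.e (u, y))

variable {C : Chart} {E : Set Plane} {k : ℝ → ℝ} {f : Plane → ℝ}

lemma Chart.isOpen_box (C : Chart) : IsOpen C.box :=
  (isOpen_Ioo.preimage (by fun_prop : Continuous fun y : Plane => (inner ℝ y C.e : ℝ))).inter
    (isOpen_Ioo.preimage (by fun_prop : Continuous fun y : Plane => (inner ℝ y (J C.e) : ℝ)))

lemma Chart.isVariant_self (C : Chart) : C.IsVariant C.g :=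
  ⟨C.contDiff, C.mapsTo, ∅, isCompact_empty, empty_subset _, fun _ _ => rfl⟩

lemma Chart.framePoint_mem_box {q : ℝ × ℝ} :
    framePoint C.e q ∈ C.box ↔ q.1 ∈ Ioo C.a C.b ∧ q.2 ∈ Ioo C.c C.d := by
  simp only [Chart.box, mem_ofPred_eq, inner_framePoint C.norm_e, inner_framePoint_J C.norm_e]

/-- The epigraphs differ only between the two graphs over `T`. The vertical segments joining the
graphs there sweep out a compact set, which stays in the box because `(c, d)` is convex. -/
lemma Chart.IsVariant.exists_compact (hk : C.IsVariant k) : ∃ K, IsCompact K ∧ K ⊆ C.box ∧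
    epigraph C.e C.g ∩ (C.box \ K) = epigraph C.e k ∩ (C.box \ K) := by
  obtain ⟨hks, hkm, T, hT, hTI, hTk⟩ := hk
  set Φ : ℝ × ℝ → Plane := fun q => framePoint C.e (q.1, (1 - q.2) * C.g q.1 + q.2 * k q.1) with hΦ
  have hΦc : Continuous Φ := (continuous_framePoint C.e).comp (by
    have := C.contDiff.continuous; have := hks.continuous; fun_prop)
  have hmem : ∀ x : Plane, ∀ θ ∈ Icc (0 : ℝ) 1, (inner ℝ x C.e : ℝ) ∈ T →
      (inner ℝ x (J C.e) : ℝ) =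
        (1 - θ) * C.g (inner ℝ x C.e) + θ * k (inner ℝ x C.e) → x ∈ Φ '' (T ×ˢ Icc 0 1) := by
    intro x θ hθ hxT hx
    refine ⟨(inner ℝ x C.e, θ), ⟨hxT, hθ⟩, ?_⟩
    simp only [hΦ]
    rw [← hx, framePoint_inner C.norm_e]
  refine ⟨Φ '' (T ×ˢ Icc 0 1), (hT.prod isCompact_Icc).image hΦc, ?_, ?_⟩
  · rintro _ ⟨⟨u, θ⟩, ⟨hu, hθ⟩, rfl⟩
    simp only [hΦ]
    have hu' := hTI hu
    refine Chart.framePoint_mem_box.2 ⟨hu', ?_⟩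
    exact convex_Ioo C.c C.d (C.mapsTo u (Ioo_subset_Icc_self hu'))
      (hkm u (Ioo_subset_Icc_self hu')) (by linarith [hθ.2] : (0 : ℝ) ≤ 1 - θ) hθ.1 (by ring)
  · ext x
    simp only [mem_inter_iff, and_congr_left_iff, epigraph, mem_ofPred_eq]
    rintro ⟨-, hxK⟩
    by_cases hxT : (inner ℝ x C.e : ℝ) ∈ T
    swap
    · rw [hTk _ hxT]
    set u : ℝ := inner ℝ x C.e
    set y : ℝ := inner ℝ x (J C.e)
    constructor
    · intro h1
      by_contra h2
      rw [not_lt] at h2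
      have h3 : 0 < k u - C.g u := by linarith
      refine hxK (hmem x ((y - C.g u) / (k u - C.g u)) ⟨by apply div_nonneg <;> linarith, ?_⟩ hxT ?_)
      · rw [div_le_one h3]; linarith
      · change y = _
        field_simp; ring
    · intro h1
      by_contra h2
      rw [not_lt] at h2
      have h3 : 0 < C.g u - k u := by linarith
      refine hxK (hmem x ((C.g u - y) / (C.g u - k u)) ⟨by apply div_nonneg <;> linarith, ?_⟩ hxT ?_)
      · rw [div_le_one h3]; linarith
      · change y = _
        field_simp; ring

lemma Chart.Represents.isVariationMeasure_modify (hC : C.Represents E) (hk : C.IsVariant k)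
    (hE : FinitePerimeter E) : IsVariationMeasure (C.modify E k)
      ((variationMeasure E).restrict C.boxᶜ + (graphMeasure C.e k).restrict C.box) := by
  obtain ⟨K, hK, hKB, hKe⟩ := hk.exists_compact
  refine hE.isVariationMeasure.glue hE.1 (measurable_epigraph hk.1.continuous).nullMeasurableSet
    C.isOpen_box hK hKB ?_ (isVariationMeasure_iff.2 ⟨_, isPolar_epigraph C.norm_e hk.1⟩)
  rw [← hKe]
  ext x
  have := Set.ext_iff.1 hC x
  simp only [mem_inter_iff, Set.mem_sdiff] at this ⊢
  tauto

lemma Chart.nullMeasurableSet_modify (hk : Continuous k) (hE : NullMeasurableSet E) :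
    NullMeasurableSet (C.modify E k) :=
  (hE.diff C.isOpen_box.measurableSet.nullMeasurableSet).union
    ((measurable_epigraph hk).nullMeasurableSet.inter C.isOpen_box.measurableSet.nullMeasurableSet)

lemma Chart.Represents.finitePerimeter_modify (hC : C.Represents E) (hk : C.IsVariant k)
    (hE : FinitePerimeter E) : FinitePerimeter (C.modify E k) :=
  ⟨Chart.nullMeasurableSet_modify hk.1.continuous hE.1, _, hC.isVariationMeasure_modify hk hE⟩

/-! ### Weighted perimeter and volume of a local modification. -/

lemma Chart.IsVariant.setLIntegral_box (hk : C.IsVariant k) (hf : Continuous f)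
    (hf0 : ∀ x, 0 ≤ f x) : ∫⁻ x in C.box, ENNReal.ofReal (f x) ∂graphMeasure C.e k =
      ENNReal.ofReal (C.len f k) := by
  have hB := C.isOpen_box.measurableSet
  have hgp := continuous_graphPoint (e := C.e) hk.1.continuous
  have hsp := continuous_graphSpeed hk.1
  rw [← lintegral_indicator hB, lintegral_graphMeasure hk.1
    ((hf.measurable.ennreal_ofReal).indicator hB), Chart.len,
    intervalIntegral.integral_of_le C.a_lt_b.le, integral_Ioc_eq_integral_Ioo,
    ofReal_integral_eq_lintegral_ofReal, ← lintegral_indicator measurableSet_Ioo]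
  · refine lintegral_congr fun u => ?_
    by_cases hu : u ∈ Ioo C.a C.b
    · have : graphPoint C.e k u ∈ C.box :=
        Chart.framePoint_mem_box.2 ⟨hu, hk.2.1 u (Ioo_subset_Icc_self hu)⟩
      rw [indicator_of_mem this, indicator_of_mem hu, mul_comm, ENNReal.ofReal_mul (hf0 _)]
    · have : graphPoint C.e k u ∉ C.box := fun h => hu (Chart.framePoint_mem_box.1 h).1
      rw [indicator_of_notMem this, indicator_of_notMem hu, mul_zero]
  · exact (((hf.comp hgp).mul hsp).continuousOn.integrableOn_compact isCompact_Icc).mono_set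
      Ioo_subset_Icc_self
  · exact Eventually.of_forall fun u => mul_nonneg (hf0 _) (graphSpeed_pos _ _).le

/-- Off the box the variation measure is that of `E`; in the box both are graph measures, by
locality. The balance is written with sums because subtraction in `ENNReal` is truncated. -/
lemma Chart.Represents.perimeter_modify (hC : C.Represents E) (hk : C.IsVariant k)
    (hE : FinitePerimeter E) (hf : Continuous f) (hf0 : ∀ x, 0 ≤ f x) :
    perimeter f (C.modify E k) + ENNReal.ofReal (C.len f C.g) =
      perimeter f E + ENNReal.ofReal (C.len f k) := by
  have hB := C.isOpen_box.measurableSet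
  have h1 := (hC.isVariationMeasure_modify hk hE).eq_variationMeasure
    (Chart.nullMeasurableSet_modify hk.1.continuous hE.1)
  have h2 : (variationMeasure E).restrict C.box = (graphMeasure C.e C.g).restrict C.box :=
    hE.isVariationMeasure.restrict_congr hE.1
      (measurable_epigraph C.contDiff.continuous).nullMeasurableSet C.isOpen_box hC
      (isVariationMeasure_iff.2 ⟨_, isPolar_epigraph C.norm_e C.contDiff⟩)
  have h3 : perimeter f E = (∫⁻ x in C.boxᶜ, ENNReal.ofReal (f x) ∂variationMeasure E) +
      ENNReal.ofReal (C.len f C.g) := by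
    rw [← C.isVariant_self.setLIntegral_box hf hf0, ← h2, add_comm,
      lintegral_add_compl _ hB, perimeter]
  rw [h3, perimeter, h1, lintegral_add_measure, hk.setLIntegral_box hf hf0]
  abel

lemma Chart.IsVariant.weightedVolume_epigraph (hk : C.IsVariant k) (hf : Continuous f)
    (hf0 : ∀ x, 0 ≤ f x) : weightedVolume f (epigraph C.e k ∩ C.box) =
      ENNReal.ofReal (C.area f k) := by
  have hkc := hk.1.continuous
  have hm : MeasurableSet {q : ℝ × ℝ | q.1 ∈ Ioo C.a C.b ∧ q.2 ∈ Ioo (k q.1) C.d} := by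
    have h : IsOpen {q : ℝ × ℝ | q.1 ∈ Ioo C.a C.b ∧ q.2 ∈ Ioo (k q.1) C.d} :=
      (isOpen_Ioo.preimage continuous_fst).inter
        ((isOpen_lt (hkc.comp continuous_fst) continuous_snd).inter
          (isOpen_lt continuous_snd continuous_const))
    exact h.measurableSet
  have hpre : framePoint C.e ⁻¹' (epigraph C.e k ∩ C.box) =
      {q : ℝ × ℝ | q.1 ∈ Ioo C.a C.b ∧ q.2 ∈ Ioo (k q.1) C.d} := by
    ext q
    simp only [mem_preimage, mem_inter_iff, Chart.framePoint_mem_box, epigraph, mem_ofPred_eq,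
      inner_framePoint C.norm_e, inner_framePoint_J C.norm_e, mem_Ioo]
    constructor
    · rintro ⟨h1, h2, h3, h4⟩; exact ⟨h2, h1, h4⟩
    · rintro ⟨h1, h2, h3⟩
      exact ⟨h2, h1, (hk.2.1 _ (Ioo_subset_Icc_self h1)).1.trans h2, h3⟩
  have hfc : Continuous fun q => f (framePoint C.e q) := hf.comp (continuous_framePoint C.e)
  rw [weightedVolume, ← (measurePreserving_framePoint C.norm_e).setLIntegral_comp_preimage_emb
    (frameHomeo C.e C.norm_e).measurableEmbedding, hpre, ← lintegral_indicator hm,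
    Measure.volume_eq_prod, lintegral_prod _
      ((hfc.measurable.ennreal_ofReal).indicator hm).aemeasurable]
  have hin : ∀ u ∈ Ioo C.a C.b,
      ∫⁻ y, ({q : ℝ × ℝ | q.1 ∈ Ioo C.a C.b ∧ q.2 ∈ Ioo (k q.1) C.d}).indicator
        (fun q => ENNReal.ofReal (f (framePoint C.e q))) (u, y) =
      ENNReal.ofReal (∫ y in (k u)..C.d, f (framePoint C.e (u, y))) := by
    intro u hu
    have hkd := (hk.2.1 u (Ioo_subset_Icc_self hu)).2
    have hc : Continuous fun y => f (framePoint C.e (u, y)) := hfc.comp (by fun_prop)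
    rw [intervalIntegral.integral_of_le hkd.le, integral_Ioc_eq_integral_Ioo,
      ofReal_integral_eq_lintegral_ofReal, ← lintegral_indicator measurableSet_Ioo]
    · refine lintegral_congr fun y => ?_
      by_cases hy : y ∈ Ioo (k u) C.d
      · rw [indicator_of_mem hy, indicator_of_mem (show (u, y) ∈ {q : ℝ × ℝ | q.1 ∈ Ioo C.a C.b ∧ q.2 ∈ Ioo (k q.1) C.d} from
          ⟨hu, hy⟩)]
      · rw [indicator_of_notMem hy, indicator_of_notMem (fun h => hy h.2)]
    · exact (hc.continuousOn.integrableOn_compact isCompact_Icc).mono_set Ioo_subset_Icc_self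
    · exact Eventually.of_forall fun y => hf0 _
  have hcont : Continuous fun u => ∫ y in (k u)..C.d, f (framePoint C.e (u, y)) := by
    have : Continuous fun u => ∫ y in C.d..(k u), f (framePoint C.e (u, y)) :=
      intervalIntegral.continuous_parametric_intervalIntegral_of_continuous hfc hkc
    simpa only [intervalIntegral.integral_symm C.d] using! this.neg
  rw [Chart.area, intervalIntegral.integral_of_le C.a_lt_b.le, integral_Ioc_eq_integral_Ioo,
    ofReal_integral_eq_lintegral_ofReal, ← lintegral_indicator measurableSet_Ioo]
  · refine lintegral_congr fun u => ?_
    by_cases hu : u ∈ Ioo C.a C.b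
    · rw [indicator_of_mem hu, hin u hu]
    · rw [indicator_of_notMem hu]
      refine (lintegral_congr fun y => ?_).trans lintegral_zero
      exact indicator_of_notMem (fun h => hu h.1) _
  · exact (hcont.continuousOn.integrableOn_compact isCompact_Icc).mono_set Ioo_subset_Icc_self
  · refine (ae_restrict_iff' measurableSet_Ioo).2 (Eventually.of_forall fun u hu => ?_)
    exact intervalIntegral.integral_nonneg (hk.2.1 u (Ioo_subset_Icc_self hu)).2.le
      fun y _ => hf0 _

lemma Chart.Represents.weightedVolume_modify (hC : C.Represents E) (hk : C.IsVariant k)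
    (hf : Continuous f) (hf0 : ∀ x, 0 ≤ f x) :
    weightedVolume f (C.modify E k) + ENNReal.ofReal (C.area f C.g) =
      weightedVolume f E + ENNReal.ofReal (C.area f k) := by
  have hB := C.isOpen_box.measurableSet
  have h1 : weightedVolume f E = weightedVolume f (E \ C.box) + ENNReal.ofReal (C.area f C.g) := by
    rw [← C.isVariant_self.weightedVolume_epigraph hf hf0, ← hC, weightedVolume, weightedVolume,
      weightedVolume, add_comm, lintegral_inter_add_sdiff _ _ hB]
  have h2 : weightedVolume f (C.modify E k) =
      weightedVolume f (E \ C.box) + ENNReal.ofReal (C.area f k) := by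
    rw [← hk.weightedVolume_epigraph hf hf0, Chart.modify, weightedVolume, weightedVolume,
      weightedVolume, lintegral_union ((measurable_epigraph hk.1.continuous).inter hB)
        (disjoint_sdiff_left.mono_right inter_subset_right)]
  rw [h1, h2]
  abel

lemma Chart.len_nonneg (hf0 : ∀ x, 0 ≤ f x) : 0 ≤ C.len f k :=
  intervalIntegral.integral_nonneg C.a_lt_b.le fun _ _ => mul_nonneg (hf0 _) (graphSpeed_pos _ _).le

lemma Chart.IsVariant.area_nonneg (hk : C.IsVariant k) (hf0 : ∀ x, 0 ≤ f x) : 0 ≤ C.area f k :=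
  intervalIntegral.integral_nonneg C.a_lt_b.le fun u hu =>
    intervalIntegral.integral_nonneg (hk.2.1 u hu).2.le fun _ _ => hf0 _

/-- Minimality against simultaneous modifications in two disjoint boxes. -/
theorem IsMinimiser.len_add_len_le {v : ℝ} (hf : Continuous f) (hf0 : ∀ x, 0 ≤ f x)
    (hmin : IsMinimiser f v E) (hb : Bornology.IsBounded E) {C D : Chart} (hC : C.Represents E)
    (hD : D.Represents E) (hdisj : Disjoint C.box D.box) {k l : ℝ → ℝ} (hk : C.IsVariant k)
    (hl : D.IsVariant l) (harea : C.area f k + D.area f l = C.area f C.g + D.area f D.g) :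
    C.len f C.g + D.len f D.g ≤ C.len f k + D.len f l := by
  obtain ⟨⟨hEp, hEv⟩, hEmin⟩ := hmin
  have hFp := hC.finitePerimeter_modify hk hEp
  -- The boxes are disjoint, so the first modification leaves the second chart intact.
  have hDF : D.Represents (C.modify E k) := by
    rw [Chart.Represents, ← hD]
    ext x
    have hx : x ∈ C.box → x ∉ D.box := fun h => Set.disjoint_left.1 hdisj h
    simp only [Chart.modify, mem_inter_iff, mem_union, Set.mem_sdiff]
    tauto
  have hGp := hDF.finitePerimeter_modify hl hFp
  have hFP := hC.perimeter_modify hk hEp hf hf0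
  have hGP := hDF.perimeter_modify hl hFp hf hf0
  have hFV := hC.weightedVolume_modify hk hf hf0
  have hGV := hDF.weightedVolume_modify hl hf hf0
  set F := C.modify E k
  set G := D.modify F l
  have hGadm : Admissible f v G := by
    refine ⟨hGp, ?_⟩
    rw [← hEv]
    have e1 : weightedVolume f G + ENNReal.ofReal (D.area f D.g) + ENNReal.ofReal (C.area f C.g) =
        weightedVolume f E +
          (ENNReal.ofReal (C.area f k) + ENNReal.ofReal (D.area f l)) := by
      rw [hGV, add_right_comm, hFV]; abel
    rw [← ENNReal.ofReal_add (hk.area_nonneg hf0) (hl.area_nonneg hf0), harea,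
      ENNReal.ofReal_add (C.isVariant_self.area_nonneg hf0) (D.isVariant_self.area_nonneg hf0),
      add_assoc, add_comm (ENNReal.ofReal (D.area f D.g))] at e1
    exact (ENNReal.add_left_inj (by simp)).1 e1
  have hle : perimeter f E ≤ perimeter f G := hEmin.le.trans (iInf₂_le G hGadm)
  have hfin : perimeter f E ≠ ⊤ := (perimeter_lt_top hEp hb hf).ne
  have e2 : perimeter f G + ENNReal.ofReal (D.len f D.g) + ENNReal.ofReal (C.len f C.g) =
        perimeter f E + (ENNReal.ofReal (C.len f k) + ENNReal.ofReal (D.len f l)) := by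
    rw [hGP, add_right_comm, hFP]; abel
  have e3 : perimeter f E + (ENNReal.ofReal (C.len f C.g) + ENNReal.ofReal (D.len f D.g)) ≤
      perimeter f E + (ENNReal.ofReal (C.len f k) + ENNReal.ofReal (D.len f l)) := by
    rw [← e2, add_assoc, add_comm (ENNReal.ofReal (D.len f D.g))]
    gcongr
  have e4 := (ENNReal.add_le_add_iff_left hfin).1 e3
  rw [← ENNReal.ofReal_add (Chart.len_nonneg hf0) (Chart.len_nonneg hf0),
    ← ENNReal.ofReal_add (Chart.len_nonneg hf0) (Chart.len_nonneg hf0),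
    ENNReal.ofReal_le_ofReal_iff (add_nonneg (Chart.len_nonneg hf0) (Chart.len_nonneg hf0))] at e4
  exact e4

end LogConvexIso

namespace LogConvexIso

/-! ### The radial density -/

section Density

variable {h : ℝ → ℝ} {τ : ℝ}

/-- Monotonicity carries the triangle inequality through `h`. Convexity on the whole plane then
gives local Lipschitz continuity, also at the origin. -/
lemma convexOn_comp_norm (hconv : ConvexOn ℝ (Ici 0) h) (hmono : MonotoneOn h (Ici 0)) :
    ConvexOn ℝ univ fun x : Plane => h ‖x‖ := by
  refine ⟨convex_univ, fun x _ y _ a b ha hb hab => ?_⟩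
  have h1 : ‖a • x + b • y‖ ≤ a * ‖x‖ + b * ‖y‖ := by
    refine (norm_add_le _ _).trans_eq ?_
    rw [norm_smul, norm_smul, Real.norm_of_nonneg ha, Real.norm_of_nonneg hb]
  have h2 : (0 : ℝ) ≤ a * ‖x‖ + b * ‖y‖ := by positivity
  exact (hmono (norm_nonneg _) h2 h1).trans
    (hconv.2 (norm_nonneg x) (norm_nonneg y) ha hb hab)

lemma locallyLipschitz_comp_norm (hconv : ConvexOn ℝ (Ici 0) h) (hmono : MonotoneOn h (Ici 0)) :
    LocallyLipschitz fun x : Plane => h ‖x‖ :=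
  (convexOn_comp_norm hconv hmono).locallyLipschitz

lemma locallyLipschitz_density (hconv : ConvexOn ℝ (Ici 0) h) (hmono : MonotoneOn h (Ici 0)) :
    LocallyLipschitz (density h) :=
  (Real.contDiff_exp (n := 1)).locallyLipschitz.comp (locallyLipschitz_comp_norm hconv hmono)

lemma continuous_density (hconv : ConvexOn ℝ (Ici 0) h) (hmono : MonotoneOn h (Ici 0)) :
    Continuous (density h) := (locallyLipschitz_density hconv hmono).continuous

lemma density_pos (h : ℝ → ℝ) (x : Plane) : 0 < density h x := Real.exp_pos _

/-! ### One-sided derivatives and kinks of a convex function. -/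

lemma hasDerivWithinAt_rhoPlus (hconv : ConvexOn ℝ (Ici 0) h) (hτ : 0 < τ) :
    HasDerivWithinAt h (rhoPlus h τ) (Ici τ) τ := by
  have hi : τ ∈ interior (Ici (0 : ℝ)) := by rw [interior_Ici]; exact hτ
  have h1 := hconv.hasDerivWithinAt_rightDeriv_of_mem_interior hi
  have h2 : HasDerivWithinAt (fun t : ℝ => τ + t * 1) 1 (Ioi 0) 0 := by
    simpa using ((hasDerivAt_id (0 : ℝ)).const_add τ).hasDerivWithinAt (s := Ioi 0)
  have h3 := HasDerivWithinAt.scomp_of_eq (0 : ℝ) h1 h2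
    (fun t ht => by simpa using (mem_Ioi.1 ht)) (by simp)
  have h4 : rhoPlus h τ = derivWithin h (Ioi τ) τ := by
    rw [hasDerivWithinAt_iff_tendsto_slope' self_notMem_Ioi] at h3
    refine Tendsto.limUnder_eq ?_
    simpa [slope_fun_def_field] using! h3
  rw [h4]
  exact hasDerivWithinAt_Ioi_iff_Ici.1 h1

lemma hasDerivWithinAt_rhoMinus (hconv : ConvexOn ℝ (Ici 0) h) (hτ : 0 < τ) :
    HasDerivWithinAt h (rhoMinus h τ) (Iic τ) τ := by
  have hi : τ ∈ interior (Ici (0 : ℝ)) := by rw [interior_Ici]; exact hτ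
  have h1 := hconv.hasDerivWithinAt_leftDeriv_of_mem_interior hi
  have h2 : HasDerivWithinAt (fun t : ℝ => τ + t * -1) (-1) (Ioi 0) 0 := by
    simpa using (((hasDerivAt_id (0 : ℝ)).mul_const (-1)).const_add τ).hasDerivWithinAt (s := Ioi 0)
  have h3 := HasDerivWithinAt.scomp_of_eq (0 : ℝ) h1 h2
    (fun t ht => by simpa using (mem_Ioi.1 ht)) (by simp)
  have h4 : dirDeriv h τ (-1) = -derivWithin h (Iio τ) τ := by
    rw [hasDerivWithinAt_iff_tendsto_slope' self_notMem_Ioi] at h3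
    refine Tendsto.limUnder_eq ?_
    simpa [slope_fun_def_field] using! h3
  rw [rhoMinus, h4, neg_neg]
  exact hasDerivWithinAt_Iio_iff_Iic.1 h1

lemma rhoMinus_le_rhoPlus (hconv : ConvexOn ℝ (Ici 0) h) (hτ : 0 < τ) :
    rhoMinus h τ ≤ rhoPlus h τ := by
  have hi : τ ∈ interior (Ici (0 : ℝ)) := by rw [interior_Ici]; exact hτ
  have h1 := hconv.leftDeriv_le_rightDeriv_of_mem_interior hi
  rwa [((hasDerivWithinAt_rhoMinus hconv hτ).mono Iio_subset_Iic_self).derivWithin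
    (uniqueDiffWithinAt_Iio τ), ((hasDerivWithinAt_rhoPlus hconv hτ).mono
    Ioi_subset_Ici_self).derivWithin (uniqueDiffWithinAt_Ioi τ)] at h1

/-- The slope of the chord from `τ` to `τ'` separates the two values. -/
lemma rhoPlus_le_rhoMinus (hconv : ConvexOn ℝ (Ici 0) h) (hτ : 0 < τ) {τ' : ℝ} (hττ : τ < τ') :
    rhoPlus h τ ≤ rhoMinus h τ' := by
  have hτ' := hτ.trans hττ
  have h1 := hconv.rightDeriv_le_slope hτ.le hτ'.le hττ
    ((hasDerivWithinAt_rhoPlus hconv hτ).mono Ioi_subset_Ici_self).differentiableWithinAt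
  have h2 := hconv.slope_le_leftDeriv hτ.le hτ'.le hττ
    ((hasDerivWithinAt_rhoMinus hconv hτ').mono Iio_subset_Iic_self).differentiableWithinAt
  rw [((hasDerivWithinAt_rhoMinus hconv hτ').mono Iio_subset_Iic_self).derivWithin
    (uniqueDiffWithinAt_Iio τ')] at h2
  rw [((hasDerivWithinAt_rhoPlus hconv hτ).mono
    Ioi_subset_Ici_self).derivWithin (uniqueDiffWithinAt_Ioi τ)] at h1
  exact h1.trans h2

/-- A convex function has only countably many kinks. -/
lemma countable_kinks (hconv : ConvexOn ℝ (Ici 0) h) :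
    {τ : ℝ | 0 < τ ∧ rhoMinus h τ < rhoPlus h τ}.Countable := by
  -- The gaps between the one-sided derivatives at distinct kinks are disjoint nonempty open
  -- intervals.
  refine Set.PairwiseDisjoint.countable_of_isOpen
    (s := fun τ => Ioo (rhoMinus h τ) (rhoPlus h τ)) ?_ (fun _ _ => isOpen_Ioo)
    fun τ hτ => nonempty_Ioo.2 hτ.2
  have key : ∀ τ τ' : ℝ, 0 < τ → τ < τ' → Disjoint (Ioo (rhoMinus h τ) (rhoPlus h τ))
      (Ioo (rhoMinus h τ') (rhoPlus h τ')) := by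
    intro τ τ' hτ hlt
    rw [Set.disjoint_left]
    intro x hx hx'
    exact absurd (hx.2.trans_le (rhoPlus_le_rhoMinus hconv hτ hlt)) (not_lt.2 hx'.1.le)
  intro τ hτ τ' hτ' hne
  rcases lt_or_gt_of_ne hne with hl | hl
  · exact key _ _ hτ.1 hl
  · exact (key _ _ hτ'.1 hl).symm

lemma norm_add_smul_sq (x w : Plane) (s : ℝ) :
    ‖x + s • w‖ ^ 2 = ‖x‖ ^ 2 + 2 * s * inner ℝ x w + s ^ 2 * ‖w‖ ^ 2 := by
  rw [norm_add_sq_real, inner_smul_right, norm_smul, mul_pow, Real.norm_eq_abs, sq_abs]; ring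

lemma hasDerivAt_norm_add_smul {x : Plane} (hx : x ≠ 0) (w : Plane) :
    HasDerivAt (fun s : ℝ => ‖x + s • w‖) (inner ℝ x w / ‖x‖) 0 := by
  have hx0 : 0 < ‖x‖ := norm_pos_iff.2 hx
  have h1 : HasDerivAt (fun s : ℝ => ‖x‖ ^ 2 + 2 * s * inner ℝ x w + s ^ 2 * ‖w‖ ^ 2)
      (2 * inner ℝ x w) 0 := by
    have h2 : HasDerivAt (fun s : ℝ => ‖x‖ ^ 2 + 2 * s * inner ℝ x w) (2 * 1 * inner ℝ x w) 0 :=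
      (((hasDerivAt_id (0 : ℝ)).const_mul 2).mul_const _).const_add _
    have h3 : HasDerivAt (fun s : ℝ => s ^ 2 * ‖w‖ ^ 2) (((2 : ℕ) * (0 : ℝ) ^ (2 - 1) * 1) * ‖w‖ ^ 2)
        0 := ((hasDerivAt_id (0 : ℝ)).pow 2).mul_const _
    simpa using! h2.add h3
  have h2 := h1.sqrt (by simp [hx])
  have h3 : (fun s : ℝ => ‖x + s • w‖) =
      fun s : ℝ => √(‖x‖ ^ 2 + 2 * s * inner ℝ x w + s ^ 2 * ‖w‖ ^ 2) := by
    ext s; rw [← norm_add_smul_sq, Real.sqrt_sq (norm_nonneg _)]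
  rw [h3]
  convert h2 using 1
  simp [Real.sqrt_sq hx0.le]
  field_simp

/-- The one-sided derivative of `h |x|` at `x` in the direction `w`. -/
noncomputable def radialDeriv (h : ℝ → ℝ) (x w : Plane) : ℝ :=
  if 0 ≤ (inner ℝ x w : ℝ) then rhoPlus h ‖x‖ * (inner ℝ x w / ‖x‖)
  else rhoMinus h ‖x‖ * (inner ℝ x w / ‖x‖)

/-- If `⟨x, w⟩ ≥ 0`, the norm does not fall below `‖x‖` for `s > 0`, so only the right derivative of
`h` is felt. If `⟨x, w⟩ < 0`, the norm is below `‖x‖` for small `s > 0`, namely on the set `S`, and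
only the left derivative is felt. -/
lemma hasDerivWithinAt_radial (hconv : ConvexOn ℝ (Ici 0) h) {x : Plane} (hx : x ≠ 0)
    (w : Plane) :
    HasDerivWithinAt (fun s : ℝ => h ‖x + s • w‖) (radialDeriv h x w) (Ioi 0) 0 := by
  have hx0 : 0 < ‖x‖ := norm_pos_iff.2 hx
  have hN := hasDerivAt_norm_add_smul hx w
  have hsq : ∀ s : ℝ, ‖x + s • w‖ ^ 2 = ‖x‖ ^ 2 + 2 * s * inner ℝ x w + s ^ 2 * ‖w‖ ^ 2 :=
    norm_add_smul_sq x w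
  unfold radialDeriv
  split_ifs with hc
  · refine HasDerivWithinAt.comp_of_eq (0 : ℝ) (hasDerivWithinAt_rhoPlus hconv hx0)
      (hN.hasDerivWithinAt (s := Ioi 0)) ?_ (by simp)
    intro s hs
    have hs0 : 0 < s := hs
    refine (pow_le_pow_iff_left₀ (norm_nonneg _) (norm_nonneg _) two_ne_zero).1 ?_
    rw [hsq]
    nlinarith [mul_nonneg hs0.le hc, mul_nonneg (sq_nonneg s) (sq_nonneg ‖w‖)]
  · rw [not_le] at hc
    set S : Set ℝ := {s | 0 < s ∧ s * ‖w‖ ^ 2 < -2 * inner ℝ x w} with hS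
    have hSm : S ∈ 𝓝[>] (0 : ℝ) := by
      refine inter_mem self_mem_nhdsWithin (mem_nhdsWithin_of_mem_nhds ?_)
      refine (isOpen_lt (f := fun s : ℝ => s * ‖w‖ ^ 2) (g := fun _ => -2 * (inner ℝ x w : ℝ))
        (by fun_prop) (by fun_prop)).mem_nhds ?_
      change (0 : ℝ) * ‖w‖ ^ 2 < -2 * inner ℝ x w
      linarith
    have h1 : HasDerivWithinAt (fun s : ℝ => h ‖x + s • w‖)
        (rhoMinus h ‖x‖ * (inner ℝ x w / ‖x‖)) S 0 := by
      refine HasDerivWithinAt.comp_of_eq (0 : ℝ) (hasDerivWithinAt_rhoMinus hconv hx0)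
        (hN.hasDerivWithinAt (s := S)) ?_ (by simp)
      rintro s ⟨hs0, hs1⟩
      refine (pow_le_pow_iff_left₀ (norm_nonneg _) (norm_nonneg _) two_ne_zero).1 ?_
      rw [hsq]
      nlinarith
    exact h1.mono_of_mem_nhdsWithin hSm

lemma radialDeriv_of_eq {x : Plane} (hk : rhoMinus h ‖x‖ = rhoPlus h ‖x‖) (w : Plane) :
    radialDeriv h x w = rho h ‖x‖ * (inner ℝ x w / ‖x‖) := by
  have : rho h ‖x‖ = rhoPlus h ‖x‖ := by rw [rho, hk]; ring
  rw [radialDeriv, this, hk, ite_self]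

end Density

end LogConvexIso

namespace LogConvexIso

/-! ### First variations -/

/-- A `C^1` function with compact support in the base of the chart. -/
def Chart.IsTest (C : Chart) (φ : ℝ → ℝ) : Prop :=
  ContDiff ℝ 1 φ ∧ HasCompactSupport φ ∧ tsupport φ ⊆ Ioo C.a C.b

/-- The vertical perturbation `g + s φ` of the graph function of a chart. -/
def Chart.perturb (C : Chart) (φ : ℝ → ℝ) (s : ℝ) : ℝ → ℝ := fun u => C.g u + s * φ u

variable {C : Chart} {φ : ℝ → ℝ} {f : Plane → ℝ} {h : ℝ → ℝ}

lemma Chart.IsTest.neg (hφ : C.IsTest φ) : C.IsTest (fun u => -φ u) := by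
  obtain ⟨h1, h2, h3⟩ := hφ
  refine ⟨h1.neg, ?_, ?_⟩
  · exact h2.comp_left (g := fun y : ℝ => -y) neg_zero
  · exact (closure_mono fun u hu => by simpa using hu).trans h3

lemma Chart.perturb_neg (s : ℝ) : C.perturb (fun u => -φ u) s = C.perturb φ (-s) := by
  ext u; simp [Chart.perturb]

@[simp] lemma Chart.perturb_zero : C.perturb φ 0 = C.g := by
  ext u; simp [Chart.perturb]

lemma Chart.contDiff_perturb (hφ : ContDiff ℝ 1 φ) (s : ℝ) : ContDiff ℝ 1 (C.perturb φ s) :=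
  C.contDiff.add (contDiff_const.mul hφ)

lemma Chart.deriv_perturb (hφ : ContDiff ℝ 1 φ) (s u : ℝ) :
    deriv (C.perturb φ s) u = deriv C.g u + s * deriv φ u := by
  have h1 := (C.contDiff.differentiable one_ne_zero u).hasDerivAt
  have h2 := (hφ.differentiable one_ne_zero u).hasDerivAt
  exact (h1.add (h2.const_mul s)).deriv

lemma Chart.graphPoint_perturb (s u : ℝ) :
    graphPoint C.e (C.perturb φ s) u = graphPoint C.e C.g u + s • (φ u • J C.e) := by
  simp only [graphPoint, framePoint, Chart.perturb, add_smul, smul_smul, add_assoc]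

lemma Chart.IsTest.eventually_isVariant (hφ : C.IsTest φ) :
    ∀ᶠ s in 𝓝 (0 : ℝ), C.IsVariant (C.perturb φ s) := by
  have hc : Continuous fun q : ℝ × ℝ => C.g q.2 + q.1 * φ q.2 := by
    have := C.contDiff.continuous; have := hφ.1.continuous; fun_prop
  have h1 : ∀ᶠ s in 𝓝 (0 : ℝ), ∀ u ∈ Icc C.a C.b, C.g u + s * φ u ∈ Ioo C.c C.d := by
    refine isCompact_Icc.eventually_forall_of_forall_eventually fun u hu => ?_
    refine (hc.tendsto (0, u)).eventually (isOpen_Ioo.mem_nhds ?_)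
    simpa using C.mapsTo u hu
  filter_upwards [h1] with s hs
  refine ⟨Chart.contDiff_perturb hφ.1 s, hs, tsupport φ, hφ.2.1, hφ.2.2, fun u hu => ?_⟩
  simp [Chart.perturb, image_eq_zero_of_notMem_tsupport hu]

lemma Chart.continuous_area_perturb (hφ : C.IsTest φ) (hf : Continuous f) :
    Continuous fun s => C.area f (C.perturb φ s) := by
  have hc : Continuous fun q : ℝ × ℝ => C.g q.2 + q.1 * φ q.2 := by
    have := C.contDiff.continuous; have := hφ.1.continuous; fun_prop
  have hF : Continuous (Function.uncurry fun (q : ℝ × ℝ) (y : ℝ) => f (framePoint C.e (q.2, y))) :=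
    hf.comp ((continuous_framePoint C.e).comp (by fun_prop))
  have h1 : Continuous fun q : ℝ × ℝ =>
      ∫ y in C.d..(C.g q.2 + q.1 * φ q.2), f (framePoint C.e (q.2, y)) :=
    intervalIntegral.continuous_parametric_intervalIntegral_of_continuous hF hc
  have h2 : Continuous fun q : ℝ × ℝ =>
      ∫ y in (C.g q.2 + q.1 * φ q.2)..C.d, f (framePoint C.e (q.2, y)) := by
    simpa only [intervalIntegral.integral_symm C.d] using! h1.neg
  exact intervalIntegral.continuous_parametric_intervalIntegral_of_continuous' (by exact h2) _ _

/-- The minus sign appears because the set lies above the graph. The derivative is two-sided for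
every continuous weight; kinks of `h` are felt only by the length. -/
lemma Chart.hasDerivAt_area (hφ : C.IsTest φ) (hf : Continuous f) :
    HasDerivAt (fun s => C.area f (C.perturb φ s))
      (-∫ u in C.a..C.b, f (graphPoint C.e C.g u) * φ u) 0 := by
  have hgc := C.contDiff.continuous
  have hφc := hφ.1.continuous
  have hc : Continuous fun q : ℝ × ℝ => C.g q.2 + q.1 * φ q.2 := by fun_prop
  have hF : Continuous (Function.uncurry fun (q : ℝ × ℝ) (y : ℝ) => f (framePoint C.e (q.2, y))) :=
    hf.comp ((continuous_framePoint C.e).comp (by fun_prop))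
  have h1 : Continuous fun q : ℝ × ℝ =>
      ∫ y in C.d..(C.g q.2 + q.1 * φ q.2), f (framePoint C.e (q.2, y)) :=
    intervalIntegral.continuous_parametric_intervalIntegral_of_continuous hF hc
  have h2 : Continuous fun q : ℝ × ℝ =>
      ∫ y in (C.g q.2 + q.1 * φ q.2)..C.d, f (framePoint C.e (q.2, y)) := by
    simpa only [intervalIntegral.integral_symm C.d] using! h1.neg
  set G' : ℝ → ℝ → ℝ := fun s u => -(f (framePoint C.e (u, C.g u + s * φ u)) * φ u) with hG'
  have hG'c : Continuous (Function.uncurry G') := by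
    have : Continuous fun q : ℝ × ℝ => f (framePoint C.e (q.2, C.g q.2 + q.1 * φ q.2)) :=
      hf.comp ((continuous_framePoint C.e).comp (by fun_prop))
    exact (this.mul (by fun_prop)).neg
  obtain ⟨M, hM⟩ := ((isCompact_Icc (a := (-1 : ℝ)) (b := 1)).prod
    (isCompact_Icc (a := C.a) (b := C.b))).exists_bound_of_continuousOn hG'c.continuousOn
  have h3 := intervalIntegral.hasDerivAt_integral_of_dominated_loc_of_deriv_le (μ := volume)
    (F := fun s u => ∫ y in (C.g u + s * φ u)..C.d, f (framePoint C.e (u, y))) (F' := G')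
    (x₀ := 0) (a := C.a) (b := C.b) (bound := fun _ => M) (s := Icc (-1) 1)
    (Icc_mem_nhds (by norm_num) (by norm_num)) ?_ ?_ ?_ ?_ ?_ ?_
  · have h4 := h3.2
    simp only [hG', zero_mul, add_zero, intervalIntegral.integral_neg] at h4
    exact h4
  · exact Eventually.of_forall fun s => (h2.comp (by fun_prop :
      Continuous fun u : ℝ => (s, u))).aestronglyMeasurable
  · exact (h2.comp (by fun_prop : Continuous fun u : ℝ => ((0 : ℝ), u))).intervalIntegrable _ _
  · exact (hG'c.comp (by fun_prop : Continuous fun u : ℝ => ((0 : ℝ), u))).aestronglyMeasurable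
  · refine Eventually.of_forall fun u hu s hs => hM (s, u) ⟨hs, ?_⟩
    rw [uIoc_of_le C.a_lt_b.le] at hu
    exact Ioc_subset_Icc_self hu
  · exact intervalIntegrable_const
  · refine Eventually.of_forall fun u _ s _ => ?_
    have hcu : Continuous fun y => f (framePoint C.e (u, y)) :=
      hf.comp ((continuous_framePoint C.e).comp (by fun_prop))
    have h5 : HasDerivAt (fun z => ∫ y in z..C.d, f (framePoint C.e (u, y)))
        (-f (framePoint C.e (u, C.g u + s * φ u))) (C.g u + s * φ u) :=
      intervalIntegral.integral_hasDerivAt_left (hcu.intervalIntegrable _ _)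
        (hcu.stronglyMeasurableAtFilter _ _) hcu.continuousAt
    have h6 : HasDerivAt (fun s => C.g u + s * φ u) (φ u) s := by
      simpa using ((hasDerivAt_id s).mul_const (φ u)).const_add (C.g u)
    simpa [hG', neg_mul] using! h5.comp s h6

/-- The one-sided derivative of the weighted length in the direction `φ`. -/
noncomputable def Chart.lenDeriv (C : Chart) (h : ℝ → ℝ) (φ : ℝ → ℝ) : ℝ :=
  ∫ u in C.a..C.b, density h (graphPoint C.e C.g u) *
    (radialDeriv h (graphPoint C.e C.g u) (φ u • J C.e) * graphSpeed C.g u +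
      deriv C.g u * deriv φ u / graphSpeed C.g u)

/-- Dominated convergence: the integrand is a locally Lipschitz function `Q` of position and slope,
so its difference quotients in `s` are uniformly bounded. Their pointwise limit exists from the
right, at points other than the origin. -/
lemma Chart.hasDerivWithinAt_len (hconv : ConvexOn ℝ (Ici 0) h) (hmono : MonotoneOn h (Ici 0))
    (hφ : C.IsTest φ) (h0 : (0 : Plane) ∉ C.box) :
    HasDerivWithinAt (fun s => C.len (density h) (C.perturb φ s)) (C.lenDeriv h φ) (Ioi 0) 0 := by
  have hgc := C.contDiff.continuous
  have hg'c := C.contDiff.continuous_deriv_one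
  have hφc := hφ.1.continuous
  have hφ'c := hφ.1.continuous_deriv_one
  have hf := continuous_density hconv hmono
  set q : ℝ → ℝ → ℝ := fun s u =>
    density h (graphPoint C.e (C.perturb φ s) u) * graphSpeed (C.perturb φ s) u with hq
  set P : ℝ × ℝ → Plane × ℝ := fun p =>
    (framePoint C.e (p.2, C.g p.2 + p.1 * φ p.2), deriv C.g p.2 + p.1 * deriv φ p.2) with hP
  set Q : Plane × ℝ → ℝ := fun p => density h p.1 * √(1 + p.2 ^ 2) with hQ
  have hPc : Continuous P := ((continuous_framePoint C.e).comp (by fun_prop)).prodMk (by fun_prop)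
  have hqQ : ∀ s u, q s u = Q (P (s, u)) := by
    intro s u
    simp only [hq, hQ, hP, graphSpeed, Chart.deriv_perturb hφ.1]
    rfl
  have hQl : LocallyLipschitz Q := by
    have h1 : LocallyLipschitz fun p : Plane × ℝ => density h p.1 :=
      (locallyLipschitz_density hconv hmono).comp LipschitzWith.prod_fst.locallyLipschitz
    have h2 : LocallyLipschitz fun p : Plane × ℝ => √(1 + p.2 ^ 2) := by
      have : ContDiff ℝ 1 fun y : ℝ => √(1 + y ^ 2) :=
        (by fun_prop : ContDiff ℝ 1 fun y : ℝ => 1 + y ^ 2).sqrt fun y => by positivity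
      exact this.locallyLipschitz.comp LipschitzWith.prod_snd.locallyLipschitz
    have h3 : LocallyLipschitz fun p : ℝ × ℝ => p.1 * p.2 :=
      (contDiff_fst.mul contDiff_snd : ContDiff ℝ 1 fun p : ℝ × ℝ => p.1 * p.2).locallyLipschitz
    exact h3.comp (h1.prodMk h2)
  have hqc : ∀ s, Continuous (q s) := fun s => by
    have : q s = fun u => Q (P (s, u)) := funext (hqQ s)
    rw [this]; exact hQl.continuous.comp (hPc.comp (by fun_prop))
  have hcomp : IsCompact (Icc (0 : ℝ) 1 ×ˢ Icc C.a C.b) := isCompact_Icc.prod isCompact_Icc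
  obtain ⟨L, hL⟩ := (hQl.locallyLipschitzOn (s := P '' (Icc (0 : ℝ) 1 ×ˢ Icc C.a C.b))
    ).exists_lipschitzOnWith_of_compact (hcomp.image hPc)
  obtain ⟨M1, hM1⟩ := (isCompact_Icc (a := C.a) (b := C.b)).exists_bound_of_continuousOn
    hφc.continuousOn
  obtain ⟨M2, hM2⟩ := (isCompact_Icc (a := C.a) (b := C.b)).exists_bound_of_continuousOn
    hφ'c.continuousOn
  have hbound : ∀ s ∈ Ioc (0 : ℝ) 1, ∀ u ∈ Icc C.a C.b,
      ‖(q s u - q 0 u) / s‖ ≤ L * max M1 M2 := by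
    intro s hs u hu
    have h1 := hL.dist_le_mul (P (s, u)) (mem_image_of_mem _ ⟨⟨hs.1.le, hs.2⟩, hu⟩) (P (0, u))
      (mem_image_of_mem _ ⟨⟨le_rfl, zero_le_one⟩, hu⟩)
    have h2 : dist (P (s, u)) (P (0, u)) ≤ s * max M1 M2 := by
      rw [Prod.dist_eq]
      refine max_le ?_ ?_
      · have : (P (s, u)).1 - (P (0, u)).1 = (s * φ u) • J C.e := by
          simp only [hP, framePoint]
          simp [add_smul]
        rw [dist_eq_norm, this, norm_smul, norm_J, C.norm_e, mul_one, norm_mul,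
          Real.norm_of_nonneg hs.1.le]
        exact mul_le_mul_of_nonneg_left ((hM1 u hu).trans (le_max_left _ _)) hs.1.le
      · have : (P (s, u)).2 - (P (0, u)).2 = s * deriv φ u := by simp [hP]
        rw [dist_eq_norm, this, norm_mul, Real.norm_of_nonneg hs.1.le]
        exact mul_le_mul_of_nonneg_left ((hM2 u hu).trans (le_max_right _ _)) hs.1.le
    rw [norm_div, Real.norm_of_nonneg hs.1.le, div_le_iff₀ hs.1, hqQ, hqQ, ← dist_eq_norm]
    refine h1.trans ((mul_le_mul_of_nonneg_left h2 L.coe_nonneg).trans_eq (by ring))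
  rw [hasDerivWithinAt_iff_tendsto_slope' self_notMem_Ioi]
  have hslope : slope (fun s => C.len (density h) (C.perturb φ s)) 0 =
      fun s => ∫ u in C.a..C.b, (q s u - q 0 u) / s := by
    ext s
    rw [slope_def_field, sub_zero, intervalIntegral.integral_div,
      intervalIntegral.integral_sub ((hqc s).intervalIntegrable _ _)
        ((hqc 0).intervalIntegrable _ _)]
    rfl
  rw [hslope]
  refine intervalIntegral.tendsto_integral_filter_of_dominated_convergence
    (fun _ => L * max M1 M2) ?_ ?_ intervalIntegrable_const ?_
  · exact Eventually.of_forall fun s =>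
      (((hqc s).sub (hqc 0)).div_const s).aestronglyMeasurable
  · filter_upwards [Ioc_mem_nhdsGT (zero_lt_one (α := ℝ))] with s hs
    refine Eventually.of_forall fun u hu => hbound s hs u ?_
    rw [uIoc_of_le C.a_lt_b.le] at hu
    exact Ioc_subset_Icc_self hu
  · have hne : ∀ᵐ u : ℝ, u ≠ C.b := by simp [ae_iff]
    filter_upwards [hne] with u hub hu
    rw [uIoc_of_le C.a_lt_b.le] at hu
    have hx : graphPoint C.e C.g u ≠ 0 := by
      intro hx
      refine h0 (hx ▸ Chart.framePoint_mem_box.2 ⟨⟨hu.1, lt_of_le_of_ne hu.2 hub⟩, ?_⟩)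
      exact C.mapsTo u (Ioc_subset_Icc_self hu)
    have h1 := (hasDerivWithinAt_radial hconv hx (φ u • J C.e)).exp
    have h2 : HasDerivAt (fun s : ℝ => √(1 + (deriv C.g u + s * deriv φ u) ^ 2))
        (deriv C.g u * deriv φ u / graphSpeed C.g u) 0 := by
      have h3 : HasDerivAt (fun s : ℝ => deriv C.g u + s * deriv φ u) (deriv φ u) 0 := by
        simpa using ((hasDerivAt_id (0 : ℝ)).mul_const (deriv φ u)).const_add (deriv C.g u)
      have h4 := ((h3.fun_pow 2).const_add 1).sqrt (by simp; positivity)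
      convert h4 using 1
      simp [graphSpeed]
      field_simp
    have h5 := h1.mul (h2.hasDerivWithinAt (s := Ioi 0))
    rw [hasDerivWithinAt_iff_tendsto_slope' self_notMem_Ioi] at h5
    have hqs : ∀ s, q s u = Real.exp (h ‖graphPoint C.e C.g u + s • φ u • J C.e‖) *
        √(1 + (deriv C.g u + s * deriv φ u) ^ 2) := by
      intro s
      simp only [hq, graphSpeed, Chart.deriv_perturb hφ.1, Chart.graphPoint_perturb, density]
    have h6 : (fun s => (q s u - q 0 u) / s) = slope ((fun s : ℝ =>
        Real.exp (h ‖graphPoint C.e C.g u + s • φ u • J C.e‖)) *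
        fun s : ℝ => √(1 + (deriv C.g u + s * deriv φ u) ^ 2)) 0 := by
      ext s
      rw [slope_def_field, hqs, hqs, sub_zero]
      rfl
    rw [h6]
    convert h5 using 2
    have hsp : graphSpeed C.g u = √(1 + deriv C.g u ^ 2) := rfl
    simp [density, ← hsp]
    ring

/-- A one-sided Lagrange inequality for two functions of one variable each, linked by a scalar
constraint. -/
lemma mul_div_le_of_constrained_min {a A b B : ℝ → ℝ} {a' α b' β r : ℝ}
    (ha : HasDerivWithinAt a a' (Ioi 0) 0) (hA : HasDerivWithinAt A α (Ioi 0) 0)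
    (hb : HasDerivAt b b' 0) (hB : HasDerivAt B β 0) (hBc : Continuous B) (hβ : β ≠ 0)
    (hr : 0 < r) (hmin : ∀ s ∈ Ioo 0 r, ∀ t ∈ Ioo (-r) r, A s + B t = A 0 + B 0 →
      a 0 + b 0 ≤ a s + b t) : b' * (α / β) ≤ a' := by
  by_contra! hlt
  -- To first order the constraint forces `t = γ s`. If the claim failed, `a + b` would decrease in
  -- this direction at rate `δ`.
  set γ : ℝ := -(α / β) with hγ
  set δ : ℝ := -(a' + b' * γ) with hδ
  have hδ0 : 0 < δ := by rw [hδ, hγ]; linarith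
  -- The remainders of `a` and `b` and the deviation of `t` from `γ s` contribute at most `s η`, `s
  -- η (|γ| + 1)` and `s η |b'|`, in total `s η N`; the choice of `η` keeps this below `s δ`.
  set N : ℝ := 2 + |b'| + |γ| with hN
  have hN0 : 0 < N := by positivity
  set η : ℝ := min 1 (δ / (2 * N)) with hη
  have hη0 : 0 < η := lt_min one_pos (by positivity)
  have hη1 : η ≤ 1 := min_le_left _ _
  have hηN : η * N < δ := by
    calc η * N ≤ δ / (2 * N) * N := mul_le_mul_of_nonneg_right (min_le_right _ _) hN0.le
      _ = δ / 2 := by field_simp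
      _ < δ := by linarith
  have hb' : ∀ᶠ t in 𝓝 (0 : ℝ), |b t - b 0 - t * b'| ≤ η * |t| := by
    simpa using (hasDerivAt_iff_isLittleO.1 hb).def hη0
  have ha' : ∀ᶠ s in 𝓝[>] (0 : ℝ), |a s - a 0 - s * a'| ≤ η * |s| := by
    simpa using (hasDerivWithinAt_iff_isLittleO.1 ha).def hη0
  have hAB : ∀ c : ℝ, HasDerivWithinAt (fun s => A s + B (s * c)) (α + β * c) (Ioi 0) 0 := by
    intro c
    have h1 : HasDerivAt (fun s : ℝ => s * c) c 0 := by
      simpa using (hasDerivAt_id (0 : ℝ)).mul_const c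
    have h2 : HasDerivAt (fun s => B (s * c)) (β * c) 0 :=
      HasDerivAt.comp_of_eq (h₂ := B) (0 : ℝ) hB h1 (by simp)
    exact hA.add h2.hasDerivWithinAt
  have hABo : ∀ c : ℝ, ∀ᶠ s in 𝓝[>] (0 : ℝ),
      |A s + B (s * c) - (A 0 + B 0) - s * (α + β * c)| ≤ |β| * η / 2 * |s| := by
    intro c
    simpa using (hasDerivWithinAt_iff_isLittleO.1 (hAB c)).def
      (by positivity : 0 < |β| * η / 2)
  have hsmall : ∀ c : ℝ, ∀ᶠ s in 𝓝[>] (0 : ℝ), s * c ∈ Ioo (-r) r := by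
    intro c
    have : Tendsto (fun s : ℝ => s * c) (𝓝[>] 0) (𝓝 0) := by
      have h : Continuous fun s : ℝ => s * c := by fun_prop
      simpa using (h.tendsto 0).mono_left nhdsWithin_le_nhds
    exact this.eventually (Ioo_mem_nhds (by linarith) hr)
  obtain ⟨ρ, hρ, hbρ⟩ := Metric.eventually_nhds_iff.1 hb'
  have hsρ : ∀ᶠ s in 𝓝[>] (0 : ℝ), s * N < ρ := by
    have : Tendsto (fun s : ℝ => s * N) (𝓝[>] 0) (𝓝 0) := by
      have h : Continuous fun s : ℝ => s * N := by fun_prop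
      simpa using (h.tendsto 0).mono_left nhdsWithin_le_nhds
    exact this.eventually (gt_mem_nhds hρ)
  have hIoo : ∀ᶠ s in 𝓝[>] (0 : ℝ), s ∈ Ioo 0 r := Ioo_mem_nhdsGT hr
  obtain ⟨s, hsr, has, hs1, hs2, hr1, hr2, hsN⟩ := (hIoo.and (ha'.and
    ((hABo (γ + η)).and ((hABo (γ - η)).and
      ((hsmall (γ + η)).and ((hsmall (γ - η)).and hsρ)))))).exists
  have hs : 0 < s := hsr.1
  have e1 : α + β * (γ + η) = β * η := by rw [hγ]; field_simp; ring
  have e2 : α + β * (γ - η) = -(β * η) := by rw [hγ]; field_simp; ring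
  rw [e1, abs_of_pos hs, abs_le] at hs1
  rw [e2, abs_of_pos hs, abs_le] at hs2
  -- At slopes `γ ± η` the defect of the constraint is `± β η s` up to an error of half that size,
  -- so it changes sign. The intermediate value theorem then solves the constraint exactly, without
  -- any inverse function theorem for `B`.
  have hmem : A 0 + B 0 - A s ∈ uIcc (B (s * (γ - η))) (B (s * (γ + η))) := by
    rw [mem_uIcc]
    have hsη : 0 < s * η := mul_pos hs hη0
    rcases lt_or_gt_of_ne hβ with hneg | hpos
    · right
      rw [abs_of_neg hneg] at hs1 hs2
      constructor <;> nlinarith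
    · left
      rw [abs_of_pos hpos] at hs1 hs2
      constructor <;> nlinarith
  obtain ⟨t, ht, hBt⟩ := intermediate_value_uIcc hBc.continuousOn hmem
  rw [uIcc_of_le (by nlinarith)] at ht
  have hkey := hmin s hsr t ⟨hr2.1.trans_le ht.1, ht.2.trans_lt hr1.2⟩ (by rw [hBt]; ring)
  have htγ : |t - s * γ| ≤ s * η := abs_le.2 ⟨by nlinarith [ht.1], by nlinarith [ht.2]⟩
  have htabs : |t| ≤ s * (|γ| + 1) := by
    calc |t| = |(t - s * γ) + s * γ| := by ring_nf
      _ ≤ |t - s * γ| + |s * γ| := abs_add_le _ _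
      _ ≤ s * η + s * |γ| := by rw [abs_mul, abs_of_pos hs]; linarith
      _ ≤ s * (|γ| + 1) := by nlinarith
  have htN : |t| < ρ := by
    refine (htabs.trans ?_).trans_lt hsN
    refine mul_le_mul_of_nonneg_left ?_ hs.le
    rw [hN]; linarith [abs_nonneg b']
  have hbt := (abs_le.1 (hbρ (by simpa using htN))).2
  rw [abs_of_pos hs] at has
  have has' := (abs_le.1 has).2
  have hb1 : t * b' ≤ s * γ * b' + s * η * |b'| := by
    have : (t - s * γ) * b' ≤ s * η * |b'| := by
      refine (le_abs_self _).trans ?_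
      rw [abs_mul]
      exact mul_le_mul_of_nonneg_right htγ (abs_nonneg _)
    linarith
  have hfin : s * δ ≤ s * (η * N) := by
    have h3 : η * |t| ≤ η * (s * (|γ| + 1)) := mul_le_mul_of_nonneg_left htabs hη0.le
    rw [hδ, hN]
    linarith
  exact absurd (le_of_mul_le_mul_left hfin hs) (not_le.2 hηN)

/-- The one-sided first variation inequality, with a second chart restoring the volume. -/
theorem IsMinimiser.first_variation {v : ℝ} {E : Set Plane} (hconv : ConvexOn ℝ (Ici 0) h)
    (hmono : MonotoneOn h (Ici 0)) (hmin : IsMinimiser (density h) v E)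
    (hbdd : Bornology.IsBounded E) {C D : Chart} (hC : C.Represents E) (hD : D.Represents E)
    (hdisj : Disjoint C.box D.box) (hC0 : (0 : Plane) ∉ C.box) {φ ψ : ℝ → ℝ} (hφ : C.IsTest φ)
    (hψ : D.IsTest ψ) {q' : ℝ}
    (hq : HasDerivAt (fun s => D.len (density h) (D.perturb ψ s)) q' 0)
    (hβ : ∫ u in D.a..D.b, density h (graphPoint D.e D.g u) * ψ u ≠ 0) :
    q' / (∫ u in D.a..D.b, density h (graphPoint D.e D.g u) * ψ u) *
      (∫ u in C.a..C.b, density h (graphPoint C.e C.g u) * φ u) ≤ C.lenDeriv h φ := by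
  have hf := continuous_density hconv hmono
  obtain ⟨r, hr, hrv⟩ := Metric.eventually_nhds_iff.1
    (hφ.eventually_isVariant.and hψ.eventually_isVariant)
  have := mul_div_le_of_constrained_min (Chart.hasDerivWithinAt_len hconv hmono hφ hC0)
    (Chart.hasDerivAt_area hφ hf).hasDerivWithinAt hq (Chart.hasDerivAt_area hψ hf)
    (Chart.continuous_area_perturb hψ hf) (neg_ne_zero.2 hβ) hr fun s hs t ht hst => by
      simp only [Chart.perturb_zero] at hst ⊢
      refine hmin.len_add_len_le hf (fun x => (density_pos h x).le) hbdd hC hD hdisj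
        (hrv ?_).1 (hrv ?_).2 hst
      · rw [Real.dist_eq, sub_zero, abs_lt]; exact ⟨by linarith [hs.1], hs.2⟩
      · rw [Real.dist_eq, sub_zero, abs_lt]; exact ht
  rw [neg_div_neg_eq] at this
  rwa [div_mul_eq_mul_div, mul_div_assoc]

end LogConvexIso

namespace LogConvexIso

/-! ### Boundary, normal and curvature in a chart -/

variable {C : Chart} {E : Set Plane}

lemma Chart.Represents.mem_iff (hC : C.Represents E) {x : Plane} (hx : x ∈ C.box) :
    x ∈ E ↔ C.g (inner ℝ x C.e) < inner ℝ x (J C.e) := by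
  have := Set.ext_iff.1 hC x
  simp only [mem_inter_iff, hx, and_true] at this
  exact this

lemma mem_frontier_of_epigraph {e : Plane} (he : ‖e‖ = 1) {g : ℝ → ℝ} (hg : Continuous g)
    {U : Set Plane} (hU : IsOpen U) (hE : E ∩ U = epigraph e g ∩ U) {x : Plane} (hx : x ∈ U) :
    x ∈ frontier E ↔ (inner ℝ x (J e) : ℝ) = g (inner ℝ x e) := by
  have hmem : ∀ y ∈ U, (y ∈ E ↔ g (inner ℝ y e) < inner ℝ y (J e)) := by
    intro y hy
    have := Set.ext_iff.1 hE y
    simp only [mem_inter_iff, hy, and_true] at this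
    exact this
  have hUx : ∀ᶠ y in 𝓝 x, y ∈ U := hU.mem_nhds hx
  constructor
  · intro hf
    rcases lt_trichotomy (inner ℝ x (J e) : ℝ) (g (inner ℝ x e)) with hlt | heq | hgt
    · have : ∀ᶠ y : Plane in 𝓝 x, (inner ℝ y (J e) : ℝ) < g (inner ℝ y e) :=
        (isOpen_lt (f := fun y : Plane => (inner ℝ y (J e) : ℝ))
          (g := fun y : Plane => g (inner ℝ y e)) (by fun_prop) (by fun_prop)).mem_nhds hlt
      obtain ⟨y, hyE, hyU, hy⟩ := ((mem_closure_iff_frequently.1 hf.1).and_eventually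
        (hUx.and this)).exists
      exact absurd ((hmem y hyU).1 hyE) (not_lt.2 hy.le)
    · exact heq
    · have : ∀ᶠ y : Plane in 𝓝 x, g (inner ℝ y e) < (inner ℝ y (J e) : ℝ) :=
        (isOpen_lt (f := fun y : Plane => g (inner ℝ y e))
          (g := fun y : Plane => (inner ℝ y (J e) : ℝ)) (by fun_prop) (by fun_prop)).mem_nhds hgt
      refine absurd (mem_interior_iff_mem_nhds.2 ?_) hf.2
      filter_upwards [hUx, this] with y hyU hy
      exact (hmem y hyU).2 hy
  · intro heq
    refine ⟨?_, fun hi => ?_⟩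
    · have ht : Tendsto (fun s : ℝ => x + s • J e) (𝓝[>] 0) (𝓝 x) := by
        have : Continuous fun s : ℝ => x + s • J e := by fun_prop
        simpa using (this.tendsto 0).mono_left nhdsWithin_le_nhds
      refine mem_closure_of_tendsto ht ?_
      filter_upwards [ht.eventually hUx, self_mem_nhdsWithin] with s hsU hs
      have hs0 : 0 < s := hs
      refine (hmem _ hsU).2 ?_
      simp only [inner_add_left, inner_smul_left, inner_J_J, inner_self_one he, inner_J_self]
      simp [heq, hs0]
    · exact absurd ((hmem x hx).1 (interior_subset hi)) (by rw [heq]; exact lt_irrefl _)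

lemma Chart.Represents.mem_frontier_iff (hC : C.Represents E) {x : Plane} (hx : x ∈ C.box) :
    x ∈ frontier E ↔ (inner ℝ x (J C.e) : ℝ) = C.g (inner ℝ x C.e) :=
  mem_frontier_of_epigraph C.norm_e C.contDiff.continuous C.isOpen_box hC hx

lemma Chart.graphPoint_mem_box {u : ℝ} (hu : u ∈ Ioo C.a C.b) : graphPoint C.e C.g u ∈ C.box :=
  Chart.framePoint_mem_box.2 ⟨hu, C.mapsTo u (Ioo_subset_Icc_self hu)⟩

lemma Chart.Represents.graphPoint_mem_frontier (hC : C.Represents E) {u : ℝ}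
    (hu : u ∈ Ioo C.a C.b) : graphPoint C.e C.g u ∈ frontier E := by
  rw [hC.mem_frontier_iff (Chart.graphPoint_mem_box hu), inner_graphPoint C.norm_e,
    inner_graphPoint_J C.norm_e]

lemma Chart.Represents.eq_graphPoint (hC : C.Represents E) {x : Plane} (hx : x ∈ C.box)
    (hxE : x ∈ frontier E) : x = graphPoint C.e C.g (inner ℝ x C.e) := by
  rw [graphPoint, ← (hC.mem_frontier_iff hx).1 hxE, framePoint_inner C.norm_e]

/-- Charts exist in arbitrarily small neighbourhoods of boundary points. -/
lemma HasC11Boundary.exists_chart (hE : HasC11Boundary E) {p : Plane} (hp : p ∈ frontier E)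
    {W : Set Plane} (hW : W ∈ 𝓝 p) : ∃ C : Chart, C.Represents E ∧ p ∈ C.box ∧ C.box ⊆ W := by
  obtain ⟨e, r, g, K, he, hr, hg, hgl, hEr⟩ := hE p hp
  have hgp : (inner ℝ p (J e) : ℝ) = g (inner ℝ p e) :=
    (mem_frontier_of_epigraph he hg.continuous Metric.isOpen_ball hEr (Metric.mem_ball_self hr)).1 hp
  obtain ⟨ε, hε, hεW⟩ := Metric.mem_nhds_iff.1 (inter_mem hW (Metric.ball_mem_nhds p hr))
  set u₀ : ℝ := inner ℝ p e
  have hcont : ∀ᶠ u in 𝓝 u₀, g u ∈ Ioo (g u₀ - ε / 2) (g u₀ + ε / 2) :=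
    hg.continuous.continuousAt.eventually (Ioo_mem_nhds (by linarith) (by linarith))
  obtain ⟨δ, hδ, hδg⟩ := Metric.eventually_nhds_iff.1 hcont
  -- Half-sides of at most `ε / 2` put the box in the ball of radius `ε`. The bound `δ / 2` keeps
  -- the graph over the closed base between bottom and top.
  set δ' : ℝ := min (δ / 2) (ε / 2)
  have hδ'0 : 0 < δ' := by positivity
  have hδ'1 : δ' ≤ δ / 2 := min_le_left _ _
  have hδ'2 : δ' ≤ ε / 2 := min_le_right _ _
  let C : Chart := ⟨e, g, K, u₀ - δ', u₀ + δ', g u₀ - ε / 2, g u₀ + ε / 2, he, hg, hgl,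
    by linarith, fun u hu => hδg (by
      rw [Real.dist_eq]; exact (abs_le.2 ⟨by linarith [hu.1], by linarith [hu.2]⟩).trans_lt
        (by linarith : δ' < δ))⟩
  have hbox : C.box ⊆ Metric.ball p ε := by
    rintro x ⟨hx1, hx2⟩
    have h1 : (inner ℝ x e : ℝ) ∈ Ioo (u₀ - δ') (u₀ + δ') := hx1
    have h2 : (inner ℝ x (J e) : ℝ) ∈ Ioo (g u₀ - ε / 2) (g u₀ + ε / 2) := hx2
    rw [mem_ball_iff_norm]
    refine (pow_lt_pow_iff_left₀ (norm_nonneg _) hε.le two_ne_zero).1 ?_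
    rw [← real_inner_self_eq_norm_sq, inner_eq_frame he, inner_sub_left, inner_sub_left, hgp]
    have h3 : ((inner ℝ x e : ℝ) - u₀) * ((inner ℝ x e : ℝ) - u₀) < (ε / 2) * (ε / 2) := by
      have : |(inner ℝ x e : ℝ) - u₀| < ε / 2 :=
        abs_lt.2 ⟨by linarith [h1.1], by linarith [h1.2]⟩
      rw [← abs_mul_abs_self]
      exact mul_self_lt_mul_self (abs_nonneg _) this
    have h4 : ((inner ℝ x (J e) : ℝ) - g u₀) * ((inner ℝ x (J e) : ℝ) - g u₀) <
        (ε / 2) * (ε / 2) := by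
      have : |(inner ℝ x (J e) : ℝ) - g u₀| < ε / 2 :=
        abs_lt.2 ⟨by linarith [h2.1], by linarith [h2.2]⟩
      rw [← abs_mul_abs_self]
      exact mul_self_lt_mul_self (abs_nonneg _) this
    change ((inner ℝ x e : ℝ) - u₀) * ((inner ℝ x e : ℝ) - u₀) +
      ((inner ℝ x (J e) : ℝ) - g u₀) * ((inner ℝ x (J e) : ℝ) - g u₀) < ε ^ 2
    nlinarith [sq_nonneg ε]
  refine ⟨C, ?_, ⟨⟨?_, ?_⟩, ?_⟩, fun x hx => (hεW (hbox hx)).1⟩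
  · have : C.box ⊆ Metric.ball p r := fun x hx => (hεW (hbox hx)).2
    change E ∩ C.box = epigraph e g ∩ C.box
    rw [← inter_eq_self_of_subset_right this, ← inter_assoc, ← inter_assoc, hEr]
    rfl
  · change u₀ - δ' < u₀; linarith
  · change u₀ < u₀ + δ'; linarith
  · change (inner ℝ p (J e) : ℝ) ∈ Ioo (g u₀ - ε / 2) (g u₀ + ε / 2)
    rw [hgp]; exact ⟨by linarith, by linarith⟩

/-! #### The inner normal -/

/-- The unit tangent of the graph. -/
noncomputable def graphTangent (e : Plane) (g : ℝ → ℝ) (u : ℝ) : Plane :=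
  framePoint e (1 / graphSpeed g u, deriv g u / graphSpeed g u)

lemma neg_J_graphNormal (e : Plane) (g : ℝ → ℝ) (u : ℝ) :
    -J (graphNormal e g u) = graphTangent e g u := by
  simp only [graphNormal, graphTangent, framePoint, J_add, J_smul, J_J]
  module

lemma hasDerivAt_graphPoint {e : Plane} {g : ℝ → ℝ} (hg : ContDiff ℝ 1 g) (u : ℝ) :
    HasDerivAt (graphPoint e g) (e + deriv g u • J e) u := by
  have h1 : HasDerivAt (fun u => u • e) ((1 : ℝ) • e) u := (hasDerivAt_id u).smul_const e
  have h2 : HasDerivAt (fun u => g u • J e) (deriv g u • J e) u :=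
    ((hg.differentiable one_ne_zero) u).hasDerivAt.smul_const (J e)
  simpa using! h1.add h2

lemma graphSpeed_smul_graphTangent (e : Plane) (g : ℝ → ℝ) (u : ℝ) :
    graphSpeed g u • graphTangent e g u = e + deriv g u • J e := by
  have h := (graphSpeed_pos g u).ne'
  simp only [graphTangent, framePoint, smul_add, smul_smul]
  rw [mul_one_div_cancel h, mul_div_cancel₀ _ h, one_smul]

/-- Along the normal line membership in `E` is decided by the sign of `G`, whose derivative at `0`
is minus the speed. The second half rules out the opposite normal when uniqueness is proved. -/
lemma Chart.Represents.eventually_mem (hC : C.Represents E) {u : ℝ} (hu : u ∈ Ioo C.a C.b) :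
    ∀ᶠ s : ℝ in 𝓝[>] 0, graphPoint C.e C.g u + s • graphNormal C.e C.g u ∈ E ∧
      graphPoint C.e C.g u - s • graphNormal C.e C.g u ∉ E := by
  have he := C.norm_e
  set N := graphNormal C.e C.g u
  set x := graphPoint C.e C.g u
  set S := graphSpeed C.g u
  have hS : 0 < S := graphSpeed_pos _ _
  set G : ℝ → ℝ := fun s => C.g (u - s * (deriv C.g u / S)) - C.g u - s * (1 / S) with hG
  have hGd : HasDerivAt G (-S) 0 := by
    have h1 : HasDerivAt (fun s => u - s * (deriv C.g u / S)) (-(deriv C.g u / S)) 0 := by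
      simpa using ((hasDerivAt_id (0 : ℝ)).mul_const (deriv C.g u / S)).const_sub u
    have h2 := (C.contDiff.differentiable one_ne_zero u).hasDerivAt
    have h3 : HasDerivAt (fun s => C.g (u - s * (deriv C.g u / S)))
        (deriv C.g u * -(deriv C.g u / S)) 0 :=
      HasDerivAt.comp_of_eq (h₂ := C.g) (0 : ℝ) h2 h1 (by simp)
    have h4 : HasDerivAt (fun s : ℝ => s * (1 / S)) (1 / S) 0 := by
      simpa using (hasDerivAt_id (0 : ℝ)).mul_const (1 / S)
    have h5 := (h3.sub_const (C.g u)).sub h4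
    refine h5.congr_deriv ?_
    have := graphSpeed_sq C.g u
    field_simp
    change _ = -S ^ 2
    rw [this]; ring
  have hGo : ∀ᶠ s in 𝓝 (0 : ℝ), |G s + s * S| ≤ S / 2 * |s| := by
    have := (hasDerivAt_iff_isLittleO.1 hGd).def (half_pos hS)
    simpa [hG] using this
  have hb : ∀ᶠ s in 𝓝 (0 : ℝ), x + s • N ∈ C.box := by
    have h1 : Continuous fun s : ℝ => x + s • N := by fun_prop
    refine h1.continuousAt.eventually (C.isOpen_box.mem_nhds ?_)
    simpa using Chart.graphPoint_mem_box hu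
  have hcoord : ∀ s : ℝ, (inner ℝ (x + s • N) C.e : ℝ) = u - s * (deriv C.g u / S) ∧
      (inner ℝ (x + s • N) (J C.e) : ℝ) = C.g u + s * (1 / S) := by
    intro s
    rw [inner_add_left, inner_add_left, inner_smul_left, inner_smul_left,
      inner_graphPoint he, inner_graphPoint_J he]
    have h1 : (inner ℝ N C.e : ℝ) = -(deriv C.g u / S) := inner_framePoint he _
    have h2 : (inner ℝ N (J C.e) : ℝ) = 1 / S := inner_framePoint_J he _
    rw [h1, h2]
    simp; ring
  have hmem : ∀ᶠ s in 𝓝 (0 : ℝ), (x + s • N ∈ E ↔ G s < 0) := by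
    filter_upwards [hb] with s hs
    rw [hC.mem_iff hs, (hcoord s).1, (hcoord s).2, hG]
    constructor <;> intro h <;> linarith
  have hneg : Tendsto (fun s : ℝ => -s) (𝓝[>] 0) (𝓝 0) := by
    have : Continuous fun s : ℝ => -s := by fun_prop
    simpa using (this.tendsto 0).mono_left nhdsWithin_le_nhds
  filter_upwards [self_mem_nhdsWithin, nhdsWithin_le_nhds (hmem.and hGo),
    hneg.eventually (hmem.and hGo)] with s hs h1 h2
  have hs0 : 0 < s := hs
  constructor
  · rw [h1.1]
    have := (abs_le.1 h1.2).2
    rw [abs_of_pos hs0] at this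
    nlinarith
  · rw [sub_eq_add_neg, ← neg_smul, h2.1, not_lt]
    have := (abs_le.1 h2.2).1
    rw [abs_neg, abs_of_pos hs0] at this
    nlinarith

lemma abs_sub_le_dist_graphPoint {e : Plane} (he : ‖e‖ = 1) (g : ℝ → ℝ) (u w : ℝ) :
    |w - u| ≤ ‖graphPoint e g w - graphPoint e g u‖ := by
  have h1 : (inner ℝ (graphPoint e g w - graphPoint e g u) e : ℝ) = w - u := by
    rw [inner_sub_left, inner_graphPoint he, inner_graphPoint he]
  have h2 := abs_real_inner_le_norm (graphPoint e g w - graphPoint e g u) e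
  rwa [h1, he, mul_one] at h2

lemma inner_graphTangent_graphNormal {e : Plane} (he : ‖e‖ = 1) (g : ℝ → ℝ) (u : ℝ) :
    inner ℝ (e + deriv g u • J e) (graphNormal e g u) = (0 : ℝ) := by
  rw [inner_eq_frame he]
  simp only [graphNormal, inner_framePoint he, inner_framePoint_J he, inner_add_left,
    inner_smul_left, inner_J_J, inner_self_J, inner_J_self, inner_self_one he]
  simp; ring

lemma Chart.Represents.isInnerNormal (hC : C.Represents E) {u : ℝ} (hu : u ∈ Ioo C.a C.b) :
    IsInnerNormal E (graphPoint C.e C.g u) (graphNormal C.e C.g u) := by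
  have he := C.norm_e
  refine ⟨norm_graphNormal he _ _, ?_, (hC.eventually_mem hu).mono fun s hs => hs.1⟩
  set N := graphNormal C.e C.g u
  have hd : HasDerivAt (fun w => (inner ℝ (graphPoint C.e C.g w) N : ℝ)) 0 u := by
    have := (hasDerivAt_graphPoint (e := C.e) C.contDiff u).inner ℝ (hasDerivAt_const u N)
    simpa [N, inner_graphTangent_graphNormal he] using! this
  rw [Asymptotics.isLittleO_iff]
  intro c hc
  have h1 := (hasDerivAt_iff_isLittleO.1 hd).def hc
  have h2 : Tendsto (fun x : Plane => (inner ℝ x C.e : ℝ))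
      (𝓝[frontier E] graphPoint C.e C.g u) (𝓝 u) := by
    have : Continuous fun x : Plane => (inner ℝ x C.e : ℝ) := by fun_prop
    have h := this.tendsto (graphPoint C.e C.g u)
    rw [inner_graphPoint he] at h
    exact h.mono_left nhdsWithin_le_nhds
  filter_upwards [h2.eventually h1, self_mem_nhdsWithin,
    nhdsWithin_le_nhds (C.isOpen_box.mem_nhds (Chart.graphPoint_mem_box hu))] with x hx hxE hxb
  have hxg := hC.eq_graphPoint hxb hxE
  set w : ℝ := inner ℝ x C.e
  rw [smul_zero, sub_zero] at hx
  rw [hxg, inner_sub_left]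
  refine hx.trans (mul_le_mul_of_nonneg_left ?_ hc.le)
  exact abs_sub_le_dist_graphPoint he _ _ _

/-- An inner normal is orthogonal to the velocity of the graph, hence one of the two unit normals,
and the downward one does not point into `E`. -/
lemma Chart.Represents.innerNormal_eq (hC : C.Represents E) {u : ℝ} (hu : u ∈ Ioo C.a C.b) :
    innerNormal E (graphPoint C.e C.g u) = graphNormal C.e C.g u := by
  have he := C.norm_e
  have hex : ∃ n, IsInnerNormal E (graphPoint C.e C.g u) n := ⟨_, hC.isInnerNormal hu⟩
  rw [innerNormal, dif_pos hex]
  obtain ⟨hn1, hno, hni⟩ := hex.choose_spec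
  set n := hex.choose
  set N := graphNormal C.e C.g u with hN
  have hγ := hasDerivAt_graphPoint (e := C.e) C.contDiff u
  have htend : Tendsto (graphPoint C.e C.g) (𝓝 u) (𝓝[frontier E] graphPoint C.e C.g u) := by
    refine tendsto_nhdsWithin_iff.2 ⟨hγ.continuousAt, ?_⟩
    filter_upwards [isOpen_Ioo.mem_nhds hu] with w hw
    exact hC.graphPoint_mem_frontier hw
  have hd : HasDerivAt (fun w => (inner ℝ (graphPoint C.e C.g w) n : ℝ)) 0 u := by
    rw [hasDerivAt_iff_isLittleO]
    have h1 := (hno.comp_tendsto htend).trans_isBigO hγ.isBigO_sub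
    refine h1.congr_left fun w => ?_
    simp [inner_sub_left]
  have hd' : HasDerivAt (fun w => (inner ℝ (graphPoint C.e C.g w) n : ℝ))
      (inner ℝ (C.e + deriv C.g u • J C.e) n) u := by
    have := hγ.inner ℝ (hasDerivAt_const u n)
    simpa using! this
  have horth := hd'.unique hd
  rw [inner_eq_frame he] at horth
  simp only [inner_add_left, inner_smul_left, inner_J_J, inner_self_J, inner_J_self,
    inner_self_one he] at horth
  simp at horth
  set n1 : ℝ := inner ℝ n C.e with hn1'
  set n2 : ℝ := inner ℝ n (J C.e) with hn2'
  have hnf : n = framePoint C.e (n1, n2) := (framePoint_inner he n).symm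
  have hnsq : n1 ^ 2 + n2 ^ 2 = 1 := by
    rw [← norm_framePoint_sq he (n1, n2), ← hnf, hn1]; norm_num
  set S := graphSpeed C.g u with hSdef
  have hS : 0 < S := graphSpeed_pos _ _
  have hS2 : S ^ 2 = 1 + deriv C.g u ^ 2 := graphSpeed_sq _ _
  have hn1e : n1 = -(deriv C.g u * n2) := by linarith
  have hn2S : (n2 * S) ^ 2 = 1 := by
    rw [mul_pow, hS2]; rw [hn1e] at hnsq; linarith
  rcases mul_self_eq_one_iff.1 ((sq (n2 * S)).symm.trans hn2S) with h | h
  · rw [hnf, hN, graphNormal]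
    congr 1
    refine Prod.ext ?_ ?_
    · change n1 = -(deriv C.g u / S)
      rw [hn1e]; field_simp; rw [mul_assoc, h, mul_one]
    · change n2 = 1 / S
      field_simp; linarith
  · exfalso
    have hnN : n = -N := by
      rw [hnf, hN, graphNormal]
      have : n2 = -(1 / S) := by field_simp; linarith
      simp only [framePoint, hn1e, this]
      module
    obtain ⟨s, hs1, hs2⟩ := (hni.and (hC.eventually_mem hu)).exists
    rw [hnN, smul_neg, ← sub_eq_add_neg] at hs1
    exact hs2.2 hs1

lemma Chart.Represents.tangent_eq (hC : C.Represents E) {u : ℝ} (hu : u ∈ Ioo C.a C.b) :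
    tangent E (graphPoint C.e C.g u) = graphTangent C.e C.g u := by
  rw [tangent, hC.innerNormal_eq hu, neg_J_graphNormal]

/-! #### The angle -/

lemma toC_div (t p : Plane) (hp : p ≠ 0) :
    toC t / toC p = ⟨inner ℝ p t / ‖p‖ ^ 2, -inner ℝ p (J t) / ‖p‖ ^ 2⟩ := by
  have hn : ‖p‖ ^ 2 ≠ 0 := pow_ne_zero _ (norm_ne_zero_iff.2 hp)
  have hpc : toC p ≠ 0 := by
    intro h
    have h0 := congrArg Complex.re h
    have h1 := congrArg Complex.im h
    exact hp (plane_ext h0 h1)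
  rw [div_eq_iff hpc]
  rw [norm_sq_plane] at hn ⊢
  apply Complex.ext
  · simp only [toC, Complex.mul_re, inner_plane, J_zero, J_one]
    field_simp; ring
  · simp only [toC, Complex.mul_im, inner_plane, J_zero, J_one]
    field_simp; ring

lemma norm_toC (p : Plane) : ‖toC p‖ = ‖p‖ := by
  have h : ‖toC p‖ ^ 2 = ‖p‖ ^ 2 := by
    rw [← Complex.normSq_eq_norm_sq, norm_sq_plane, Complex.normSq_apply]
    simp only [toC]; ring
  exact (pow_left_inj₀ (norm_nonneg _) (norm_nonneg _) two_ne_zero).1 h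

/-- The real and imaginary parts of `t / p` are, up to the factor `|p|⁻²`, the products `⟨p, t⟩` and
`-⟨p, J t⟩`, and `J t = n`. Thus `cos σ = 0` says that the boundary is tangent to a centred circle.
-/
lemma cos_sin_sigma {p : Plane} (hp : p ≠ 0) (hn : ‖innerNormal E p‖ = 1) :
    Real.cos (sigma E p) = inner ℝ p (tangent E p) / ‖p‖ ∧
      Real.sin (sigma E p) = -inner ℝ p (innerNormal E p) / ‖p‖ := by
  have hp0 : ‖p‖ ≠ 0 := norm_ne_zero_iff.2 hp
  have ht : ‖tangent E p‖ = 1 := by rw [tangent, norm_neg, norm_J, hn]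
  have hz : ‖toC (tangent E p) / toC p‖ = 1 / ‖p‖ := by rw [norm_div, norm_toC, norm_toC, ht]
  have hz0 : toC (tangent E p) / toC p ≠ 0 := by
    rw [← norm_ne_zero_iff, hz]; exact one_div_ne_zero hp0
  rw [sigma, Complex.cos_arg hz0, Complex.sin_arg, hz, toC_div _ _ hp]
  have hJ : J (tangent E p) = innerNormal E p := by rw [tangent, J_neg, J_J, neg_neg]
  rw [hJ]
  constructor
  · field_simp
  · field_simp

end LogConvexIso

namespace LogConvexIso

/-! ### Curvature of a graph -/

variable {C : Chart} {E : Set Plane}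

/-- Arc-length reparametrisation of the line with speed `graphSpeed g`. -/
lemma exists_arclength {g : ℝ → ℝ} (hg : ContDiff ℝ 1 g) (u : ℝ) :
    ∃ m : ℝ → ℝ, m 0 = u ∧ StrictMono m ∧ ∀ s, HasDerivAt m (1 / graphSpeed g (m s)) s := by
  have hS := continuous_graphSpeed hg
  set ℓ : ℝ → ℝ := fun w => ∫ x in u..w, graphSpeed g x with hℓ
  have hd : ∀ w, HasDerivAt ℓ (graphSpeed g w) w := fun w =>
    intervalIntegral.integral_hasDerivAt_right (hS.intervalIntegrable _ _)
      (hS.stronglyMeasurableAtFilter _ _) hS.continuousAt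
  have hℓc : Continuous ℓ := continuous_iff_continuousAt.2 fun w => (hd w).continuousAt
  have hmono : StrictMono ℓ :=
    strictMono_of_deriv_pos fun w => by rw [(hd w).deriv]; exact graphSpeed_pos _ _
  have hge : ∀ x, 1 ≤ graphSpeed g x := fun x =>
    Real.one_le_sqrt.2 (by nlinarith [sq_nonneg (deriv g x)])
  have hℓ0 : ℓ u = 0 := intervalIntegral.integral_same
  -- The speed is at least one, so arc length grows at least linearly and is onto `ℝ`.
  have hmono' : Monotone fun w => ℓ w - w := by
    refine monotone_of_deriv_nonneg (fun w => ((hd w).fun_sub (hasDerivAt_id' w)).differentiableAt)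
      fun w => ?_
    rw [((hd w).fun_sub (hasDerivAt_id' w)).deriv]
    linarith [hge w]
  have hsurj : Function.Surjective ℓ := by
    refine hℓc.surjective ?_ ?_
    · refine tendsto_atTop_mono' atTop (f₁ := fun w => w - u) ?_
        (tendsto_atTop_add_const_right _ _ tendsto_id)
      filter_upwards [eventually_ge_atTop u] with w hw
      have := hmono' hw
      simp only [hℓ0] at this
      linarith
    · refine tendsto_atBot_mono' atBot (f₁ := fun w => w - u) ?_
        (tendsto_atBot_add_const_right _ _ tendsto_id)
      filter_upwards [eventually_le_atBot u] with w hw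
      have := hmono' hw
      simp only [hℓ0] at this
      linarith
  set o := hmono.orderIsoOfSurjective ℓ hsurj with ho
  have hoapp : ∀ w, o w = ℓ w := fun _ => rfl
  refine ⟨o.symm, ?_, o.symm.strictMono, fun s => ?_⟩
  · rw [OrderIso.symm_apply_eq, hoapp, hℓ0]
  · rw [one_div]
    refine HasDerivAt.of_local_left_inverse o.symm.continuous.continuousAt (hd _)
      (graphSpeed_pos _ _).ne' (Eventually.of_forall fun t => ?_)
    rw [← hoapp, OrderIso.apply_symm_apply]

lemma norm_graphTangent {e : Plane} (he : ‖e‖ = 1) (g : ℝ → ℝ) (u : ℝ) :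
    ‖graphTangent e g u‖ = 1 := by
  rw [← neg_J_graphNormal, norm_neg, norm_J, norm_graphNormal he]

lemma continuous_graphTangent {e : Plane} {g : ℝ → ℝ} (hg : ContDiff ℝ 1 g) :
    Continuous (graphTangent e g) := by
  have h1 := hg.continuous_deriv_one
  have h2 := continuous_graphSpeed hg
  have h3 : ∀ u, graphSpeed g u ≠ 0 := fun u => (graphSpeed_pos g u).ne'
  exact (continuous_framePoint e).comp (by fun_prop (disch := exact h3 _))

lemma hasDerivAt_graphSpeed {g : ℝ → ℝ} {u g'' : ℝ} (hg : HasDerivAt (deriv g) g'' u) :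
    HasDerivAt (graphSpeed g) (deriv g u * g'' / graphSpeed g u) u := by
  have h := ((hg.fun_pow 2).const_add 1).sqrt (by positivity)
  refine h.congr_deriv ?_
  have : √(1 + deriv g u ^ 2) = graphSpeed g u := rfl
  have h0 := (graphSpeed_pos g u).ne'
  rw [this]
  field_simp
  simp; ring

lemma hasDerivAt_graphTangent {e : Plane} {g : ℝ → ℝ} {u g'' : ℝ}
    (hg : HasDerivAt (deriv g) g'' u) :
    HasDerivAt (graphTangent e g) ((g'' / graphSpeed g u ^ 2) • graphNormal e g u) u := by
  have hS := hasDerivAt_graphSpeed hg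
  have h0 := (graphSpeed_pos g u).ne'
  have hsq := graphSpeed_sq g u
  have h1 : HasDerivAt (fun w => 1 / graphSpeed g w)
      (-(deriv g u * g'' / graphSpeed g u ^ 3)) u := by
    simp only [one_div]
    refine (hS.fun_inv h0).congr_deriv ?_
    field_simp
  have h2 : HasDerivAt (fun w => deriv g w / graphSpeed g w) (g'' / graphSpeed g u ^ 3) u := by
    refine (hg.fun_div hS h0).congr_deriv ?_
    field_simp
    rw [hsq]; ring
  have h3 := (h1.smul_const e).add (h2.smul_const (J e))
  refine HasDerivAt.congr_deriv (f := graphTangent e g) h3 ?_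
  simp only [graphNormal, framePoint, smul_add, smul_smul]
  congr 2 <;> field_simp

/-- Where the second derivative of the graph function exists, the curvature exists and has the
usual value. -/
lemma Chart.Represents.hasCurvatureAt (hC : C.Represents E) {u g'' : ℝ}
    (hu : u ∈ Ioo C.a C.b) (hg : HasDerivAt (deriv C.g) g'' u) :
    HasCurvatureAt E (graphPoint C.e C.g u) (g'' / graphSpeed C.g u ^ 3) := by
  have he := C.norm_e
  obtain ⟨m, hm0, hmm, hmd⟩ := exists_arclength C.contDiff u
  have hmc : Continuous m := continuous_iff_continuousAt.2 fun s => (hmd s).continuousAt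
  set γ : ℝ → Plane := fun s => graphPoint C.e C.g (m s) with hγ
  have hγd : ∀ s, HasDerivAt γ (graphTangent C.e C.g (m s)) s := by
    intro s
    have h1 := (hasDerivAt_graphPoint (e := C.e) C.contDiff (m s)).scomp s (hmd s)
    rw [← graphSpeed_smul_graphTangent, smul_smul,
      one_div_mul_cancel (graphSpeed_pos _ _).ne', one_smul] at h1
    exact h1
  have hγ' : deriv γ = fun s => graphTangent C.e C.g (m s) := funext fun s => (hγd s).deriv
  have hev : ∀ᶠ s in 𝓝 (0 : ℝ), m s ∈ Ioo C.a C.b :=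
    hmc.continuousAt.eventually (isOpen_Ioo.mem_nhds (by rwa [hm0]))
  obtain ⟨δ, hδ, hδm⟩ := Metric.eventually_nhds_iff.1 hev
  refine ⟨γ, δ, ⟨hδ, ?_, fun s _ => ?_, ?_, ?_⟩, ?_, ?_, ?_⟩
  · refine (contDiff_one_iff_deriv.2 ⟨fun s => (hγd s).differentiableAt, ?_⟩).contDiffOn
    rw [hγ']; exact (continuous_graphTangent C.contDiff).comp hmc
  · rw [(hγd s).deriv, norm_graphTangent he]
  · intro s _ t _ hst
    have := congrArg (fun x => (inner ℝ x C.e : ℝ)) hst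
    simp only [hγ, inner_graphPoint he] at this
    exact hmm.injective this
  -- The strip selects the parameters in `(-δ, δ)`, and in the box the boundary is the graph.
  · refine ⟨{x | (inner ℝ x C.e : ℝ) ∈ Ioo (m (-δ)) (m δ)} ∩ C.box, ?_, ?_⟩
    · exact (isOpen_Ioo.preimage
        (by fun_prop : Continuous fun y : Plane => (inner ℝ y C.e : ℝ))).inter C.isOpen_box
    · ext x
      constructor
      · rintro ⟨s, hs, rfl⟩
        have hms : m s ∈ Ioo C.a C.b := hδm (by
          rw [Real.dist_eq, sub_zero, abs_lt]; exact hs)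
        refine ⟨hC.graphPoint_mem_frontier hms, ?_, Chart.graphPoint_mem_box hms⟩
        rw [mem_ofPred_eq, inner_graphPoint he]
        exact ⟨hmm hs.1, hmm hs.2⟩
      · rintro ⟨hxE, hx1, hxb⟩
        obtain ⟨s, hs, hsx⟩ := intermediate_value_Ioo (by linarith : -δ ≤ δ) hmc.continuousOn hx1
        refine ⟨s, hs, ?_⟩
        simp only [hγ]
        rw [hsx, ← hC.eq_graphPoint hxb hxE]
  · simp only [hγ, hm0]
  · rw [hγ', hC.tangent_eq hu]; simp only [hm0]
  · rw [hγ', hC.innerNormal_eq hu]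
    have h1 := hasDerivAt_graphTangent (e := C.e) hg
    have h2 := hmd 0
    rw [hm0] at h2
    have h3 := HasDerivAt.scomp_of_eq (0 : ℝ) h1 h2 hm0.symm
    refine HasDerivAt.congr_deriv h3 ?_
    rw [smul_smul]
    congr 1
    have h0 := (graphSpeed_pos C.g u).ne'
    field_simp

end LogConvexIso

namespace LogConvexIso

/-! ### Boundary points with radial normal -/

variable {C : Chart} {E : Set Plane}

lemma Chart.Represents.mem_Lam_iff (hC : C.Represents E) {u : ℝ} (hu : u ∈ Ioo C.a C.b)
    (h0 : graphPoint C.e C.g u ≠ 0) : graphPoint C.e C.g u ∈ Lam E ↔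
      inner ℝ (graphPoint C.e C.g u) (C.e + deriv C.g u • J C.e) = (0 : ℝ) := by
  have hn : ‖innerNormal E (graphPoint C.e C.g u)‖ = 1 := by
    rw [hC.innerNormal_eq hu, norm_graphNormal C.norm_e]
  have hS := (graphSpeed_pos C.g u).ne'
  have h1 := (cos_sin_sigma h0 hn).1
  rw [hC.tangent_eq hu] at h1
  rw [← graphSpeed_smul_graphTangent, inner_smul_right]
  simp [Lam, hC.graphPoint_mem_frontier hu, h0, h1, hS]

lemma hasDerivAt_norm_sq_graphPoint {e : Plane} {g : ℝ → ℝ} (hg : ContDiff ℝ 1 g) (u : ℝ) :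
    HasDerivAt (fun w => ‖graphPoint e g w‖ ^ 2)
      (2 * inner ℝ (graphPoint e g u) (e + deriv g u • J e)) u :=
  (hasDerivAt_graphPoint hg u).norm_sq

/-- A boundary point near which the boundary stays on a centred circle belongs to `Λ₁`. -/
lemma Chart.Represents.mem_Lam₁ (hC : C.Represents E) {u τ : ℝ} (hu : u ∈ Ioo C.a C.b)
    (hτ : 0 < τ) (h : ∀ᶠ w in 𝓝 u, ‖graphPoint C.e C.g w‖ = τ) :
    graphPoint C.e C.g u ∈ Lam₁ E := by
  have h1 : ∀ᶠ w in 𝓝 u, w ∈ Ioo C.a C.b → graphPoint C.e C.g w ∈ Lam E := by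
    filter_upwards [h.eventually_nhds] with w hw hwI
    have hw0 : graphPoint C.e C.g w ≠ 0 := by
      rw [← norm_ne_zero_iff, hw.self_of_nhds]; exact hτ.ne'
    refine (hC.mem_Lam_iff hwI hw0).2 ?_
    have h2 : HasDerivAt (fun w => ‖graphPoint C.e C.g w‖ ^ 2) 0 w :=
      (hasDerivAt_const w (τ ^ 2)).congr_of_eventuallyEq (hw.mono fun x hx => by
        simp only [hx])
    have := (hasDerivAt_norm_sq_graphPoint C.contDiff w).unique h2
    linarith
  have hcont : Continuous fun x : Plane => (inner ℝ x C.e : ℝ) := by fun_prop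
  have h2 : ∀ᶠ x in 𝓝 (graphPoint C.e C.g u), x ∈ C.box ∧
      ((inner ℝ x C.e : ℝ) ∈ Ioo C.a C.b → graphPoint C.e C.g (inner ℝ x C.e) ∈ Lam E) := by
    have hb : ∀ᶠ x in 𝓝 (graphPoint C.e C.g u), x ∈ C.box :=
      C.isOpen_box.mem_nhds (Chart.graphPoint_mem_box hu)
    refine hb.and ?_
    have ht := hcont.tendsto (graphPoint C.e C.g u)
    rw [inner_graphPoint C.norm_e] at ht
    exact ht.eventually h1
  obtain ⟨ρ, hρ, hball⟩ := Metric.eventually_nhds_iff_ball.1 h2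
  refine ⟨hC.graphPoint_mem_frontier hu, ρ, hρ, ?_⟩
  congr 1
  ext x
  constructor
  · rintro ⟨hx, hxb⟩; exact ⟨hx.1, hxb⟩
  · rintro ⟨hx, hxb⟩
    obtain ⟨hxB, hxL⟩ := hball x hxb
    refine ⟨?_, hxb⟩
    have := hxL hxB.1
    rwa [← hC.eq_graphPoint hxB hx] at this

/-! #### Length of the boundary -/

lemma exists_lipschitzOnWith_graphPoint {e : Plane} {g : ℝ → ℝ} (hg : ContDiff ℝ 1 g) (a b : ℝ) :
    ∃ K, LipschitzOnWith K (graphPoint e g) (Icc a b) := by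
  have h1 : ContDiff ℝ 1 (graphPoint e g) := by
    unfold graphPoint framePoint
    exact (contDiff_id.smul contDiff_const).add (hg.smul contDiff_const)
  exact h1.locallyLipschitz.locallyLipschitzOn.exists_lipschitzOnWith_of_compact isCompact_Icc

lemma Chart.Represents.frontier_inter_box (hC : C.Represents E) :
    frontier E ∩ C.box = graphPoint C.e C.g '' Ioo C.a C.b := by
  ext x
  constructor
  · rintro ⟨hx, hxb⟩
    exact ⟨_, hxb.1, (hC.eq_graphPoint hxb hx).symm⟩
  · rintro ⟨u, hu, rfl⟩
    exact ⟨hC.graphPoint_mem_frontier hu, Chart.graphPoint_mem_box hu⟩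

/-- The graph map is Lipschitz on the compact base. This transfers almost everywhere statements from
the parameter to the boundary. -/
lemma Chart.hausdorffMeasure_image_eq_zero {N : Set ℝ} (hN : volume N = 0)
    (hNI : N ⊆ Ioo C.a C.b) : Measure.hausdorffMeasure 1 (graphPoint C.e C.g '' N) = 0 := by
  obtain ⟨K, hK⟩ := exists_lipschitzOnWith_graphPoint (e := C.e) C.contDiff C.a C.b
  have h1 := (hK.mono (hNI.trans Ioo_subset_Icc_self)).hausdorffMeasure_image_le zero_le_one
  rw [hausdorffMeasure_real, hN, mul_zero] at h1
  exact le_antisymm h1 (zero_le)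

lemma Chart.Represents.hausdorffMeasure_lt_top (hC : C.Represents E) :
    Measure.hausdorffMeasure 1 (frontier E ∩ C.box) < ⊤ := by
  obtain ⟨K, hK⟩ := exists_lipschitzOnWith_graphPoint (e := C.e) C.contDiff C.a C.b
  rw [hC.frontier_inter_box]
  refine ((hK.mono Ioo_subset_Icc_self).hausdorffMeasure_image_le zero_le_one).trans_lt ?_
  rw [hausdorffMeasure_real, Real.volume_Ioo]
  exact ENNReal.mul_lt_top (by simp) ENNReal.ofReal_lt_top

lemma HasC11Boundary.hausdorffMeasure_frontier_lt_top (hE : HasC11Boundary E)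
    (hb : Bornology.IsBounded E) : Measure.hausdorffMeasure 1 (frontier E) < ⊤ := by
  have hK : IsCompact (frontier E) :=
    hb.isCompact_closure.of_isClosed_subset isClosed_frontier frontier_subset_closure
  refine hK.measure_lt_top_of_nhdsWithin fun p hp => ?_
  obtain ⟨C, hC, hpC, -⟩ := hE.exists_chart hp univ_mem
  refine ⟨frontier E ∩ C.box, inter_mem self_mem_nhdsWithin
    (mem_nhdsWithin_of_mem_nhds (C.isOpen_box.mem_nhds hpC)), hC.hausdorffMeasure_lt_top⟩

/-- The projection to the base is 1-Lipschitz and maps the piece of boundary onto a set containing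
an interval. -/
lemma Chart.Represents.hausdorffMeasure_pos (hC : C.Represents E) {u : ℝ}
    (hu : u ∈ Ioo C.a C.b) {W : Set Plane} (hW : W ∈ 𝓝 (graphPoint C.e C.g u)) :
    0 < Measure.hausdorffMeasure 1 (frontier E ∩ W) := by
  have hc := continuous_graphPoint (e := C.e) C.contDiff.continuous
  obtain ⟨r, hr, hball⟩ := Metric.mem_nhds_iff.1
    (inter_mem (hc.continuousAt.preimage_mem_nhds hW) (isOpen_Ioo.mem_nhds hu))
  have hproj : LipschitzWith 1 fun x : Plane => (inner ℝ x C.e : ℝ) := by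
    refine LipschitzWith.of_dist_le_mul fun x y => ?_
    rw [Real.dist_eq, ← inner_sub_left, dist_eq_norm, NNReal.coe_one, one_mul]
    refine (abs_real_inner_le_norm _ _).trans_eq ?_
    rw [C.norm_e, mul_one]
  have h1 := hproj.hausdorffMeasure_image_le zero_le_one (frontier E ∩ W)
  rw [hausdorffMeasure_real] at h1
  have h2 : Metric.ball u r ⊆ (fun x : Plane => (inner ℝ x C.e : ℝ)) '' (frontier E ∩ W) := by
    intro w hw
    obtain ⟨hwW, hwI⟩ := hball hw
    exact ⟨graphPoint C.e C.g w, ⟨hC.graphPoint_mem_frontier hwI, hwW⟩,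
      inner_graphPoint C.norm_e _ _⟩
  have h3 : 0 < volume (Metric.ball u r) := Metric.measure_ball_pos _ _ hr
  have h4 := h3.trans_le ((measure_mono h2).trans h1)
  simpa using h4

/-- Near a point of `Λ₁` the boundary is everywhere orthogonal to the position vector. -/
lemma Chart.Represents.inner_eq_zero_of_mem_Lam₁ (hC : C.Represents E)
    (hfin : Measure.hausdorffMeasure 1 (frontier E) < ⊤) {x : Plane} {ρ : ℝ}
    (hρ : Measure.hausdorffMeasure 1 (Lam E ∩ Metric.ball x ρ) =
      Measure.hausdorffMeasure 1 (frontier E ∩ Metric.ball x ρ))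
    (hbox : C.box ⊆ Metric.ball x ρ) (h0 : (0 : Plane) ∉ C.box) {u : ℝ} (hu : u ∈ Ioo C.a C.b) :
    inner ℝ (graphPoint C.e C.g u) (C.e + deriv C.g u • J C.e) = (0 : ℝ) := by
  by_contra hne
  have hc := continuous_graphPoint (e := C.e) C.contDiff.continuous
  have hg' := C.contDiff.continuous_deriv_one
  have hw0 : ∀ w ∈ Ioo C.a C.b, graphPoint C.e C.g w ≠ 0 := fun w hw h =>
    h0 (h ▸ Chart.graphPoint_mem_box hw)
  set G : ℝ → ℝ := fun w => inner ℝ (graphPoint C.e C.g w) (C.e + deriv C.g w • J C.e) with hG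
  have hGc : Continuous G := by
    refine hc.inner (continuous_const.add (hg'.smul continuous_const))
  -- By continuity, orthogonality fails on all of the boundary in the open set `W`, a piece of
  -- positive length that misses `Λ`. As the total length is finite, `Λ` cannot have full measure in
  -- the ball.
  set W : Set Plane := C.box ∩ (fun y : Plane => (inner ℝ y C.e : ℝ)) ⁻¹' {w | G w ≠ 0} with hW
  have hWo : IsOpen W := C.isOpen_box.inter
    ((isOpen_ne_fun hGc continuous_const).preimage (by fun_prop))
  have huW : graphPoint C.e C.g u ∈ W := by
    refine ⟨Chart.graphPoint_mem_box hu, ?_⟩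
    change G (inner ℝ (graphPoint C.e C.g u) C.e) ≠ 0
    rw [inner_graphPoint C.norm_e]; exact hne
  have hLW : Lam E ∩ Metric.ball x ρ ⊆ (frontier E ∩ Metric.ball x ρ) \ W := by
    rintro y ⟨hy, hyb⟩
    refine ⟨⟨hy.1, hyb⟩, fun hyW => ?_⟩
    have hyg := hC.eq_graphPoint hyW.1 hy.1
    have h1 : G (inner ℝ y C.e) ≠ 0 := hyW.2
    rw [hyg] at hy
    exact h1 ((hC.mem_Lam_iff hyW.1.1 (hw0 _ hyW.1.1)).1 hy)
  have hpos := hC.hausdorffMeasure_pos hu (hWo.mem_nhds huW)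
  have hsub : frontier E ∩ W ⊆ (frontier E ∩ Metric.ball x ρ) ∩ W := fun y hy =>
    ⟨⟨hy.1, hbox hy.2.1⟩, hy.2⟩
  have hadd := measure_inter_add_sdiff (μ := (Measure.hausdorffMeasure 1 : Measure Plane))
    (frontier E ∩ Metric.ball x ρ) hWo.measurableSet
  have hlt : Measure.hausdorffMeasure 1 (frontier E ∩ Metric.ball x ρ) < ⊤ :=
    (measure_mono inter_subset_left).trans_lt hfin
  have h1 := measure_mono (μ := (Measure.hausdorffMeasure 1 : Measure Plane)) hLW
  rw [hρ] at h1
  have h2 : (Measure.hausdorffMeasure 1 : Measure Plane) ((frontier E ∩ Metric.ball x ρ) \ W) < ⊤ :=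
    (measure_mono sdiff_subset).trans_lt hlt
  have h3 : 0 < (Measure.hausdorffMeasure 1 : Measure Plane)
      (frontier E ∩ Metric.ball x ρ ∩ W) := hpos.trans_le (measure_mono hsub)
  have h4 := ENNReal.lt_add_right h2.ne h3.ne'
  rw [add_comm, hadd] at h4
  exact absurd h1 (not_le.2 h4)

/-! #### Consequences of spherical cap symmetry -/

/-- Each cap is the whole circle or a superlevel set of the first coordinate on it. -/
lemma mem_of_capSymmetral (hsymm : E \ {0} = capSymmetral E) {x y : Plane} (hx : x ∈ E)
    (hx0 : x ≠ 0) (hxy : ‖y‖ = ‖x‖) (hle : (inner ℝ x e₁ : ℝ) ≤ inner ℝ y e₁) : y ∈ E := by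
  have h1 : x ∈ capSymmetral E := hsymm ▸ ⟨hx, hx0⟩
  suffices y ∈ capSymmetral E by
    rw [← hsymm] at this; exact this.1
  simp only [capSymmetral, mem_iUnion] at h1 ⊢
  obtain ⟨τ, hτ, hxτ⟩ := h1
  refine ⟨τ, hτ, ?_⟩
  unfold sphericalCap at hxτ ⊢
  split_ifs at hxτ ⊢ with hα
  · obtain ⟨h2, h3⟩ := hxτ
    refine ⟨by simpa [hxy] using h2, ?_⟩
    rw [hxy]; exact h3.trans_le hle
  · simpa [hxy] using hxτ

/-- Points `z` of `E` near `x` are moved to the ray through `y` without changing their modulus. The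
strict inequality persists near `x`, so the moved points stay in `E`, and they approach `y`. -/
lemma mem_closure_of_capSymmetral (hsymm : E \ {0} = capSymmetral E) {x y : Plane}
    (hx : x ∈ closure E) (hx0 : x ≠ 0) (hxy : ‖y‖ = ‖x‖)
    (hlt : (inner ℝ x e₁ : ℝ) < inner ℝ y e₁) : y ∈ closure E := by
  set Φ : Plane → Plane := fun z => (‖z‖ / ‖x‖) • y with hΦ
  have hΦc : Continuous Φ := by fun_prop
  have hxn : ‖x‖ ≠ 0 := norm_ne_zero_iff.2 hx0
  have hΦx : Φ x = y := by simp [hΦ, hxn]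
  have hΦt : Tendsto Φ (𝓝 x) (𝓝 y) := by
    have := hΦc.tendsto x
    rwa [hΦx] at this
  have h1 : ∀ᶠ z in 𝓝 x, (inner ℝ z e₁ : ℝ) < inner ℝ (Φ z) e₁ := by
    refine (isOpen_lt (f := fun z : Plane => (inner ℝ z e₁ : ℝ))
      (g := fun z => (inner ℝ (Φ z) e₁ : ℝ)) (by fun_prop) (by fun_prop)).mem_nhds ?_
    change (inner ℝ x e₁ : ℝ) < inner ℝ (Φ x) e₁
    rwa [hΦx]
  have h2 : ∃ᶠ z in 𝓝 x, Φ z ∈ E := by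
    refine ((mem_closure_iff_frequently.1 hx).and_eventually
      (h1.and (isOpen_ne.mem_nhds hx0))).mono ?_
    rintro z ⟨hzE, hz1, hz0⟩
    refine mem_of_capSymmetral hsymm hzE hz0 ?_ hz1.le
    rw [hΦ]
    simp only [norm_smul, norm_div, norm_norm, hxy]
    field_simp
  exact mem_closure_iff_frequently.2 (hΦt.frequently h2)

/-- The boundary contains each arc of a centred circle between two of its points in one half-plane,
here described by the first coordinate. -/
lemma mem_frontier_of_between (hsymm : E \ {0} = capSymmetral E) (hopen : IsOpen E)
    {x y z : Plane} (hx : x ∈ frontier E) (hz : z ∈ frontier E) (hx0 : x ≠ 0)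
    (hxy : ‖y‖ = ‖x‖) (hzy : ‖z‖ = ‖y‖) (h1 : (inner ℝ x e₁ : ℝ) < inner ℝ y e₁)
    (h2 : (inner ℝ y e₁ : ℝ) < inner ℝ z e₁) : y ∈ frontier E := by
  rw [hopen.frontier_eq] at hx hz ⊢
  have hy0 : y ≠ 0 := by rw [← norm_ne_zero_iff, hxy]; exact norm_ne_zero_iff.2 hx0
  exact ⟨mem_closure_of_capSymmetral hsymm hx.1 hx0 hxy h1,
    fun hy => hz.2 (mem_of_capSymmetral hsymm hy hy0 hzy h2.le)⟩

lemma graphPoint_injective {e : Plane} (he : ‖e‖ = 1) (g : ℝ → ℝ) :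
    Function.Injective (graphPoint e g) := fun u w h => by
  have := congrArg (fun x => (inner ℝ x e : ℝ)) h
  simpa only [inner_graphPoint he] using this

/-- The circular arc `c` around the middle point stays between the outer points in first coordinate,
so it lies in the boundary. In the chart it covers the graph near `u₂`, because its abscissa has
nonzero strict derivative and so maps neighbourhoods onto neighbourhoods. -/
lemma Chart.Represents.mem_Lam₁_of_between (hC : C.Represents E)
    (hsymm : E \ {0} = capSymmetral E) (hopen : IsOpen E) {τ : ℝ} (hτ : 0 < τ) {u₁ u₂ u₃ : ℝ}
    (hu₁ : u₁ ∈ Ioo C.a C.b) (hu₂ : u₂ ∈ Ioo C.a C.b) (hu₃ : u₃ ∈ Ioo C.a C.b)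
    (hτ₁ : ‖graphPoint C.e C.g u₁‖ = τ) (hτ₂ : ‖graphPoint C.e C.g u₂‖ = τ)
    (hτ₃ : ‖graphPoint C.e C.g u₃‖ = τ)
    (h₁₂ : (inner ℝ (graphPoint C.e C.g u₁) e₁ : ℝ) < inner ℝ (graphPoint C.e C.g u₂) e₁)
    (h₂₃ : (inner ℝ (graphPoint C.e C.g u₂) e₁ : ℝ) < inner ℝ (graphPoint C.e C.g u₃) e₁) :
    graphPoint C.e C.g u₂ ∈ Lam₁ E := by
  have he := C.norm_e
  set y := graphPoint C.e C.g u₂ with hy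
  set c : ℝ → Plane := fun θ => Real.cos θ • y + Real.sin θ • J y with hc
  have hcn : ∀ θ, ‖c θ‖ = τ := by
    intro θ
    have h1 : ‖c θ‖ ^ 2 = τ ^ 2 := by
      rw [← real_inner_self_eq_norm_sq]
      simp only [hc, inner_add_left, inner_add_right, inner_smul_left, inner_smul_right,
        inner_self_J, inner_J_self, real_inner_self_eq_norm_sq, norm_J, hτ₂]
      simp
      linear_combination τ ^ 2 * Real.sin_sq_add_cos_sq θ
    exact (pow_left_inj₀ (norm_nonneg _) hτ.le two_ne_zero).1 h1
  have hcc : Continuous c := by fun_prop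
  have hc0 : c 0 = y := by simp [hc]
  have hx0 : graphPoint C.e C.g u₁ ≠ 0 := by
    rw [← norm_ne_zero_iff, hτ₁]; exact hτ.ne'
  have hcF : ∀ᶠ θ in 𝓝 (0 : ℝ), c θ ∈ C.box ∧ c θ ∈ frontier E := by
    have hb : ∀ᶠ θ in 𝓝 (0 : ℝ), c θ ∈ C.box :=
      hcc.continuousAt.eventually (C.isOpen_box.mem_nhds (by
        rw [hc0]; exact Chart.graphPoint_mem_box hu₂))
    have hI : ∀ᶠ θ in 𝓝 (0 : ℝ), (inner ℝ (c θ) e₁ : ℝ) ∈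
        Ioo (inner ℝ (graphPoint C.e C.g u₁) e₁) (inner ℝ (graphPoint C.e C.g u₃) e₁ : ℝ) := by
      have : Continuous fun θ => (inner ℝ (c θ) e₁ : ℝ) := by fun_prop
      refine this.continuousAt.eventually (isOpen_Ioo.mem_nhds ?_)
      simp only [hc0]; exact ⟨h₁₂, h₂₃⟩
    filter_upwards [hb, hI] with θ h1 h2
    exact ⟨h1, mem_frontier_of_between hsymm hopen (hC.graphPoint_mem_frontier hu₁)
      (hC.graphPoint_mem_frontier hu₃) hx0 (by rw [hcn, hτ₁]) (by rw [hcn, hτ₃]) h2.1 h2.2⟩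
  have hcd : ∀ v : Plane, HasStrictDerivAt (fun θ => (inner ℝ (c θ) v : ℝ)) (inner ℝ (J y) v) 0 := by
    intro v
    have h1 := ((Real.hasStrictDerivAt_cos 0).mul_const (inner ℝ y v)).fun_add
      ((Real.hasStrictDerivAt_sin 0).mul_const (inner ℝ (J y) v))
    have h2 : (fun θ => (inner ℝ (c θ) v : ℝ)) =
        fun θ => Real.cos θ * inner ℝ y v + Real.sin θ * inner ℝ (J y) v := by
      ext θ; simp [hc, inner_add_left, inner_smul_left]
    rw [h2]
    simpa using h1
  have hU0 : (inner ℝ (c 0) C.e : ℝ) = u₂ := by rw [hc0, hy, inner_graphPoint he]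
  -- On the graph a stationary abscissa forces a stationary ordinate, whereas the velocity `J y` of
  -- the arc has length `τ > 0`.
  have hne : (inner ℝ (J y) C.e : ℝ) ≠ 0 := by
    intro hz
    have h1 := (hcd C.e).hasDerivAt
    have h2 := (C.contDiff.differentiable one_ne_zero u₂).hasDerivAt
    have h3 : HasDerivAt (fun θ => C.g (inner ℝ (c θ) C.e))
        (deriv C.g u₂ * inner ℝ (J y) C.e) 0 :=
      HasDerivAt.comp_of_eq (h₂ := C.g) (0 : ℝ) h2 h1 hU0.symm
    have h4 : (fun θ => (inner ℝ (c θ) (J C.e) : ℝ)) =ᶠ[𝓝 0] fun θ => C.g (inner ℝ (c θ) C.e) := by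
      filter_upwards [hcF] with θ hθ
      exact (hC.mem_frontier_iff hθ.1).1 hθ.2
    have h5 := (hcd (J C.e)).hasDerivAt.unique (h3.congr_of_eventuallyEq h4)
    rw [hz, mul_zero] at h5
    have h6 := framePoint_inner he (J y)
    rw [hz, h5] at h6
    have h7 : ‖J y‖ = 0 := by rw [← h6]; simp [framePoint]
    rw [norm_J, hτ₂] at h7
    exact hτ.ne' h7
  have hmap := (hcd C.e).map_nhds_eq hne
  rw [hU0] at hmap
  refine hC.mem_Lam₁ hu₂ hτ ?_
  rw [← hmap, eventually_map]
  filter_upwards [hcF] with θ hθ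
  rw [← hC.eq_graphPoint hθ.1 hθ.2, hcn]

/-- Three distinct first coordinates would put the middle point in `Λ₁`. So at most two occur, and
each is shared by at most two points of the circle. -/
lemma Chart.Represents.finite_setOf_norm_eq (hC : C.Represents E)
    (hsymm : E \ {0} = capSymmetral E) (hopen : IsOpen E) (hΛ : Disjoint C.box (Lam₁ E)) {τ : ℝ}
    (hτ : 0 < τ) : {u | u ∈ Ioo C.a C.b ∧ ‖graphPoint C.e C.g u‖ = τ}.Finite := by
  refine Set.Finite.of_finite_fibers (fun u => (inner ℝ (graphPoint C.e C.g u) e₁ : ℝ)) ?_ ?_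
  · by_contra hinf
    obtain ⟨t, hts, ht3⟩ := Set.Infinite.exists_subset_card_eq hinf 3
    have hmem : ∀ i, t.orderEmbOfFin ht3 i ∈ (fun u => (inner ℝ (graphPoint C.e C.g u) e₁ : ℝ)) ''
        {u | u ∈ Ioo C.a C.b ∧ ‖graphPoint C.e C.g u‖ = τ} := fun i =>
      hts (Finset.orderEmbOfFin_mem t ht3 i)
    obtain ⟨u₁, ⟨h1, h1'⟩, e1⟩ := hmem 0
    obtain ⟨u₂, ⟨h2, h2'⟩, e2⟩ := hmem 1
    obtain ⟨u₃, ⟨h3, h3'⟩, e3⟩ := hmem 2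
    have h12 : t.orderEmbOfFin ht3 0 < t.orderEmbOfFin ht3 1 := by
      rw [OrderEmbedding.lt_iff_lt]; decide
    have h23 : t.orderEmbOfFin ht3 1 < t.orderEmbOfFin ht3 2 := by
      rw [OrderEmbedding.lt_iff_lt]; decide
    rw [← e1, ← e2] at h12
    rw [← e2, ← e3] at h23
    exact Set.disjoint_left.1 hΛ (Chart.graphPoint_mem_box h2)
      (hC.mem_Lam₁_of_between hsymm hopen hτ h1 h2 h3 h1' h2' h3' h12 h23)
  · intro z _
    have hfin : ({!₂[z, √(τ ^ 2 - z ^ 2)], !₂[z, -√(τ ^ 2 - z ^ 2)]} : Set Plane).Finite := by simp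
    refine (hfin.preimage (graphPoint_injective C.norm_e C.g).injOn).subset ?_
    rintro u ⟨⟨-, hu⟩, huz⟩
    set p := graphPoint C.e C.g u
    have hp0 : p 0 = z := by
      have : (inner ℝ p e₁ : ℝ) = z := huz
      rw [← this, inner_plane]; simp [e₁]
    have hp1 : p 1 ^ 2 = τ ^ 2 - z ^ 2 := by
      rw [← hu, norm_sq_plane, hp0]; ring
    have habs : |p 1| = √(τ ^ 2 - z ^ 2) := by rw [← hp1, Real.sqrt_sq_eq_abs]
    rcases abs_choice (p 1) with hc | hc
    · left; exact plane_ext (by simpa using hp0) (by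
        rw [← habs, hc]; simp [p])
    · right; exact plane_ext (by simpa using hp0) (by
        rw [← habs, hc]; simp [p])

/-- Away from `Λ₁`, almost no boundary point lies on a circle whose radius is a kink of `h`. -/
lemma Chart.Represents.ae_rhoMinus_eq_rhoPlus {h : ℝ → ℝ} (hconv : ConvexOn ℝ (Ici 0) h)
    (hC : C.Represents E) (hsymm : E \ {0} = capSymmetral E) (hopen : IsOpen E)
    (hΛ : Disjoint C.box (Lam₁ E)) (h0 : (0 : Plane) ∉ C.box) :
    ∀ᵐ u : ℝ, u ∈ Ioo C.a C.b →
      rhoMinus h ‖graphPoint C.e C.g u‖ = rhoPlus h ‖graphPoint C.e C.g u‖ := by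
  -- There are countably many kinks, and finitely many parameters for each.
  have hcount : (⋃ τ ∈ {τ : ℝ | 0 < τ ∧ rhoMinus h τ < rhoPlus h τ},
      {u | u ∈ Ioo C.a C.b ∧ ‖graphPoint C.e C.g u‖ = τ}).Countable :=
    (countable_kinks hconv).biUnion fun τ hτ =>
      (hC.finite_setOf_norm_eq hsymm hopen hΛ hτ.1).countable
  filter_upwards [hcount.ae_notMem volume] with u hu huI
  by_contra hne
  have hpos : 0 < ‖graphPoint C.e C.g u‖ :=
    norm_pos_iff.2 fun h => h0 (h ▸ Chart.graphPoint_mem_box huI)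
  refine hu (mem_biUnion (x := ‖graphPoint C.e C.g u‖) ⟨hpos, ?_⟩ ⟨huI, rfl⟩)
  exact lt_of_le_of_ne (rhoMinus_le_rhoPlus hconv hpos) hne

end LogConvexIso

namespace LogConvexIso

/-! ### Lagrange multipliers and the Euler–Lagrange equation -/

variable {C : Chart} {E : Set Plane} {h : ℝ → ℝ} {φ : ℝ → ℝ} {lam : ℝ}

/-- The derivative of the weighted area in the direction `-φ`. -/
noncomputable def Chart.mass (C : Chart) (h : ℝ → ℝ) (φ : ℝ → ℝ) : ℝ :=
  ∫ u in C.a..C.b, density h (graphPoint C.e C.g u) * φ u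

/-- The one-sided first variation inequality with multiplier `lam`. -/
def Chart.HasMultiplier (C : Chart) (h : ℝ → ℝ) (lam : ℝ) : Prop :=
  ∀ φ, C.IsTest φ → lam * C.mass h φ ≤ C.lenDeriv h φ

/-- Almost no point of the graph has the modulus of a kink of `h`. -/
def Chart.IsRegular (C : Chart) (h : ℝ → ℝ) : Prop :=
  ∀ᵐ u : ℝ, u ∈ Ioo C.a C.b →
    rhoMinus h ‖graphPoint C.e C.g u‖ = rhoPlus h ‖graphPoint C.e C.g u‖

lemma Chart.integral_congr_Ioo {F G : ℝ → ℝ} (hFG : ∀ᵐ u : ℝ, u ∈ Ioo C.a C.b → F u = G u) :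
    ∫ u in C.a..C.b, F u = ∫ u in C.a..C.b, G u := by
  refine intervalIntegral.integral_congr_ae ?_
  have hne : ∀ᵐ u : ℝ, u ≠ C.b := by simp [ae_iff]
  filter_upwards [hFG, hne] with u hu hub huI
  rw [uIoc_of_le C.a_lt_b.le] at huI
  exact hu ⟨huI.1, lt_of_le_of_ne huI.2 hub⟩

lemma Chart.mass_neg (φ : ℝ → ℝ) : C.mass h (fun u => -φ u) = -C.mass h φ := by
  simp only [Chart.mass, mul_neg, intervalIntegral.integral_neg]

/-- Away from kinks the radial derivative no longer depends on the sign of `φ`, which makes the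
first variation linear. -/
lemma Chart.IsRegular.lenDeriv_eq (hC : C.IsRegular h) (φ : ℝ → ℝ) :
    C.lenDeriv h φ = ∫ u in C.a..C.b, density h (graphPoint C.e C.g u) *
      (rhoPlus h ‖graphPoint C.e C.g u‖ * (φ u * C.g u / ‖graphPoint C.e C.g u‖) *
        graphSpeed C.g u + deriv C.g u * deriv φ u / graphSpeed C.g u) := by
  refine Chart.integral_congr_Ioo ?_
  filter_upwards [hC] with u hu huI
  have h1 : rho h ‖graphPoint C.e C.g u‖ = rhoPlus h ‖graphPoint C.e C.g u‖ := by
    rw [rho, hu huI]; ring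
  rw [radialDeriv_of_eq (hu huI), h1, inner_smul_right, inner_graphPoint_J C.norm_e]

lemma Chart.IsRegular.lenDeriv_neg (hC : C.IsRegular h) (φ : ℝ → ℝ) :
    C.lenDeriv h (fun u => -φ u) = -C.lenDeriv h φ := by
  rw [hC.lenDeriv_eq, hC.lenDeriv_eq, ← intervalIntegral.integral_neg]
  refine intervalIntegral.integral_congr fun u _ => ?_
  have : deriv (fun u => -φ u) u = -deriv φ u := deriv.fun_neg
  simp only [this]
  ring

/-- The left derivative in direction `φ` is minus the right derivative in direction `-φ`, and the
first variation is odd in a regular chart. -/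
lemma Chart.IsRegular.hasDerivAt_len (hC : C.IsRegular h) (hconv : ConvexOn ℝ (Ici 0) h)
    (hmono : MonotoneOn h (Ici 0)) (hφ : C.IsTest φ) (h0 : (0 : Plane) ∉ C.box) :
    HasDerivAt (fun s => C.len (density h) (C.perturb φ s)) (C.lenDeriv h φ) 0 := by
  have h1 := Chart.hasDerivWithinAt_len hconv hmono hφ h0
  have h2 := Chart.hasDerivWithinAt_len hconv hmono hφ.neg h0
  have h3 : HasDerivWithinAt (fun s : ℝ => -s) (-1) (Iio 0) 0 :=
    (hasDerivAt_neg (0 : ℝ)).hasDerivWithinAt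
  have h4 := HasDerivWithinAt.comp_of_eq (0 : ℝ) h2 h3
    (fun s hs => by simpa using (mem_Iio.1 hs)) (by simp)
  have h5 : HasDerivWithinAt (fun s => C.len (density h) (C.perturb φ s)) (C.lenDeriv h φ)
      (Iio 0) 0 := by
    rw [hC.lenDeriv_neg, neg_mul_neg, mul_one] at h4
    refine h4.congr (fun s _ => ?_) ?_
    · simp only [Function.comp_apply, Chart.perturb_neg, neg_neg]
    · simp only [Function.comp_apply, Chart.perturb_neg, neg_neg]
  have h6 := (hasDerivWithinAt_Iio_iff_Iic.1 h5).union (hasDerivWithinAt_Ioi_iff_Ici.1 h1)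
  rw [Iic_union_Ici] at h6
  exact hasDerivWithinAt_univ.1 h6

lemma Chart.mass_pos (hconv : ConvexOn ℝ (Ici 0) h)
    (hmono : MonotoneOn h (Ici 0)) (hφ : C.IsTest φ) (h0 : ∀ u, 0 ≤ φ u) {u : ℝ}
    (hu : u ∈ Ioo C.a C.b) (hpos : 0 < φ u) : 0 < C.mass h φ := by
  have hc : Continuous fun u => density h (graphPoint C.e C.g u) :=
    (continuous_density hconv hmono).comp (continuous_graphPoint C.contDiff.continuous)
  exact intervalIntegral.integral_pos C.a_lt_b (hc.mul hφ.1.continuous).continuousOn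
    (fun u _ => mul_nonneg (density_pos _ _).le (h0 u))
    ⟨u, Ioo_subset_Icc_self hu, mul_pos (density_pos _ _) hpos⟩

lemma Chart.exists_test (C : Chart) :
    ∃ φ, C.IsTest φ ∧ (∀ u, 0 ≤ φ u) ∧ ∃ u ∈ Ioo C.a C.b, 0 < φ u := by
  have hab := C.a_lt_b
  have hm : (C.a + C.b) / 2 ∈ Ioo C.a C.b := ⟨by linarith, by linarith⟩
  obtain ⟨f, hf1, hf2, hf3, hf4, hf5⟩ :=
    exists_contDiff_tsupport_subset (n := 1) (Ioo_mem_nhds hm.1 hm.2)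
  exact ⟨f, ⟨hf3, hf2, hf1⟩, fun u => (hf4 (mem_range_self u)).1, _, hm, by rw [hf5]; exact one_pos⟩

/-- Two regular charts with disjoint boxes have a common multiplier, which is valid in every chart
whose box is disjoint from one of them. -/
theorem IsMinimiser.exists_multiplier {v : ℝ} (hconv : ConvexOn ℝ (Ici 0) h)
    (hmono : MonotoneOn h (Ici 0)) (hmin : IsMinimiser (density h) v E)
    (hbdd : Bornology.IsBounded E) {D₀ D₁ : Chart} (hD₀ : D₀.Represents E) (hD₁ : D₁.Represents E)
    (hr₀ : D₀.IsRegular h) (hr₁ : D₁.IsRegular h) (h0₀ : (0 : Plane) ∉ D₀.box)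
    (h0₁ : (0 : Plane) ∉ D₁.box) (hdisj : Disjoint D₀.box D₁.box) :
    ∃ lam : ℝ, ∀ C : Chart, C.Represents E → (0 : Plane) ∉ C.box →
      (Disjoint C.box D₀.box ∨ Disjoint C.box D₁.box) → C.HasMultiplier h lam := by
  obtain ⟨ψ₀, ht₀, hn₀, u₀, hu₀, hp₀⟩ := D₀.exists_test
  obtain ⟨ψ₁, ht₁, hn₁, u₁, hu₁, hp₁⟩ := D₁.exists_test
  have hm₀ := Chart.mass_pos hconv hmono ht₀ hn₀ hu₀ hp₀
  have hm₁ := Chart.mass_pos hconv hmono ht₁ hn₁ hu₁ hp₁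
  have hd₀ := hr₀.hasDerivAt_len hconv hmono ht₀ h0₀
  have hd₁ := hr₁.hasDerivAt_len hconv hmono ht₁ h0₁
  -- The chart `D₀` restores the volume by a multiple of the fixed bump `ψ₀`, so the quotient does
  -- not depend on `C`.
  have key₀ : ∀ C : Chart, C.Represents E → (0 : Plane) ∉ C.box → Disjoint C.box D₀.box →
      C.HasMultiplier h (D₀.lenDeriv h ψ₀ / D₀.mass h ψ₀) := fun C hC h0 hd φ hφ =>
    hmin.first_variation hconv hmono hbdd hC hD₀ hd h0 hφ ht₀ hd₀ hm₀.ne'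
  have key₁ : ∀ C : Chart, C.Represents E → (0 : Plane) ∉ C.box → Disjoint C.box D₁.box →
      C.HasMultiplier h (D₁.lenDeriv h ψ₁ / D₁.mass h ψ₁) := fun C hC h0 hd φ hφ =>
    hmin.first_variation hconv hmono hbdd hC hD₁ hd h0 hφ ht₁ hd₁ hm₁.ne'
  -- The multiplier of `D₀` is tested in `D₁` with `ψ₁` and `-ψ₁`; regularity of `D₁` turns the two
  -- inequalities into an equality.
  have heq : D₁.lenDeriv h ψ₁ / D₁.mass h ψ₁ = D₀.lenDeriv h ψ₀ / D₀.mass h ψ₀ := by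
    have e1 := key₀ D₁ hD₁ h0₁ hdisj.symm ψ₁ ht₁
    have e2 := key₀ D₁ hD₁ h0₁ hdisj.symm _ ht₁.neg
    rw [Chart.mass_neg, hr₁.lenDeriv_neg] at e2
    rw [div_eq_iff hm₁.ne']
    linarith
  refine ⟨D₀.lenDeriv h ψ₀ / D₀.mass h ψ₀, fun C hC h0 hd => ?_⟩
  rcases hd with hd | hd
  · exact key₀ C hC h0 hd
  · rw [← heq]; exact key₁ C hC h0 hd

lemma Chart.HasMultiplier.lenDeriv_eq (hl : C.HasMultiplier h lam) (hC : C.IsRegular h)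
    (hφ : C.IsTest φ) : C.lenDeriv h φ = lam * C.mass h φ := by
  have h1 := hl φ hφ
  have h2 := hl _ hφ.neg
  rw [Chart.mass_neg, hC.lenDeriv_neg] at h2
  linarith

lemma Chart.IsTest.apply_eq_zero (hφ : C.IsTest φ) {u : ℝ} (hu : u ∉ Ioo C.a C.b) : φ u = 0 :=
  image_eq_zero_of_notMem_tsupport fun hu' => hu (hφ.2.2 hu')

/-- Truncation at `m` removes the radii about which convexity says nothing. Monotonicity makes the
radial term of the first variation measurable and bounded. -/
lemma monotone_rhoPlus_max (hconv : ConvexOn ℝ (Ici 0) h) {m : ℝ} (hm : 0 < m) :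
    Monotone fun τ => rhoPlus h (max τ m) := by
  intro τ τ' hττ
  have h1 : max τ m ≤ max τ' m := max_le_max_right m hττ
  have h2 : 0 < max τ m := hm.trans_le (le_max_right _ _)
  rcases h1.eq_or_lt with he | hlt
  · simp only [he, le_refl]
  · exact (rhoPlus_le_rhoMinus hconv h2 hlt).trans (rhoMinus_le_rhoPlus hconv (h2.trans hlt))

lemma hasDerivAt_of_rhoMinus_eq (hconv : ConvexOn ℝ (Ici 0) h) {τ : ℝ} (hτ : 0 < τ)
    (heq : rhoMinus h τ = rhoPlus h τ) : HasDerivAt h (rhoPlus h τ) τ := by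
  have h1 := hasDerivWithinAt_rhoMinus hconv hτ
  rw [heq] at h1
  have h2 := h1.union (hasDerivWithinAt_rhoPlus hconv hτ)
  rw [Iic_union_Ici] at h2
  exact hasDerivWithinAt_univ.1 h2

lemma hasDerivAt_norm_graphPoint {e : Plane} {g : ℝ → ℝ} (hg : ContDiff ℝ 1 g) {u : ℝ}
    (h0 : graphPoint e g u ≠ 0) : HasDerivAt (fun w => ‖graphPoint e g w‖)
      (inner ℝ (graphPoint e g u) (e + deriv g u • J e) / ‖graphPoint e g u‖) u := by
  have h1 := (hasDerivAt_norm_sq_graphPoint (e := e) hg u).sqrt (by simpa using h0)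
  have h2 : (fun w => ‖graphPoint e g w‖) = fun w => √(‖graphPoint e g w‖ ^ 2) := by
    ext w; rw [Real.sqrt_sq (norm_nonneg _)]
  rw [h2]
  refine h1.congr_deriv ?_
  rw [Real.sqrt_sq (norm_nonneg _)]
  have := norm_ne_zero_iff.2 h0
  field_simp

/-- The Euler–Lagrange equation in a regular chart. -/
theorem Chart.HasMultiplier.euler_lagrange (hl : C.HasMultiplier h lam)
    (hconv : ConvexOn ℝ (Ici 0) h) (hmono : MonotoneOn h (Ici 0)) (hC : C.IsRegular h) {m : ℝ}
    (hm : 0 < m) (hmC : ∀ x ∈ C.box, m ≤ ‖x‖) :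
    ∀ᵐ u : ℝ, u ∈ Ioo C.a C.b → ∃ g'', HasDerivAt (deriv C.g) g'' u ∧
      g'' / graphSpeed C.g u ^ 3 + rho h ‖graphPoint C.e C.g u‖ *
        (-inner ℝ (graphPoint C.e C.g u) (graphNormal C.e C.g u) / ‖graphPoint C.e C.g u‖) +
        lam = 0 := by
  have he := C.norm_e
  have hgc := C.contDiff.continuous
  have hg'c := C.contDiff.continuous_deriv_one
  have hpc := continuous_graphPoint (e := C.e) hgc
  have hSc := continuous_graphSpeed C.contDiff
  have hfc : Continuous fun u => density h (graphPoint C.e C.g u) :=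
    (continuous_density hconv hmono).comp hpc
  have hmγ : ∀ u ∈ Ioo C.a C.b, m ≤ ‖graphPoint C.e C.g u‖ := fun u hu =>
    hmC _ (Chart.graphPoint_mem_box hu)
  -- The coefficient of `deriv φ` in the first variation. It is Lipschitz on the base because `deriv
  -- g` is, which is where the `C^{1,1}` assumption permits integration by parts.
  set w : ℝ → ℝ := fun u => density h (graphPoint C.e C.g u) * (deriv C.g u / graphSpeed C.g u)
    with hw
  have hwl : LocallyLipschitz w := by
    have h1 : LocallyLipschitz (graphPoint C.e C.g) := by
      have : ContDiff ℝ 1 (graphPoint C.e C.g) := by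
        unfold graphPoint framePoint
        exact (contDiff_id.smul contDiff_const).add (C.contDiff.smul contDiff_const)
      exact this.locallyLipschitz
    have h2 : LocallyLipschitz fun y : ℝ => y / √(1 + y ^ 2) := by
      have : ContDiff ℝ 1 fun y : ℝ => y / √(1 + y ^ 2) :=
        contDiff_id.div ((by fun_prop : ContDiff ℝ 1 fun y : ℝ => 1 + y ^ 2).sqrt
          fun y => by positivity) fun y => by positivity
      exact this.locallyLipschitz
    have h3 : LocallyLipschitz fun p : ℝ × ℝ => p.1 * p.2 :=
      (contDiff_fst.mul contDiff_snd : ContDiff ℝ 1 fun p : ℝ × ℝ => p.1 * p.2).locallyLipschitz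
    exact h3.comp (((locallyLipschitz_density hconv hmono).comp h1).prodMk
      (h2.comp C.lip.locallyLipschitz))
  obtain ⟨Kw, hKw⟩ := (hwl.locallyLipschitzOn (s := uIcc C.a C.b)).exists_lipschitzOnWith_of_compact
    isCompact_uIcc
  have hwac := hKw.absolutelyContinuousOnInterval
  have hw'i := hwac.intervalIntegrable_deriv
  -- a measurable version of the radial term
  set R : ℝ → ℝ := fun u => density h (graphPoint C.e C.g u) *
    (rhoPlus h (max ‖graphPoint C.e C.g u‖ m) * (C.g u / max ‖graphPoint C.e C.g u‖ m) *
      graphSpeed C.g u) with hR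
  have hRi : IntervalIntegrable R volume C.a C.b := by
    have hmax : Continuous fun u => max ‖graphPoint C.e C.g u‖ m := by fun_prop
    have hmax0 : ∀ u, max ‖graphPoint C.e C.g u‖ m ≠ 0 := fun u =>
      (hm.trans_le (le_max_right _ _)).ne'
    have h1 : Continuous fun u => density h (graphPoint C.e C.g u) *
        (C.g u / max ‖graphPoint C.e C.g u‖ m * graphSpeed C.g u) :=
      hfc.mul ((hgc.div hmax hmax0).mul hSc)
    have h2 : IntervalIntegrable (fun u => rhoPlus h (max ‖graphPoint C.e C.g u‖ m))
        volume C.a C.b := by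
      have hmon := monotone_rhoPlus_max hconv hm
      have hmeas : Measurable fun u => rhoPlus h (max ‖graphPoint C.e C.g u‖ m) :=
        hmon.measurable.comp (hpc.norm.measurable)
      obtain ⟨B, hB⟩ := (isCompact_uIcc (a := C.a) (b := C.b)).exists_bound_of_continuousOn
        hpc.norm.continuousOn
      refine (intervalIntegrable_const (c := max |rhoPlus h (max 0 m)| |rhoPlus h (max B m)|)).mono_fun
        hmeas.aestronglyMeasurable ?_
      refine (ae_restrict_iff' measurableSet_uIoc).2 (Eventually.of_forall fun u hu => ?_)
      have hBu : ‖graphPoint C.e C.g u‖ ≤ B := by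
        have := hB u (uIoc_subset_uIcc hu)
        rwa [norm_norm] at this
      change |rhoPlus h (max ‖graphPoint C.e C.g u‖ m)| ≤ |max _ _|
      rw [abs_of_nonneg (le_max_of_le_left (abs_nonneg _))]
      exact abs_le_max_abs_abs (hmon (norm_nonneg _)) (hmon hBu)
    refine (h2.mul_continuousOn h1.continuousOn).congr (fun u _ => ?_)
    simp only [hR]; ring
  -- Once the derivative is moved off `φ`, the first variation reads `∫ φ Z = 0` for all smooth test
  -- functions, so `Z` vanishes almost everywhere.
  set Z : ℝ → ℝ := fun u => R u - deriv w u - lam * density h (graphPoint C.e C.g u) with hZ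
  have hZi : IntervalIntegrable Z volume C.a C.b :=
    (hRi.sub hw'i).sub ((hfc.const_mul lam).intervalIntegrable _ _)
  have hZon : IntegrableOn Z (Ioo C.a C.b) :=
    ((intervalIntegrable_iff_integrableOn_Ioc_of_le C.a_lt_b.le).1 hZi).mono_set
      Ioo_subset_Ioc_self
  have hZ0 : ∀ᵐ u : ℝ, u ∈ Ioo C.a C.b → Z u = 0 := by
    refine isOpen_Ioo.ae_eq_zero_of_integral_contDiff_smul_eq_zero hZon.locallyIntegrableOn
      fun φ hφs hφc hφI => ?_
    have hφ : C.IsTest φ := ⟨hφs.of_le (by exact_mod_cast le_top), hφc, hφI⟩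
    have hφa : φ C.a = 0 := hφ.apply_eq_zero fun h => lt_irrefl _ h.1
    have hφb : φ C.b = 0 := hφ.apply_eq_zero fun h => lt_irrefl _ h.2
    have hφcont := hφ.1.continuous
    obtain ⟨Kφ, hKφ⟩ := (hφ.1.locallyLipschitz.locallyLipschitzOn (s := uIcc C.a C.b)
      ).exists_lipschitzOnWith_of_compact isCompact_uIcc
    have hparts := hwac.integral_mul_deriv_eq_deriv_mul hKφ.absolutelyContinuousOnInterval
    rw [hφa, hφb, mul_zero, mul_zero, sub_zero, zero_sub] at hparts
    have hEL := hl.lenDeriv_eq hC hφ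
    rw [hC.lenDeriv_eq] at hEL
    have e1 : ∫ u in C.a..C.b, density h (graphPoint C.e C.g u) *
        (rhoPlus h ‖graphPoint C.e C.g u‖ * (φ u * C.g u / ‖graphPoint C.e C.g u‖) *
          graphSpeed C.g u + deriv C.g u * deriv φ u / graphSpeed C.g u) =
        ∫ u in C.a..C.b, (R u * φ u + w u * deriv φ u) := by
      refine Chart.integral_congr_Ioo (Eventually.of_forall fun u hu => ?_)
      simp only [hR, hw, max_eq_left (hmγ u hu)]
      ring
    have iR : IntervalIntegrable (fun u => R u * φ u) volume C.a C.b :=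
      hRi.mul_continuousOn hφcont.continuousOn
    have iw : IntervalIntegrable (fun u => w u * deriv φ u) volume C.a C.b :=
      (hwl.continuous.mul hφ.1.continuous_deriv_one).intervalIntegrable _ _
    have iw' : IntervalIntegrable (fun u => deriv w u * φ u) volume C.a C.b :=
      hw'i.mul_continuousOn hφcont.continuousOn
    have iM : IntervalIntegrable (fun u => lam * (density h (graphPoint C.e C.g u) * φ u))
        volume C.a C.b := ((hfc.mul hφcont).const_mul lam).intervalIntegrable _ _
    have e2 : ∫ u in C.a..C.b, φ u • Z u = 0 := by
      have e3 : ∫ u in C.a..C.b, φ u • Z u = ∫ u in C.a..C.b,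
          (R u * φ u - deriv w u * φ u - lam * (density h (graphPoint C.e C.g u) * φ u)) := by
        refine intervalIntegral.integral_congr fun u _ => ?_
        simp only [hZ, smul_eq_mul]; ring
      rw [e3, intervalIntegral.integral_sub (iR.sub iw') iM, intervalIntegral.integral_sub iR iw',
        intervalIntegral.integral_const_mul]
      rw [e1, intervalIntegral.integral_add iR iw, hparts, Chart.mass] at hEL
      linarith
    rw [intervalIntegral.integral_of_le C.a_lt_b.le, integral_Ioc_eq_integral_Ioo,
      setIntegral_eq_integral_of_forall_compl_eq_zero] at e2
    · exact e2
    · intro u hu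
      rw [hφ.apply_eq_zero hu, zero_smul]
  filter_upwards [hZ0, hC, C.lip.ae_differentiableAt_real] with u hZu hCu hdu hu
  have hγ0 : 0 < ‖graphPoint C.e C.g u‖ := hm.trans_le (hmγ u hu)
  have hγne : graphPoint C.e C.g u ≠ 0 := norm_pos_iff.1 hγ0
  refine ⟨_, hdu.hasDerivAt, ?_⟩
  set g'' := deriv (deriv C.g) u
  set τ := ‖graphPoint C.e C.g u‖ with hτ
  set S := graphSpeed C.g u with hS
  have hS0 : S ≠ 0 := (graphSpeed_pos _ _).ne'
  have hS2 : S ^ 2 = 1 + deriv C.g u ^ 2 := graphSpeed_sq _ _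
  have hrho : rho h τ = rhoPlus h τ := by rw [rho, hCu hu]; ring
  have hip : (inner ℝ (graphPoint C.e C.g u) (C.e + deriv C.g u • J C.e) : ℝ) =
      u + C.g u * deriv C.g u := by
    rw [inner_add_right, inner_smul_right, inner_graphPoint he, inner_graphPoint_J he]; ring
  have hin : (inner ℝ (graphPoint C.e C.g u) (graphNormal C.e C.g u) : ℝ) =
      (C.g u - u * deriv C.g u) / S := by
    rw [inner_eq_frame he, inner_graphPoint he, inner_graphPoint_J he, graphNormal,
      inner_framePoint he, inner_framePoint_J he, ← hS]
    field_simp; ring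
  have hdh : HasDerivAt (fun v => density h (graphPoint C.e C.g v))
      (density h (graphPoint C.e C.g u) * (rhoPlus h τ * ((u + C.g u * deriv C.g u) / τ))) u := by
    have h1 := hasDerivAt_norm_graphPoint C.contDiff hγne
    rw [hip] at h1
    have h2 := hasDerivAt_of_rhoMinus_eq hconv hγ0 (hCu hu)
    exact (h2.comp u h1).exp
  have hdq : HasDerivAt (fun v => deriv C.g v / graphSpeed C.g v) (g'' / S ^ 3) u := by
    refine (hdu.hasDerivAt.fun_div (hasDerivAt_graphSpeed hdu.hasDerivAt) hS0).congr_deriv ?_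
    change (g'' * S - deriv C.g u * (deriv C.g u * g'' / S)) / S ^ 2 = g'' / S ^ 3
    field_simp
    rw [hS2]; ring
  have hdw := (hdh.fun_mul hdq).deriv
  have hZ1 := hZu hu
  simp only [hZ, hR] at hZ1
  rw [max_eq_left (hmγ u hu)] at hZ1
  have hdw' : deriv w u = _ := hdw
  rw [hdw'] at hZ1
  have hf0 := density_pos h (graphPoint C.e C.g u)
  set F := density h (graphPoint C.e C.g u)
  have hZ2 : F * (rhoPlus h τ * (C.g u / τ) * S -
      rhoPlus h τ * ((u + C.g u * deriv C.g u) / τ) * (deriv C.g u / S) - g'' / S ^ 3 - lam) = 0 := by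
    linear_combination hZ1
  have hZ3 := (mul_eq_zero.1 hZ2).resolve_left hf0.ne'
  rw [hrho, hin]
  -- By `S² = 1 + g'²`, the radial term minus the derivative of the density along the graph leaves
  -- only the normal component of the position vector.
  have hid : rhoPlus h τ * (C.g u / τ) * S -
      rhoPlus h τ * ((u + C.g u * deriv C.g u) / τ) * (deriv C.g u / S) =
      rhoPlus h τ * ((C.g u - u * deriv C.g u) / S / τ) := by
    have hτ0 := hγ0.ne'
    field_simp
    rw [hS2]; ring
  rw [hid] at hZ3
  linear_combination -hZ3

end LogConvexIso

namespace LogConvexIso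

/-! ### Circular arcs -/

variable {C : Chart} {E : Set Plane} {h : ℝ → ℝ} {φ : ℝ → ℝ} {lam τ ε : ℝ}

/-- The graph of the chart is an arc of the circle of radius `τ` about the origin, above the origin
if `ε = 1` and below it if `ε = -1`. -/
structure Chart.IsArc (C : Chart) (τ ε : ℝ) : Prop where
  radius_pos : 0 < τ
  sign_sq : ε ^ 2 = 1
  sq_add_sq : ∀ u ∈ Ioo C.a C.b, u ^ 2 + C.g u ^ 2 = τ ^ 2
  sign_mul_pos : ∀ u ∈ Ioo C.a C.b, 0 < ε * C.g u
  add_mul_deriv : ∀ u ∈ Ioo C.a C.b, u + C.g u * deriv C.g u = 0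

/-- Orthogonality says that `u² + g²` has zero derivative. At a zero of `g` it would also force `u =
0`, that is, the origin; so `g` has constant sign, and the weak inequality at `u₀` determines it. -/
lemma Chart.isArc_of_inner_eq_zero (h0 : (0 : Plane) ∉ C.box)
    (horth : ∀ u ∈ Ioo C.a C.b,
      inner ℝ (graphPoint C.e C.g u) (C.e + deriv C.g u • J C.e) = (0 : ℝ))
    {u₀ : ℝ} (hu₀ : u₀ ∈ Ioo C.a C.b) (hε : ε ^ 2 = 1) (hε₀ : 0 ≤ ε * C.g u₀) :
    C.IsArc ‖graphPoint C.e C.g u₀‖ ε := by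
  have hne : ∀ u ∈ Ioo C.a C.b, graphPoint C.e C.g u ≠ 0 := fun u hu h =>
    h0 (h ▸ Chart.graphPoint_mem_box hu)
  have hns : ∀ u, ‖graphPoint C.e C.g u‖ ^ 2 = u ^ 2 + C.g u ^ 2 := fun u => by
    rw [graphPoint, norm_framePoint_sq C.norm_e]
  have horth' : ∀ u ∈ Ioo C.a C.b, u + C.g u * deriv C.g u = 0 := fun u hu => by
    rw [← horth u hu, inner_add_right, inner_smul_right, inner_graphPoint C.norm_e,
      inner_graphPoint_J C.norm_e]
    ring
  have hconst : ∀ u ∈ Ioo C.a C.b, u ^ 2 + C.g u ^ 2 = ‖graphPoint C.e C.g u₀‖ ^ 2 := by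
    intro u hu
    have hd : ∀ w ∈ Ioo C.a C.b, HasDerivAt (fun w => w ^ 2 + C.g w ^ 2) 0 w := fun w hw => by
      have h1 := (C.contDiff.differentiable one_ne_zero w).hasDerivAt
      refine ((hasDerivAt_pow 2 w).add (h1.pow 2)).congr_deriv ?_
      have := horth' w hw
      simp only [Nat.cast_ofNat, Nat.add_one_sub_one, pow_one]
      linear_combination 2 * this
    rw [hns]
    exact isOpen_Ioo.is_const_of_deriv_eq_zero isPreconnected_Ioo
      (fun w hw => (hd w hw).differentiableAt.differentiableWithinAt) (fun w hw => (hd w hw).deriv)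
      hu hu₀
  have hg0 : ∀ u ∈ Ioo C.a C.b, C.g u ≠ 0 := by
    intro u hu hgu
    have h1 := horth' u hu
    have h2 : ‖graphPoint C.e C.g u‖ ^ 2 = 0 := by
      rw [hns]; rw [hgu, zero_mul, add_zero] at h1; rw [hgu, h1]; norm_num
    exact hne u hu (norm_eq_zero.1 (pow_eq_zero_iff two_ne_zero |>.1 h2))
  have hε0 : ε ≠ 0 := by rintro rfl; norm_num at hε
  refine ⟨norm_pos_iff.2 (hne u₀ hu₀), hε, hconst, fun u hu => ?_, horth'⟩
  by_contra hle
  obtain ⟨w, hw, hw0⟩ := isPreconnected_Ioo.intermediate_value hu hu₀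
    (f := fun u => ε * C.g u) (continuous_const.mul C.contDiff.continuous).continuousOn
    ⟨not_lt.1 hle, hε₀⟩
  exact (mul_ne_zero hε0 (hg0 w hw)) hw0

namespace Chart.IsArc

lemma norm_graphPoint (hA : C.IsArc τ ε) {u : ℝ} (hu : u ∈ Ioo C.a C.b) :
    ‖graphPoint C.e C.g u‖ = τ := by
  have h1 : ‖graphPoint C.e C.g u‖ ^ 2 = τ ^ 2 := by
    rw [graphPoint, norm_framePoint_sq C.norm_e]; exact hA.sq_add_sq u hu
  exact (pow_left_inj₀ (norm_nonneg _) hA.radius_pos.le two_ne_zero).1 h1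

lemma ne_zero (hA : C.IsArc τ ε) {u : ℝ} (hu : u ∈ Ioo C.a C.b) : C.g u ≠ 0 := fun h =>
  (hA.sign_mul_pos u hu).ne' (by rw [h, mul_zero])

lemma deriv_eq (hA : C.IsArc τ ε) {u : ℝ} (hu : u ∈ Ioo C.a C.b) : deriv C.g u = -u / C.g u := by
  rw [eq_div_iff (hA.ne_zero hu)]
  linear_combination hA.add_mul_deriv u hu

lemma graphSpeed_eq (hA : C.IsArc τ ε) {u : ℝ} (hu : u ∈ Ioo C.a C.b) :
    graphSpeed C.g u = ε * τ / C.g u := by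
  have hg := hA.ne_zero hu
  have hpos : 0 < ε * τ / C.g u := by
    have h1 : ε * τ / C.g u = τ * (ε * C.g u) / C.g u ^ 2 := by field_simp
    rw [h1]
    exact div_pos (mul_pos hA.radius_pos (hA.sign_mul_pos u hu)) (by positivity)
  refine (pow_left_inj₀ (graphSpeed_pos _ _).le hpos.le two_ne_zero).1 ?_
  rw [graphSpeed_sq, hA.deriv_eq hu, div_pow, div_pow, mul_pow, hA.sign_sq, one_mul,
    ← hA.sq_add_sq u hu]
  field_simp
  ring

lemma hasCurvatureAt (hA : C.IsArc τ ε) (hC : C.Represents E) {u : ℝ} (hu : u ∈ Ioo C.a C.b) :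
    HasCurvatureAt E (graphPoint C.e C.g u) (-ε / τ) := by
  have hg := hA.ne_zero hu
  have hτ := hA.radius_pos.ne'
  have hε0 : ε ≠ 0 := left_ne_zero_of_mul (hA.sign_mul_pos u hu).ne'
  have h1 : HasDerivAt (fun u => -u / C.g u) (-τ ^ 2 / C.g u ^ 3) u := by
    refine ((hasDerivAt_neg u).fun_div (C.contDiff.differentiable one_ne_zero u).hasDerivAt
      hg).congr_deriv ?_
    rw [hA.deriv_eq hu, ← hA.sq_add_sq u hu]
    field_simp
    ring
  have h2 : HasDerivAt (deriv C.g) (-τ ^ 2 / C.g u ^ 3) u :=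
    h1.congr_of_eventuallyEq (eventually_of_mem (isOpen_Ioo.mem_nhds hu) fun w hw => hA.deriv_eq hw)
  have h3 := hC.hasCurvatureAt hu h2
  have h4 : -τ ^ 2 / C.g u ^ 3 / graphSpeed C.g u ^ 3 = -ε / τ := by
    rw [hA.graphSpeed_eq hu, div_pow, mul_pow,
      show ε ^ 3 = ε by rw [pow_succ, hA.sign_sq, one_mul]]
    field_simp
    rw [hA.sign_sq]
  rwa [h4] at h3

/-- The first variation of length along a circular arc. -/
lemma lenDeriv_eq (hA : C.IsArc τ ε) (hφ : C.IsTest φ) {P : ℝ}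
    (hP : ∀ u ∈ Ioo C.a C.b,
      radialDeriv h (graphPoint C.e C.g u) (φ u • J C.e) = P * (φ u * C.g u / τ)) :
    C.lenDeriv h φ = ε * (P + 1 / τ) * C.mass h φ := by
  have hτ := hA.radius_pos.ne'
  have hφ' := fun u => (hφ.1.differentiable one_ne_zero u).hasDerivAt
  have hφc := hφ.1.continuous
  have hφ'c := hφ.1.continuous_deriv_one
  set F := Real.exp (h τ)
  have hF : ∀ u ∈ Ioo C.a C.b, density h (graphPoint C.e C.g u) = F := fun u hu => by
    rw [density, hA.norm_graphPoint hu]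
  have e1 : C.mass h φ = ∫ u in C.a..C.b, F * φ u :=
    Chart.integral_congr_Ioo (Eventually.of_forall fun u hu => by rw [hF u hu])
  -- On the arc the density is constant and `g' / S = -ε u / τ`. Adding and subtracting `ε φ / τ`
  -- isolates the exact derivative of `u φ`, whose integral vanishes.
  have e2 : C.lenDeriv h φ = ∫ u in C.a..C.b,
      (ε * (P + 1 / τ) * (F * φ u) - F * ε / τ * (1 * φ u + u * deriv φ u)) := by
    refine Chart.integral_congr_Ioo (Eventually.of_forall fun u hu => ?_)
    have hg := hA.ne_zero hu
    have hε0 : ε ≠ 0 := left_ne_zero_of_mul (hA.sign_mul_pos u hu).ne'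
    have hε1 : 1 / ε = ε := by
      rw [div_eq_iff hε0, ← sq, hA.sign_sq]
    have h1 : deriv C.g u / graphSpeed C.g u = -ε * u / τ := by
      rw [hA.deriv_eq hu, hA.graphSpeed_eq hu]
      nth_rewrite 2 [← hε1]
      field_simp
    have h2 : P * (φ u * C.g u / τ) * graphSpeed C.g u = ε * P * φ u := by
      rw [hA.graphSpeed_eq hu]; field_simp
    rw [hP u hu, hF u hu, h2, mul_div_right_comm, h1]
    field_simp
    ring
  have hparts : ∫ u in C.a..C.b, (1 * φ u + u * deriv φ u) = 0 := by
    rw [intervalIntegral.integral_eq_sub_of_hasDerivAt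
      (f := fun u => u * φ u) (fun u _ => (hasDerivAt_id' u).fun_mul (hφ' u))
      (((continuous_const.mul hφc).add (continuous_id.mul hφ'c)).intervalIntegrable _ _),
      hφ.apply_eq_zero fun h => lt_irrefl _ h.1, hφ.apply_eq_zero fun h => lt_irrefl _ h.2]
    ring
  rw [e2, intervalIntegral.integral_sub, intervalIntegral.integral_const_mul (F * ε / τ), hparts, mul_zero, sub_zero,
    intervalIntegral.integral_const_mul, e1]
  · exact (by fun_prop : Continuous fun u => ε * (P + 1 / τ) * (F * φ u)).intervalIntegrable _ _
  · exact (by fun_prop : Continuous fun u =>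
      F * ε / τ * (1 * φ u + u * deriv φ u)).intervalIntegrable _ _

/-- The one-sided first variations along a circular arc bound the multiplier. -/
lemma multiplier_bounds (hA : C.IsArc τ ε) (hconv : ConvexOn ℝ (Ici 0) h)
    (hmono : MonotoneOn h (Ici 0)) (hl : C.HasMultiplier h lam) :
    rhoMinus h τ + 1 / τ ≤ ε * lam ∧ ε * lam ≤ rhoPlus h τ + 1 / τ := by
  -- A bump multiplied by `ε` moves the arc away from the origin and feels the right derivative of
  -- `h`; its negative moves the arc inwards and feels the left one.
  obtain ⟨φ, hφ, hφg, hm⟩ : ∃ φ, C.IsTest φ ∧ (∀ u ∈ Ioo C.a C.b, 0 ≤ φ u * C.g u) ∧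
      0 < ε * C.mass h φ := by
    obtain ⟨ψ, hψ, hψ0, u, hu, hψu⟩ := C.exists_test
    have hm := Chart.mass_pos hconv hmono hψ hψ0 hu hψu
    rcases sq_eq_one_iff.1 hA.sign_sq with rfl | rfl
    · refine ⟨ψ, hψ, fun w hw => mul_nonneg (hψ0 w) ?_, by rwa [one_mul]⟩
      have := hA.sign_mul_pos w hw
      linarith
    · refine ⟨_, hψ.neg, fun w hw => ?_, by rw [Chart.mass_neg]; linarith⟩
      have := hA.sign_mul_pos w hw
      exact mul_nonneg_of_nonpos_of_nonpos (by linarith [hψ0 w]) (by linarith)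
  have hin : ∀ (ψ : ℝ → ℝ) (u : ℝ),
      (inner ℝ (graphPoint C.e C.g u) (ψ u • J C.e) : ℝ) = ψ u * C.g u := fun ψ u => by
    rw [inner_smul_right, inner_graphPoint_J C.norm_e]
  have h1 := hA.lenDeriv_eq (h := h) hφ (P := rhoPlus h τ) fun u hu => by
    rw [radialDeriv, hin, if_pos (hφg u hu), hA.norm_graphPoint hu]
  have h2 := hA.lenDeriv_eq (h := h) hφ.neg (P := rhoMinus h τ) fun u hu => by
    rw [radialDeriv, hin (fun u => -φ u), hA.norm_graphPoint hu]
    -- Where `φ` vanishes `radialDeriv` takes the branch of `rhoPlus`, but the factor multiplying it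
    -- is zero.
    split_ifs with hle
    · have : φ u * C.g u = 0 := le_antisymm (by linarith) (hφg u hu)
      rw [neg_mul, this]; simp
    · rfl
  have h3 := hl φ hφ
  have h4 := hl _ hφ.neg
  rw [h1] at h3
  rw [h2, Chart.mass_neg] at h4
  set m := ε * C.mass h φ
  have hmm : C.mass h φ = ε * m := by
    simp only [m]; rw [← mul_assoc, ← sq, hA.sign_sq, one_mul]
  rw [hmm] at h3 h4
  have hε2 : ε * ε = 1 := by rw [← sq, hA.sign_sq]
  constructor
  · refine le_of_mul_le_mul_right ?_ hm
    linear_combination h4 - (rhoMinus h τ + 1 / τ) * m * hε2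
  · refine le_of_mul_le_mul_right ?_ hm
    linear_combination h3 + (rhoPlus h τ + 1 / τ) * m * hε2

end Chart.IsArc

end LogConvexIso

namespace LogConvexIso

/-! ### The global multiplier -/

variable {E : Set Plane} {h : ℝ → ℝ}

/-- One chart off the closure of `Λ₁` contains infinitely many boundary points, of which at most one
is the origin. Two are needed so that each boundary point can avoid one of the volume-restoring
charts. -/
lemma HasC11Boundary.exists_pair (hE : HasC11Boundary E)
    (hne : (frontier E \ closure (Lam₁ E)).Nonempty) :
    ∃ p ∈ frontier E \ closure (Lam₁ E), ∃ q ∈ frontier E \ closure (Lam₁ E),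
      p ≠ 0 ∧ q ≠ 0 ∧ p ≠ q := by
  obtain ⟨p, hp, hpΛ⟩ := hne
  obtain ⟨C, hC, -, hCΛ⟩ := hE.exists_chart hp (isClosed_closure.isOpen_compl.mem_nhds hpΛ)
  have hinj := graphPoint_injective C.norm_e C.g
  have hfin : {u | graphPoint C.e C.g u = 0}.Finite :=
    Set.Subsingleton.finite fun u hu w hw => hinj (hu.trans hw.symm)
  obtain ⟨u, ⟨hu, hu0⟩, w, ⟨hw, hw0⟩, huw⟩ := ((Ioo_infinite C.a_lt_b).sdiff hfin).nontrivial
  exact ⟨_, ⟨hC.graphPoint_mem_frontier hu, hCΛ (Chart.graphPoint_mem_box hu)⟩, _,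
    ⟨hC.graphPoint_mem_frontier hw, hCΛ (Chart.graphPoint_mem_box hw)⟩, hu0, hw0, hinj.ne huw⟩

lemma HasC11Boundary.exists_regular_chart (hE : HasC11Boundary E)
    (hconv : ConvexOn ℝ (Ici 0) h) (hsymm : E \ {0} = capSymmetral E) (hopen : IsOpen E)
    {p : Plane} (hp : p ∈ frontier E \ closure (Lam₁ E)) (hp0 : p ≠ 0) {W : Set Plane}
    (hW : W ∈ 𝓝 p) :
    ∃ C : Chart, C.Represents E ∧ C.box ⊆ W ∧ (0 : Plane) ∉ C.box ∧ C.IsRegular h := by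
  obtain ⟨C, hC, -, hCW⟩ := hE.exists_chart hp.1
    (inter_mem hW (inter_mem (isClosed_closure.isOpen_compl.mem_nhds hp.2)
      (isOpen_compl_singleton.mem_nhds hp0)))
  have h0 : (0 : Plane) ∉ C.box := fun hmem => (hCW hmem).2.2 rfl
  refine ⟨C, hC, fun x hx => (hCW hx).1, h0,
    hC.ae_rhoMinus_eq_rhoPlus hconv hsymm hopen ?_ h0⟩
  exact Set.disjoint_left.2 fun x hx hxΛ => (hCW hx).2.1 (subset_closure hxΛ)

/-- One multiplier serves for small charts at all boundary points away from the origin. -/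
theorem IsMinimiser.exists_global_multiplier {v : ℝ} (hmin : IsMinimiser (density h) v E)
    (hconv : ConvexOn ℝ (Ici 0) h) (hmono : MonotoneOn h (Ici 0))
    (hbdd : Bornology.IsBounded E) (hopen : IsOpen E) (hE : HasC11Boundary E)
    (hsymm : E \ {0} = capSymmetral E) (hne : (frontier E \ closure (Lam₁ E)).Nonempty) :
    ∃ lam : ℝ, ∀ x ∈ frontier E, x ≠ 0 → ∀ W ∈ 𝓝 x, ∃ C : Chart, C.Represents E ∧ x ∈ C.box ∧
      C.box ⊆ W ∧ (∀ y ∈ C.box, ‖x‖ / 2 ≤ ‖y‖) ∧ C.HasMultiplier h lam := by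
  obtain ⟨p, hp, q, hq, hp0, hq0, hpq⟩ := hE.exists_pair hne
  have hd : 0 < dist p q / 3 := by have := dist_pos.2 hpq; positivity
  -- A boundary point misses at least one of these closed balls, and a small chart there misses the
  -- restoring chart inside that ball.
  have hK : Disjoint (Metric.closedBall p (dist p q / 3)) (Metric.closedBall q (dist p q / 3)) :=
    Metric.closedBall_disjoint_closedBall (by linarith)
  obtain ⟨D₀, hD₀, hDp, h0₀, hr₀⟩ := hE.exists_regular_chart hconv hsymm hopen hp hp0
    (Metric.closedBall_mem_nhds p hd)
  obtain ⟨D₁, hD₁, hDq, h0₁, hr₁⟩ := hE.exists_regular_chart hconv hsymm hopen hq hq0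
    (Metric.closedBall_mem_nhds q hd)
  obtain ⟨lam, hlam⟩ := hmin.exists_multiplier hconv hmono hbdd hD₀ hD₁ hr₀ hr₁ h0₀ h0₁
    (hK.mono hDp hDq)
  refine ⟨lam, fun x hx hx0 W hW => ?_⟩
  have hx0' := norm_pos_iff.2 hx0
  have key : ∀ K : Set Plane, IsClosed K → x ∉ K →
      ∃ C : Chart, C.Represents E ∧ x ∈ C.box ∧ C.box ⊆ W ∧ (∀ y ∈ C.box, ‖x‖ / 2 ≤ ‖y‖) ∧
        Disjoint C.box K := by
    intro K hKc hxK
    have hN : {y : Plane | ‖x‖ / 2 < ‖y‖} ∈ 𝓝 x :=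
      (isOpen_lt continuous_const continuous_norm).mem_nhds (half_lt_self hx0')
    obtain ⟨C, hC, hxC, hCW⟩ := hE.exists_chart hx
      (inter_mem hW (inter_mem hN (hKc.isOpen_compl.mem_nhds hxK)))
    exact ⟨C, hC, hxC, fun y hy => (hCW hy).1, fun y hy => le_of_lt (hCW hy).2.1,
      Set.disjoint_left.2 fun y hy => (hCW hy).2.2⟩
  have h0 : ∀ C : Chart, (∀ y ∈ C.box, ‖x‖ / 2 ≤ ‖y‖) → (0 : Plane) ∉ C.box := fun C hC hmem => by
    have := hC 0 hmem
    rw [norm_zero] at this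
    linarith
  by_cases hxp : x ∈ Metric.closedBall p (dist p q / 3)
  · obtain ⟨C, hC, hxC, hCW, hCx, hCd⟩ := key _ Metric.isClosed_closedBall
      (Set.disjoint_left.1 hK hxp)
    exact ⟨C, hC, hxC, hCW, hCx, hlam C hC (h0 C hCx) (Or.inr (hCd.mono_right hDq))⟩
  · obtain ⟨C, hC, hxC, hCW, hCx, hCd⟩ := key _ Metric.isClosed_closedBall hxp
    exact ⟨C, hC, hxC, hCW, hCx, hlam C hC (h0 C hCx) (Or.inl (hCd.mono_right hDp))⟩

/-- The points of a small regular chart at which the Euler–Lagrange equation fails form a null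
set. -/
lemma Chart.HasMultiplier.hausdorffMeasure_eq_zero {C : Chart} {lam m : ℝ}
    (hl : C.HasMultiplier h lam) (hconv : ConvexOn ℝ (Ici 0) h) (hmono : MonotoneOn h (Ici 0))
    (hC : C.Represents E) (hr : C.IsRegular h) (hm : 0 < m) (hmC : ∀ x ∈ C.box, m ≤ ‖x‖) :
    Measure.hausdorffMeasure 1 {x | x ∈ frontier E ∧ x ∈ C.box ∧ ¬ ∃ k : ℝ, HasCurvatureAt E x k ∧
      k + rho h ‖x‖ * Real.sin (sigma E x) + lam = 0} = 0 := by
  have hEL := hl.euler_lagrange hconv hmono hr hm hmC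
  rw [ae_iff] at hEL
  refine measure_mono_null ?_ (C.hausdorffMeasure_image_eq_zero hEL
    fun u hu => (Classical.not_imp.1 hu).1)
  rintro x ⟨hx, hxC, hbad⟩
  have hu : inner ℝ x C.e ∈ Ioo C.a C.b := hxC.1
  have hxg := hC.eq_graphPoint hxC hx
  refine ⟨_, fun hgood => hbad ?_, hxg.symm⟩
  obtain ⟨g'', hg'', heq⟩ := hgood hu
  have hx0 : x ≠ 0 := norm_pos_iff.1 (hm.trans_le (hmC x hxC))
  have hn : innerNormal E x = graphNormal C.e C.g (inner ℝ x C.e) := by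
    conv_lhs => rw [hxg]
    exact hC.innerNormal_eq hu
  have hsin := (cos_sin_sigma (E := E) hx0 (by rw [hn, norm_graphNormal C.norm_e])).2
  have hcurv := hC.hasCurvatureAt hu hg''
  rw [← hxg] at hcurv heq
  exact ⟨_, hcurv, by rw [hsin, hn]; exact heq⟩

/-- At a point of `Λ₁` where the position vector is not tangent, the boundary is locally an arc
of a centred circle. -/
lemma HasC11Boundary.curvature_of_mem_Lam₁ (hE : HasC11Boundary E)
    (hbdd : Bornology.IsBounded E) (hconv : ConvexOn ℝ (Ici 0) h) (hmono : MonotoneOn h (Ici 0))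
    {lam : ℝ} {x : Plane} (hx0 : x ≠ 0) (hx : x ∈ Lam₁ E)
    (hlam : ∀ W ∈ 𝓝 x, ∃ C : Chart, C.Represents E ∧ x ∈ C.box ∧
      C.box ⊆ W ∧ (∀ y ∈ C.box, ‖x‖ / 2 ≤ ‖y‖) ∧ C.HasMultiplier h lam)
    {ε : ℝ} (hε : ε ^ 2 = 1) (hxε : 0 ≤ ε * inner ℝ x (innerNormal E x)) :
    HasCurvatureAt E x (-ε / ‖x‖) ∧ rhoMinus h ‖x‖ + 1 / ‖x‖ ≤ ε * lam ∧
      ε * lam ≤ rhoPlus h ‖x‖ + 1 / ‖x‖ := by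
  obtain ⟨hxE, ρ, hρ, hρΛ⟩ := hx
  obtain ⟨C, hC, hxC, hCρ, hCx, hl⟩ := hlam _ (Metric.ball_mem_nhds x hρ)
  have h0 : (0 : Plane) ∉ C.box := fun hmem => by
    have := hCx 0 hmem
    rw [norm_zero] at this
    linarith [norm_pos_iff.2 hx0]
  have hu : inner ℝ x C.e ∈ Ioo C.a C.b := hxC.1
  have hxg := hC.eq_graphPoint hxC hxE
  set u : ℝ := inner ℝ x C.e
  have horth : ∀ u ∈ Ioo C.a C.b,
      inner ℝ (graphPoint C.e C.g u) (C.e + deriv C.g u • J C.e) = (0 : ℝ) := fun u hu =>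
    hC.inner_eq_zero_of_mem_Lam₁ (hE.hausdorffMeasure_frontier_lt_top hbdd) hρΛ hCρ h0 hu
  -- A positive product: `⟨x, n⟩` and `g u` have the same sign, which carries `ε` over to the chart.
  have hgn : (inner ℝ x (innerNormal E x) : ℝ) * graphSpeed C.g u * C.g u = ‖x‖ ^ 2 := by
    have hS := (graphSpeed_pos C.g u).ne'
    have he := C.norm_e
    have h1 := horth u hu
    rw [inner_add_right, inner_smul_right, inner_graphPoint he, inner_graphPoint_J he] at h1
    rw [hxg, hC.innerNormal_eq hu, inner_eq_frame he, inner_graphPoint he, inner_graphPoint_J he,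
      graphNormal, inner_framePoint he, inner_framePoint_J he, graphPoint, norm_framePoint_sq he]
    field_simp
    linear_combination -u * h1
  have hεg : 0 ≤ ε * C.g u := by
    by_contra hneg
    have h1 : 0 < ‖x‖ ^ 2 := by have := norm_pos_iff.2 hx0; positivity
    have h2 : (ε * inner ℝ x (innerNormal E x)) * graphSpeed C.g u * (ε * C.g u) = ‖x‖ ^ 2 := by
      linear_combination hgn + (inner ℝ x (innerNormal E x) : ℝ) * graphSpeed C.g u * C.g u * hε
    have h3 := mul_nonpos_of_nonneg_of_nonpos (mul_nonneg hxε (graphSpeed_pos C.g u).le)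
      (not_le.1 hneg).le
    linarith
  have hA := Chart.isArc_of_inner_eq_zero h0 horth hu hε hεg
  have h1 := hA.hasCurvatureAt hC hu
  rw [← hxg] at hA h1
  exact ⟨h1, hA.multiplier_bounds hconv hmono hl⟩

end LogConvexIso

/-! ### Assembly of the three assertions. -/

open LogConvexIso in
theorem theorem6p5 (h : ℝ → ℝ) (hconv : ConvexOn ℝ (Set.Ici 0) h)
    (hmono : MonotoneOn h (Set.Ici 0)) (v : ℝ) (hv : 0 < v) (E : Set Plane)
    (hmin : IsMinimiser (density h) v E) (hbdd : Bornology.IsBounded E) (hopen : IsOpen E)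
    (hbdry : HasC11Boundary E) (hsymm : E \ {0} = capSymmetral E)
    (hne : (frontier E \ closure (Lam₁ E)).Nonempty) :
    ∃ lam : ℝ,
      (∀ᵐ x ∂((MeasureTheory.Measure.hausdorffMeasure 1 : MeasureTheory.Measure Plane).restrict
          (frontier E \ closure (Lam₁ E))),
        ∃ k : ℝ, HasCurvatureAt E x k ∧ k + rho h ‖x‖ * Real.sin (sigma E x) + lam = 0) ∧
      (∀ x ∈ Lam₁Plus E, ∃ k : ℝ, HasCurvatureAt E x k ∧
        rhoMinus h ‖x‖ - lam ≤ k ∧ k ≤ rhoPlus h ‖x‖ - lam) ∧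
      (∀ x ∈ Lam₁Minus E, ∃ k : ℝ, HasCurvatureAt E x k ∧
        -rhoPlus h ‖x‖ - lam ≤ k ∧ k ≤ -rhoMinus h ‖x‖ - lam) := by
  obtain ⟨lam, hlam⟩ :=
    hmin.exists_global_multiplier hconv hmono hbdd hopen hbdry hsymm hne
  refine ⟨lam, ?_, fun x hx => ?_, fun x hx => ?_⟩
  · rw [ae_restrict_iff' (isClosed_frontier.measurableSet.diff isClosed_closure.measurableSet),
      ae_iff]
    have hatoms : NullSingletonClass (Measure.hausdorffMeasure 1 : Measure Plane) :=
      Measure.nullSingletonClass_hausdorff Plane one_pos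
    set B : Set Plane := {x | ¬(x ∈ frontier E \ closure (Lam₁ E) → ∃ k : ℝ,
      HasCurvatureAt E x k ∧ k + rho h ‖x‖ * Real.sin (sigma E x) + lam = 0)} with hB
    -- The origin may lie on the boundary, where the charts give nothing, but a single point is
    -- null. Elsewhere it suffices that the exceptional set is locally null.
    have hB0 : Measure.hausdorffMeasure 1 (B \ {0}) = 0 := by
      refine measure_null_of_locally_null _ fun x hx => ?_
      obtain ⟨⟨hxE, hxΛ⟩, -⟩ := Classical.not_imp.1 hx.1
      obtain ⟨C, hC, hxC, hCΛ, hCx, hl⟩ := hlam x hxE hx.2 _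
        (isClosed_closure.isOpen_compl.mem_nhds hxΛ)
      have hx0 : 0 < ‖x‖ / 2 := half_pos (norm_pos_iff.2 hx.2)
      have h0 : (0 : Plane) ∉ C.box := fun hmem => by
        have := hCx 0 hmem
        rw [norm_zero] at this
        linarith
      have hr : C.IsRegular h := hC.ae_rhoMinus_eq_rhoPlus hconv hsymm hopen
        (Set.disjoint_left.2 fun y hy hyΛ => hCΛ hy (subset_closure hyΛ)) h0
      refine ⟨C.box ∩ (B \ {0}), inter_mem
        (mem_nhdsWithin_of_mem_nhds (C.isOpen_box.mem_nhds hxC)) self_mem_nhdsWithin,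
        measure_mono_null ?_ (hl.hausdorffMeasure_eq_zero hconv hmono hC hr hx0 hCx)⟩
      rintro y ⟨hyC, hyB, -⟩
      obtain ⟨hyE, hbad⟩ := Classical.not_imp.1 hyB
      exact ⟨hyE.1, hyC, hbad⟩
    refine measure_mono_null (fun x hx => ?_ : B ⊆ {0} ∪ B \ {0})
      (measure_union_null (measure_singleton 0) hB0)
    by_cases hx0 : x = 0
    · exact Or.inl hx0
    · exact Or.inr ⟨hx, hx0⟩
  · have hx0 : x ≠ 0 := by rintro rfl; simpa using hx.2
    -- The curvature is `-1 / |x|` here and `1 / |x|` in the last case; the multiplier bounds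
    -- rearrange to the claims.
    obtain ⟨h1, h2, h3⟩ := hbdry.curvature_of_mem_Lam₁ hbdd hconv hmono hx0 hx.1
      (hlam x hx.1.1 hx0) (ε := 1) (by norm_num) (by rw [one_mul]; exact hx.2.le)
    refine ⟨_, h1, ?_, ?_⟩ <;> rw [neg_div] <;> linarith
  · have hx0 : x ≠ 0 := by rintro rfl; simpa using hx.2
    obtain ⟨h1, h2, h3⟩ := hbdry.curvature_of_mem_Lam₁ hbdd hconv hmono hx0 hx.1
      (hlam x hx.1.1 hx0) (ε := -1) (by norm_num) (by linarith [hx.2])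
    refine ⟨_, h1, ?_, ?_⟩ <;> rw [neg_neg] <;> linarith
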